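/- Let $d,\sigma\in\mathbb N$ with $d\sigma\ge 2$, let $\mu\in\{1,-1\}$, and let $s<-\frac1{2\sigma+1}$. Consider the nonlinear Schrödinger equation $$i\partial_t\psi+\tfrac12\Delta\psi=\mu|\psi|^{2\sigma}\psi,\qquad x\in\mathbb R^d. \tag{NLS}$$ For $f\in\mathcal S(\mathbb R^d)$, $p\in[1,\infty]$ and $k\in\mathbb R$ put $\|f\|_{\mathcal F L^p_k}=\big\|(1+|\cdot|^2)^{k/2}\hat f\,\big\|_{L^p(\mathbb R^d)}$, where $\hat f(\xi)=(2\pi)^{-d}\int_{\mathbb R^d}e^{-ix\cdot\xi}f(x)\,dx$. Then there exist a sequence of initial data $(\psi_n(0))_n$ in $\mathcal S(\mathbb R^d)$ such that $$\|\psi_n(0)\|_{\mathcal F L^p_s}\longrightarrow 0\quad\text{as } n\to\infty,\qquad\text{for all } p\in[1,\infty],$$ and a sequence of times $t_n>0$ with $t_n\to0$ such that, for every $n$, (NLS) with initial datum $\psi_n(0)$ has a unique classical solution $\psi_n\in C([0,t_n];\mathcal S(\mathbb R^d))$ on $[0,t_n]$, and $$\|\psi_n(t_n)\|_{\mathcal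 F L^p_k}\longrightarrow\infty\quad\text{as } n\to\infty,\qquad\text{for all } k\in\mathbb R \text{ and all } p\in[1,\infty].$$ The data and the times depend neither on $p$ nor on $k$. -/

import Mathlib

open MeasureTheory Filter Topology
open scoped SchwartzMap ENNReal Laplacian

noncomputable section

/-- The Fourier transform with the normalization
`f̂(ξ) = (2π)⁻ᵈ ∫ e^{-i x·ξ} f(x) dx`, for `f` in the Schwartz space on `ℝᵈ`. -/
def fourierHat {d : ℕ} (f : 𝓢(EuclideanSpace ℝ (Fin d), ℂ))
    (ξ : EuclideanSpace ℝ (Fin d)) : ℂ :=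
  (1 / (2 * (Real.pi : ℂ)) ^ d) *
    ∫ x : EuclideanSpace ℝ (Fin d), Complex.exp (-(Complex.I * (inner ℝ x ξ : ℝ))) * f x

/-- The Fourier-Lebesgue norm `‖f‖_{FLᵖ_s} = ‖ ⟨·⟩ˢ f̂ ‖_{Lᵖ}`, where
`⟨ξ⟩ˢ = (1 + |ξ|²)^{s/2}`, of a Schwartz function (it is finite for every `s` and `p`). -/
def fourierLebesgueNorm {d : ℕ} (p : ℝ≥0∞) (s : ℝ)
    (f : 𝓢(EuclideanSpace ℝ (Fin d), ℂ)) : ℝ≥0∞ :=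
  eLpNorm (fun ξ : EuclideanSpace ℝ (Fin d) =>
    (((1 + ‖ξ‖ ^ 2) ^ (s / 2) : ℝ) : ℂ) * fourierHat f ξ) p volume

/-- `ψ` belongs to `C([0,T]; 𝓢(ℝᵈ))` and is a classical solution of
`i ∂ₜψ + ½ Δψ = μ |ψ|^{2σ} ψ` on `[0,T] × ℝᵈ` (the time derivative is one-sided at the
end points). -/
structure IsNLSSolution {d : ℕ} (σ : ℕ) (μ : ℝ) (T : ℝ)
    (ψ : ℝ → 𝓢(EuclideanSpace ℝ (Fin d), ℂ)) : Prop where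
  continuousOn : ContinuousOn ψ (Set.Icc 0 T)
  equation : ∀ t ∈ Set.Icc 0 T, ∀ x : EuclideanSpace ℝ (Fin d), ∃ v : ℂ,
    HasDerivWithinAt (fun τ => ψ τ x) v (Set.Icc 0 T) t ∧
      Complex.I * v + (1 / 2) * (Δ (ψ t)) x = (μ : ℂ) * (‖ψ t x‖ : ℂ) ^ (2 * σ) * ψ t x

end

/-!
Norm inflation for the nonlinear Schrödinger equation in Fourier–Lebesgue spaces of negative order.

The data are `φ = A ∑ⱼ e^{2πi N κⱼ·x} a(x)`, three plane waves of high frequency `N` under a common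
envelope `a`. In a space of negative order `s` their norm is of size `A Nˢ`, hence small, although
the amplitude `A` is large. The frequencies `κⱼ` are resonant: some interaction of `σ + 1` modes with
`σ` conjugated modes preserves the energy and has zero momentum, so that the nonlinearity feeds the
zero frequency coherently. After a time `t` this produces a term of size `t A^{2σ+1}` near frequency
zero, where all weights `⟨ξ⟩ᵏ` are comparable, and the scales can be chosen such that this term is
large (`exists_scales`). Since a pairing `∫ G ψ` with a fixed Schwartz function is controlled by
every Fourier–Lebesgue norm (`exists_enorm_integral_mul_le`), it is enough to show that one such
pairing blows up (`tendsto_fourierLebesgueNorm_top`).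

Everything takes place in the weakly nonlinear regime `t A^{2σ} → 0`. The Wiener norm `‖f̂‖_{L¹}` is
submultiplicative and invariant under the free flow, so that Picard iteration works on the time
interval needed. Weighted variants of that norm which also measure the decay in space dominate all
Schwartz seminorms; giving the weights a small coefficient makes these norms of the datum as close
as desired to its Wiener norm, so the iteration converges in the Schwartz space on the same time
interval (`exists_interaction_solution`). Working in the interaction picture `w(t) = e^{-itΔ/2} ψ(t)`
removes the unbounded operator from the equation; it also yields uniqueness by Gronwall's inequality
in the Wiener norm (`IsNLSSolution.unique`).

For the pairing, the linear evolution of the data is negligible, because free evolution preserves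
Fourier–Lebesgue norms. The nonlinear part is, up to errors of relative size `t + t A^{2σ} + t N`,
the first Duhamel iterate in which each plane wave is only rotated by its own phase
(`exists_norm_pairingCLM_solution_sub_le`). Expanding the power into plane waves, the time average
of this iterate converges to the number of resonant interactions times a nonzero constant
(`tendsto_average_pairingCLM_wavePacket`): nonzero momenta disappear by the Riemann–Lebesgue lemma,
nonzero energies by oscillation in time, since `t N² → ∞`.
-/

noncomputable section

open scoped NNReal

set_option linter.unusedSectionVars false

/-! ### Curves in the Schwartz space -/

section SchwartzCurves

variable {E F : Type} [NormedAddCommGroup E] [NormedSpace ℝ E]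
  [NormedAddCommGroup F] [NormedSpace ℝ F]

/-- Evaluation at a point, as a continuous linear functional on Schwartz functions. -/
def evalCLMAt (x : E) : 𝓢(E, F) →L[ℝ] F :=
  (BoundedContinuousFunction.evalCLM ℝ x).comp (SchwartzMap.toBoundedContinuousFunctionCLM ℝ E F)

theorem evalCLMAt_apply (x : E) (f : 𝓢(E, F)) : evalCLMAt x f = f x := rfl

theorem continuous_schwartz_eval {G : ℝ → 𝓢(E, F)} (hG : Continuous G) (x : E) :
    Continuous fun τ => G τ x :=
  (evalCLMAt (F := F) x).continuous.comp hG

theorem continuous_seminorm (k n : ℕ) :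
    Continuous (SchwartzMap.seminorm ℝ k n : 𝓢(E, F) → ℝ) :=
  (schwartz_withSeminorms ℝ E F).continuous_seminorm (k, n)

theorem hasFDerivAt_integral_schwartz {G : ℝ → 𝓢(E, F)} (hG : Continuous G) (a b : ℝ) (x : E) :
    HasFDerivAt (fun x => ∫ τ in a..b, G τ x)
      (∫ τ in a..b, SchwartzMap.fderivCLM ℝ E F (G τ) x) x := by
  have hG' : Continuous fun τ => SchwartzMap.fderivCLM ℝ E F (G τ) :=
    (SchwartzMap.fderivCLM ℝ E F).continuous.comp hG
  refine intervalIntegral.hasFDerivAt_integral_of_dominated_of_fderiv_le (𝕜 := ℝ)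
    (F' := fun x τ => SchwartzMap.fderivCLM ℝ E F (G τ) x)
    (bound := fun τ => SchwartzMap.seminorm ℝ 0 0 (SchwartzMap.fderivCLM ℝ E F (G τ)))
    (s := Set.univ) Filter.univ_mem ?_ ?_ ?_ ?_ ?_ ?_
  · exact Eventually.of_forall fun y => (continuous_schwartz_eval hG y).aestronglyMeasurable
  · exact (continuous_schwartz_eval hG x).intervalIntegrable _ _
  · exact (continuous_schwartz_eval hG' x).aestronglyMeasurable
  · exact ae_of_all _ fun τ _ y _ => SchwartzMap.norm_le_seminorm ℝ _ y
  · exact ((continuous_seminorm 0 0).comp hG').intervalIntegrable _ _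
  · exact ae_of_all _ fun τ _ y _ => (G τ).hasFDerivAt y

theorem fderiv_integral_schwartz {G : ℝ → 𝓢(E, F)} (hG : Continuous G) (a b : ℝ) :
    fderiv ℝ (fun x => ∫ τ in a..b, G τ x) =
      fun x => ∫ τ in a..b, SchwartzMap.fderivCLM ℝ E F (G τ) x :=
  funext fun x => (hasFDerivAt_integral_schwartz hG a b x).fderiv

theorem contDiff_integral_schwartz (n : ℕ) :
    ∀ {F : Type} [NormedAddCommGroup F] [NormedSpace ℝ F] {G : ℝ → 𝓢(E, F)},
      Continuous G → ∀ a b : ℝ, ContDiff ℝ n (fun x => ∫ τ in a..b, G τ x) := by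
  induction n with
  | zero =>
    intro F _ _ G hG a b
    have : Differentiable ℝ (fun x => ∫ τ in a..b, G τ x) := fun x =>
      (hasFDerivAt_integral_schwartz hG a b x).differentiableAt
    exact_mod_cast contDiff_zero.2 this.continuous
  | succ n ih =>
    intro F _ _ G hG a b
    have h : ContDiff ℝ ((n : WithTop ℕ∞) + 1) (fun x => ∫ τ in a..b, G τ x) := by
      rw [contDiff_succ_iff_fderiv]
      refine ⟨fun x => (hasFDerivAt_integral_schwartz hG a b x).differentiableAt, by simp, ?_⟩
      rw [fderiv_integral_schwartz hG]
      exact ih ((SchwartzMap.fderivCLM ℝ E F).continuous.comp hG) a b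
    exact_mod_cast h

theorem decay_integral_schwartz (k n : ℕ) (a b M : ℝ) :
    ∀ {F : Type} [NormedAddCommGroup F] [NormedSpace ℝ F] {G : ℝ → 𝓢(E, F)}, Continuous G →
      (∀ τ ∈ Set.uIcc a b, ∀ x, ‖x‖ ^ k * ‖iteratedFDeriv ℝ n (G τ) x‖ ≤ M) →
      ∀ x, ‖x‖ ^ k * ‖iteratedFDeriv ℝ n (fun x => ∫ τ in a..b, G τ x) x‖ ≤ M * |b - a| := by
  induction n with
  | zero =>
    intro F _ _ G hG hM x
    simp only [norm_iteratedFDeriv_zero] at hM ⊢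
    have h : ‖∫ τ in a..b, ‖x‖ ^ k • G τ x‖ ≤ M * |b - a| := by
      refine intervalIntegral.norm_integral_le_of_norm_le_const fun τ hτ => ?_
      rw [norm_smul, norm_pow, norm_norm]
      exact hM τ (Set.uIoc_subset_uIcc hτ) x
    rwa [intervalIntegral.integral_smul, norm_smul, norm_pow, norm_norm] at h
  | succ n ih =>
    intro F _ _ G hG hM x
    rw [← norm_iteratedFDeriv_fderiv, fderiv_integral_schwartz hG]
    refine ih ((SchwartzMap.fderivCLM ℝ E F).continuous.comp hG) (fun τ hτ y => ?_) x
    have := hM τ hτ y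
    rwa [← norm_iteratedFDeriv_fderiv] at this

theorem exists_seminorm_le_uIcc {G : ℝ → 𝓢(E, F)} (hG : Continuous G) (k n : ℕ) (a b : ℝ) :
    ∃ M, ∀ τ ∈ Set.uIcc a b, SchwartzMap.seminorm ℝ k n (G τ) ≤ M := by
  obtain ⟨M, hM⟩ := (isCompact_uIcc (a := a) (b := b)).bddAbove_image
    ((continuous_seminorm k n).comp hG).continuousOn
  exact ⟨M, fun τ hτ => hM ⟨τ, hτ, rfl⟩⟩

/-- The integral `∫ₐᵇ G(τ) dτ` of a continuous curve of Schwartz functions. The Schwartz space is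
not normed, so the integral is taken pointwise and shown to be a Schwartz function. -/
def schwartzIntegral (G : C(ℝ, 𝓢(E, F))) (a b : ℝ) : 𝓢(E, F) where
  toFun x := ∫ τ in a..b, G τ x
  smooth' := contDiff_infty.2 fun n => contDiff_integral_schwartz n G.continuous a b
  decay' k n := by
    obtain ⟨M, hM⟩ := exists_seminorm_le_uIcc G.continuous k n a b
    exact ⟨_, decay_integral_schwartz k n a b M G.continuous fun τ hτ x =>
      (SchwartzMap.le_seminorm ℝ k n (G τ) x).trans (hM τ hτ)⟩

theorem schwartzIntegral_apply (G : C(ℝ, 𝓢(E, F))) (a b : ℝ) (x : E) :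
    schwartzIntegral G a b x = ∫ τ in a..b, G τ x := rfl

theorem seminorm_schwartzIntegral_le (G : C(ℝ, 𝓢(E, F))) (a b : ℝ) (k n : ℕ) {M : ℝ}
    (hM : ∀ τ ∈ Set.uIcc a b, SchwartzMap.seminorm ℝ k n (G τ) ≤ M) :
    SchwartzMap.seminorm ℝ k n (schwartzIntegral G a b) ≤ M * |b - a| := by
  have hM0 : 0 ≤ M := (apply_nonneg _ _).trans (hM a Set.left_mem_uIcc)
  refine SchwartzMap.seminorm_le_bound ℝ k n _ (by positivity) ?_
  exact decay_integral_schwartz k n a b M G.continuous fun τ hτ x =>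
      (SchwartzMap.le_seminorm ℝ k n (G τ) x).trans (hM τ hτ)

/-- The fundamental theorem of calculus in the Schwartz space. -/
theorem tendsto_slope_schwartzIntegral [CompleteSpace F] (G : C(ℝ, 𝓢(E, F))) (a t : ℝ) :
    Tendsto (slope (schwartzIntegral G a) t) (𝓝[≠] t) (𝓝 (G t)) := by
  rw [(schwartz_withSeminorms ℝ E F).tendsto_nhds]
  rintro ⟨k, n⟩ ε hε
  have h1 : ∀ᶠ τ in 𝓝 t, SchwartzMap.seminorm ℝ k n (G τ - G t) < ε / 2 := by
    have hc : Continuous fun τ => SchwartzMap.seminorm ℝ k n (G τ - G t) :=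
      (continuous_seminorm k n).comp (G.continuous.sub continuous_const)
    have := hc.tendsto t
    rw [sub_self, map_zero] at this
    exact this.eventually (gt_mem_nhds (by positivity))
  obtain ⟨δ, hδ, hball⟩ := Metric.eventually_nhds_iff.1 h1
  filter_upwards [mem_nhdsWithin_of_mem_nhds (Metric.ball_mem_nhds t hδ), self_mem_nhdsWithin]
    with τ hτ hne
  have hne' : τ - t ≠ 0 := sub_ne_zero.2 hne
  have hrepr : slope (schwartzIntegral G a) t τ - G t =
      (τ - t)⁻¹ • schwartzIntegral (G - ContinuousMap.const ℝ (G t)) t τ := by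
    ext x
    have hi : ∀ u v : ℝ, IntervalIntegrable (fun s => G s x) volume u v := fun u v =>
      (continuous_schwartz_eval G.continuous x).intervalIntegrable _ _
    simp only [slope, vsub_eq_sub, sub_apply, smul_apply,
      schwartzIntegral_apply, ContinuousMap.sub_apply, ContinuousMap.const_apply]
    rw [intervalIntegral.integral_interval_sub_left (hi _ _) (hi _ _),
      intervalIntegral.integral_sub (hi _ _) (by simp), intervalIntegral.integral_const,
      smul_sub, smul_smul, inv_mul_cancel₀ hne', one_smul]
  have hb : SchwartzMap.seminorm ℝ k n
      (schwartzIntegral (G - ContinuousMap.const ℝ (G t)) t τ) ≤ ε / 2 * |τ - t| := by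
    refine seminorm_schwartzIntegral_le _ _ _ _ _ fun s hs => ?_
    refine (hball ?_).le
    rw [Real.dist_eq]
    exact (Set.abs_sub_left_of_mem_uIcc hs).trans_lt hτ
  change SchwartzMap.seminorm ℝ k n _ < ε
  rw [hrepr, map_smul_eq_mul, norm_inv, Real.norm_eq_abs]
  have habs : 0 < |τ - t| := abs_pos.2 hne'
  calc |τ - t|⁻¹ * _ ≤ |τ - t|⁻¹ * (ε / 2 * |τ - t|) := by gcongr
    _ = ε / 2 := by field_simp
    _ < ε := by linarith

end SchwartzCurves

section Slopes

variable {V : Type*} [AddCommGroup V] [Module ℝ V] [TopologicalSpace V]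

theorem continuousWithinAt_of_tendsto_slope [IsTopologicalAddGroup V] [ContinuousSMul ℝ V] {f : ℝ → V} {v : V} {s : Set ℝ} {t : ℝ}
    (h : Tendsto (slope f t) (𝓝[s \ {t}] t) (𝓝 v)) : ContinuousWithinAt f s t := by
  rw [← continuousWithinAt_sdiff_self]
  have h0 : Tendsto (fun τ : ℝ => τ - t) (𝓝[s \ {t}] t) (𝓝 0) := by
    have : Tendsto (fun τ : ℝ => τ - t) (𝓝 t) (𝓝 (t - t)) := (continuous_id.sub continuous_const).tendsto t
    rw [sub_self] at this
    exact this.mono_left nhdsWithin_le_nhds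
  have h1 := (h0.smul h).add_const (f t)
  rw [zero_smul, zero_add] at h1
  refine h1.congr fun τ => ?_
  simp

/-- The mean value inequality for a continuous seminorm on a topological vector space. -/
theorem seminorm_sub_le_of_tendsto_slope [IsTopologicalAddGroup V] {f f' : ℝ → V} {a b M : ℝ} (q : Seminorm ℝ V)
    (hq : Continuous q) (hf : ContinuousOn f (Set.Icc a b))
    (hf' : ∀ t ∈ Set.Ico a b, Tendsto (slope f t) (𝓝[>] t) (𝓝 (f' t)))
    (hM : ∀ t ∈ Set.Ico a b, q (f' t) ≤ M) :
    ∀ t ∈ Set.Icc a b, q (f t - f a) ≤ M * (t - a) := by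
  intro t ht
  refine le_of_forall_pos_le_add fun ε hε => ?_
  have key : ∀ η > 0, q (f t - f a) ≤ (M + η) * (t - a) := by
    intro η hη
    refine image_le_of_liminf_slope_right_lt_deriv_boundary (f := fun t => q (f t - f a))
      (f' := fun _ => M) (B := fun t => (M + η) * (t - a)) (B' := fun _ => M + η)
      (hq.comp_continuousOn (hf.sub continuousOn_const)) ?_ (by simp) ?_ ?_ ht
    · intro x hx r hr
      refine Eventually.frequently ?_
      have h1 : Tendsto (fun z => q (slope f x z)) (𝓝[>] x) (𝓝 (q (f' x))) :=
        (hq.tendsto _).comp (hf' x hx)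
      filter_upwards [h1.eventually (gt_mem_nhds ((hM x hx).trans_lt hr)), self_mem_nhdsWithin]
        with z hz hxz
      refine lt_of_le_of_lt ?_ hz
      have hpos : 0 < z - x := sub_pos.2 hxz
      simp only [slope, vsub_eq_sub, map_smul_eq_mul, smul_eq_mul, norm_inv, Real.norm_eq_abs,
        abs_of_pos hpos]
      gcongr
      have := map_add_le_add q (f z - f x) (f x - f a)
      rw [sub_add_sub_cancel] at this
      linarith
    · intro x
      simpa using ((hasDerivAt_id x).sub_const a).const_mul (M + η)
    · intro x _ _
      linarith
  rcases eq_or_lt_of_le ht.1 with h | h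
  · subst h; simpa using hε.le
  · have hpos : 0 < t - a := sub_pos.2 h
    have := key (ε / (t - a)) (by positivity)
    rw [add_mul, div_mul_cancel₀ _ hpos.ne'] at this
    exact this

theorem hasDerivWithinAt_clm_comp {Y : Type*} [NormedAddCommGroup Y] [NormedSpace ℝ Y]
    (L : V →L[ℝ] Y) {f : ℝ → V} {v : V} {s : Set ℝ} {t : ℝ}
    (h : Tendsto (slope f t) (𝓝[s \ {t}] t) (𝓝 v)) :
    HasDerivWithinAt (fun τ => L (f τ)) (L v) s t := by
  rw [hasDerivWithinAt_iff_tendsto_slope]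
  refine ((L.continuous.tendsto _).comp h).congr fun τ => ?_
  simp [slope]

end Slopes

section SchwartzCurves

variable {E F : Type} [NormedAddCommGroup E] [NormedSpace ℝ E]
  [NormedAddCommGroup F] [NormedSpace ℝ F]

theorem continuous_schwartzIntegral [CompleteSpace F] (G : C(ℝ, 𝓢(E, F))) (a : ℝ) :
    Continuous (schwartzIntegral G a) := by
  rw [continuous_iff_continuousAt]
  intro t
  rw [← continuousWithinAt_univ]
  refine continuousWithinAt_of_tendsto_slope (v := G t) ?_
  have := tendsto_slope_schwartzIntegral G a t
  rwa [Set.compl_eq_univ_sdiff] at this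

theorem schwartzIntegral_self (G : C(ℝ, 𝓢(E, F))) (a : ℝ) : schwartzIntegral G a a = 0 := by
  ext x
  simp [schwartzIntegral_apply]

theorem seminorm_schwartzIntegral_le_of_continuous [CompleteSpace F] (G : C(ℝ, 𝓢(E, F))) {a b M : ℝ}
    (hab : a ≤ b) (q : Seminorm ℝ 𝓢(E, F)) (hq : Continuous q)
    (hM : ∀ τ ∈ Set.Icc a b, q (G τ) ≤ M) :
    q (schwartzIntegral G a b) ≤ M * (b - a) := by
  have := seminorm_sub_le_of_tendsto_slope (f := schwartzIntegral G a) (f' := G) (b := b) q hq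
    (continuous_schwartzIntegral G a).continuousOn
    (fun t _ => (tendsto_slope_schwartzIntegral G a t).mono_left
      (nhdsWithin_mono _ fun z hz => ne_of_gt hz))
    (fun t ht => hM t (Set.Ico_subset_Icc_self ht)) b (Set.right_mem_Icc.2 hab)
  rwa [schwartzIntegral_self, sub_zero] at this

theorem clm_schwartzIntegral [CompleteSpace F] {Y : Type*} [NormedAddCommGroup Y] [NormedSpace ℝ Y]
    [CompleteSpace Y] (L : 𝓢(E, F) →L[ℝ] Y) (G : C(ℝ, 𝓢(E, F))) (a b : ℝ) :
    L (schwartzIntegral G a b) = ∫ τ in a..b, L (G τ) := by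
  have h := intervalIntegral.integral_eq_sub_of_hasDerivAt (a := a) (b := b)
    (f := fun t => L (schwartzIntegral G a t)) (f' := fun t => L (G t))
    (fun t _ => by
      rw [← hasDerivWithinAt_univ]
      refine hasDerivWithinAt_clm_comp L ?_
      rw [← Set.compl_eq_univ_sdiff]
      exact tendsto_slope_schwartzIntegral G a t)
    ((L.continuous.comp G.continuous).intervalIntegrable _ _)
  rw [h, schwartzIntegral_self, map_zero, sub_zero]

/-- Sequential completeness of the Schwartz space, for geometrically convergent sequences. -/
theorem exists_schwartz_limit [CompleteSpace F] (u : ℕ → 𝓢(E, F)) (C : ℕ → ℕ → ℝ)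
    (hC : ∀ k n m, SchwartzMap.seminorm ℝ k n (u (m + 1) - u m) ≤ C k n * (1 / 2) ^ m) :
    ∃ v : 𝓢(E, F), ∀ k n m,
      SchwartzMap.seminorm ℝ k n (v - u m) ≤ C k n * 2 * (1 / 2) ^ m := by
  have hsum : ∀ k n, Summable fun m : ℕ => C k n * (1 / 2 : ℝ) ^ m := fun k n =>
    (summable_geometric_of_lt_one (by norm_num) (by norm_num)).mul_left _
  have hbd : ∀ (n i : ℕ) (x : E), ‖iteratedFDeriv ℝ n (u (i + 1) - u i) x‖ ≤
      C 0 n * (1 / 2 : ℝ) ^ i := fun n i x =>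
    (SchwartzMap.norm_iteratedFDeriv_le_seminorm ℝ _ n x).trans (hC 0 n i)
  have hsm : ∀ i, ContDiff ℝ ((⊤ : ℕ∞) : WithTop ℕ∞) (u (i + 1) - u i) := fun i =>
    (u (i + 1) - u i).smooth _
  -- tails of the telescoping series
  have hD : ∀ m k n x, ‖x‖ ^ k *
      ‖iteratedFDeriv ℝ n (fun y => ∑' i, (u (i + m + 1) - u (i + m)) y) x‖ ≤
        C k n * 2 * (1 / 2) ^ m := by
    intro m k n x
    have hsm' : ∀ n, Summable fun i : ℕ => C 0 n * (1 / 2 : ℝ) ^ (i + m) := fun n =>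
      (summable_nat_add_iff m).2 (hsum 0 n)
    rw [iteratedFDeriv_tsum_apply (N := ⊤) (v := fun n i => C 0 n * (1 / 2 : ℝ) ^ (i + m))
      (fun i => hsm (i + m)) (fun n _ => hsm' n) (fun n i x _ => hbd n (i + m) x) le_top]
    have hs : Summable fun i => ‖iteratedFDeriv ℝ n (u (i + m + 1) - u (i + m)) x‖ :=
      Summable.of_nonneg_of_le (fun _ => norm_nonneg _) (fun i => hbd n (i + m) x) (hsm' n)
    calc ‖x‖ ^ k * ‖∑' i, iteratedFDeriv ℝ n (u (i + m + 1) - u (i + m)) x‖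
        ≤ ‖x‖ ^ k * ∑' i, ‖iteratedFDeriv ℝ n (u (i + m + 1) - u (i + m)) x‖ := by
          gcongr; exact norm_tsum_le_tsum_norm hs
      _ = ∑' i, ‖x‖ ^ k * ‖iteratedFDeriv ℝ n (u (i + m + 1) - u (i + m)) x‖ :=
          tsum_mul_left.symm
      _ ≤ ∑' i : ℕ, C k n * (1 / 2 : ℝ) ^ (i + m) := by
          refine Summable.tsum_le_tsum (fun i => ?_) (hs.mul_left _)
            ((summable_nat_add_iff m).2 (hsum k n))
          exact (SchwartzMap.le_seminorm ℝ k n _ x).trans (hC k n (i + m))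
      _ = C k n * 2 * (1 / 2) ^ m := by
          simp only [pow_add, tsum_mul_left, tsum_mul_right, tsum_geometric_two]
          ring
  let w : 𝓢(E, F) :=
    { toFun := fun y => ∑' i, (u (i + 0 + 1) - u (i + 0)) y
      smooth' := contDiff_tsum (N := ⊤) hsm (fun n _ => hsum 0 n) fun n i x _ => hbd n i x
      decay' := fun k n => ⟨_, hD 0 k n⟩ }
  refine ⟨w + u 0, fun k n m => ?_⟩
  have hpos : 0 ≤ C k n := by simpa using (apply_nonneg _ _).trans (hC k n 0)
  refine SchwartzMap.seminorm_le_bound ℝ k n _ (by positivity) fun x => ?_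
  have heq : ⇑(w + u 0 - u m) = fun y => ∑' i, (u (i + m + 1) - u (i + m)) y := by
    ext y
    have hsy : Summable fun i => (u (i + 1) - u i) y := by
      refine Summable.of_norm_bounded (hsum 0 0) fun i => ?_
      simpa using hbd 0 i y
    have h1 := hsy.sum_add_tsum_nat_add m
    have h2 : ∑ i ∈ Finset.range m, (u (i + 1) - u i) y = u m y - u 0 y := by
      simp only [sub_apply]
      exact Finset.sum_range_sub (fun i => u i y) m
    change (∑' i, (u (i + 1) - u i) y) + u 0 y - u m y = _
    rw [← h1, h2]
    abel
  rw [heq]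
  exact hD m k n x

end SchwartzCurves

/-! ### Operators on Schwartz functions -/

section Operators

open FourierTransform LineDeriv

variable {E : Type} [NormedAddCommGroup E] [InnerProductSpace ℝ E] [FiniteDimensional ℝ E]
  [MeasurableSpace E] [BorelSpace E]

/-- The pointwise product of Schwartz functions. -/
def schwartzMul (f g : 𝓢(E, ℂ)) : 𝓢(E, ℂ) :=
  SchwartzMap.pairing (ContinuousLinearMap.mul ℂ ℂ) f g

/-- The pointwise complex conjugate of a Schwartz function. -/
def schwartzConj : 𝓢(E, ℂ) →L[ℝ] 𝓢(E, ℂ) :=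
  SchwartzMap.postcompCLM (Complex.conjCLE : ℂ →L[ℝ] ℂ)

/-- The power nonlinearity `|f|^{2σ} f`, defined by recursion on `σ`. -/
def powerNonlinearity : ℕ → 𝓢(E, ℂ) → 𝓢(E, ℂ)
  | 0, f => f
  | σ + 1, f => schwartzMul (schwartzMul f (schwartzConj f)) (powerNonlinearity σ f)

/-- The symbol `e^{-2π² i t |ξ|²}` of the free Schrödinger group `e^{i t Δ / 2}`, for Mathlib's
normalization `e^{-2π i x·ξ}` of the Fourier transform. -/
def schrodingerSymbol (t : ℝ) (ξ : E) : ℂ :=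
  Complex.exp (((-(2 * Real.pi ^ 2 * t) * ‖ξ‖ ^ 2 : ℝ) : ℂ) * Complex.I)

/-- The free Schrödinger group `e^{i t Δ / 2}`. -/
def schrodingerGroup (t : ℝ) : 𝓢(E, ℂ) →L[ℂ] 𝓢(E, ℂ) :=
  SchwartzMap.fourierMultiplierCLM ℂ (schrodingerSymbol t)

/-- Multiplication by the linear function `x ↦ ⟨x, v⟩`. -/
def innerMul (v : E) : 𝓢(E, ℂ) →L[ℂ] 𝓢(E, ℂ) :=
  SchwartzMap.smulLeftCLM ℂ (fun x : E => ((inner ℝ x v : ℝ) : ℂ))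

theorem schwartzMul_apply (f g : 𝓢(E, ℂ)) (x : E) : schwartzMul f g x = f x * g x := rfl

theorem schwartzConj_apply (f : 𝓢(E, ℂ)) (x : E) :
    schwartzConj f x = (starRingEnd ℂ) (f x) := rfl

theorem innerMul_apply (v : E) (f : 𝓢(E, ℂ)) (x : E) :
    innerMul v f x = (inner ℝ x v : ℝ) * f x := by
  rw [innerMul, SchwartzMap.smulLeftCLM_apply_apply (by fun_prop), smul_eq_mul]

theorem powerNonlinearity_apply (σ : ℕ) (f : 𝓢(E, ℂ)) (x : E) :
    powerNonlinearity σ f x = (‖f x‖ : ℂ) ^ (2 * σ) * f x := by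
  induction σ with
  | zero => simp [powerNonlinearity]
  | succ σ ih =>
    rw [powerNonlinearity, schwartzMul_apply, schwartzMul_apply, schwartzConj_apply, ih,
      Complex.mul_conj, Complex.normSq_eq_norm_sq]
    push_cast
    ring

theorem hasTemperateGrowth_cexp_ofReal_mul_I :
    (fun r : ℝ => Complex.exp (r * Complex.I)).HasTemperateGrowth := by
  have hd : ∀ n : ℕ, iteratedDeriv n (fun r : ℝ => Complex.exp (r * Complex.I)) =
      fun r : ℝ => Complex.I ^ n * Complex.exp (r * Complex.I) := by
    intro n
    induction n with
    | zero => simp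
    | succ n ih =>
      rw [iteratedDeriv_succ, ih]
      ext r
      have h1 : HasDerivAt (fun r : ℝ => (r : ℂ) * Complex.I) Complex.I r := by
        simpa using (Complex.ofRealCLM.hasDerivAt (x := r)).mul_const Complex.I
      rw [(h1.cexp.const_mul (Complex.I ^ n)).deriv]
      ring
  refine ⟨(Complex.ofRealCLM.contDiff.mul contDiff_const).cexp, fun n => ⟨0, 1, fun r => ?_⟩⟩
  rw [norm_iteratedFDeriv_eq_norm_iteratedDeriv, hd]
  simp [Complex.norm_exp_ofReal_mul_I]

theorem hasTemperateGrowth_cexp_comp {h : E → ℝ} (hh : h.HasTemperateGrowth) :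
    (fun x : E => Complex.exp (h x * Complex.I)).HasTemperateGrowth :=
  hasTemperateGrowth_cexp_ofReal_mul_I.comp hh

theorem hasTemperateGrowth_schrodingerSymbol (t : ℝ) :
    (schrodingerSymbol t : E → ℂ).HasTemperateGrowth :=
  hasTemperateGrowth_cexp_comp (h := fun ξ : E => -(2 * Real.pi ^ 2 * t) * ‖ξ‖ ^ 2)
    ((Function.HasTemperateGrowth.const _).mul (by fun_prop))

theorem norm_schrodingerSymbol (t : ℝ) (ξ : E) : ‖schrodingerSymbol t ξ‖ = 1 :=
  Complex.norm_exp_ofReal_mul_I _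

theorem schrodingerSymbol_add (s t : ℝ) (ξ : E) :
    schrodingerSymbol (s + t) ξ = schrodingerSymbol s ξ * schrodingerSymbol t ξ := by
  rw [schrodingerSymbol, schrodingerSymbol, schrodingerSymbol, ← Complex.exp_add]
  congr 1
  push_cast
  ring

theorem schrodingerSymbol_zero (ξ : E) : schrodingerSymbol 0 ξ = 1 := by
  simp [schrodingerSymbol]

theorem fourier_schrodingerGroup (t : ℝ) (f : 𝓢(E, ℂ)) :
    𝓕 (schrodingerGroup t f) =
      SchwartzMap.smulLeftCLM ℂ (schrodingerSymbol t) (𝓕 f) := by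
  rw [schrodingerGroup, SchwartzMap.fourierMultiplierCLM_apply, FourierTransform.fourier_fourierInv_eq]

theorem fourier_schrodingerGroup_apply (t : ℝ) (f : 𝓢(E, ℂ)) (ξ : E) :
    𝓕 (schrodingerGroup t f) ξ = schrodingerSymbol t ξ * 𝓕 f ξ := by
  rw [fourier_schrodingerGroup,
    SchwartzMap.smulLeftCLM_apply_apply (hasTemperateGrowth_schrodingerSymbol t), smul_eq_mul]

theorem schwartz_ext_fourier {f g : 𝓢(E, ℂ)} (h : ∀ ξ, 𝓕 f ξ = 𝓕 g ξ) : f = g := by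
  have : 𝓕 f = 𝓕 g := by ext ξ; exact h ξ
  rw [← FourierTransform.fourierInv_fourier_eq (E := 𝓢(E, ℂ)) (F := 𝓢(E, ℂ)) f, this,
    FourierTransform.fourierInv_fourier_eq]

theorem schrodingerGroup_add (s t : ℝ) (f : 𝓢(E, ℂ)) :
    schrodingerGroup (s + t) f = schrodingerGroup s (schrodingerGroup t f) := by
  refine schwartz_ext_fourier fun ξ => ?_
  simp only [fourier_schrodingerGroup_apply, schrodingerSymbol_add]
  ring

theorem schrodingerGroup_zero (f : 𝓢(E, ℂ)) : schrodingerGroup 0 f = f := by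
  refine schwartz_ext_fourier fun ξ => ?_
  simp only [fourier_schrodingerGroup_apply, schrodingerSymbol_zero, one_mul]

theorem fourier_lineDerivOp_apply (v : E) (f : 𝓢(E, ℂ)) (ξ : E) :
    𝓕 (∂_{v} f) ξ = (2 * Real.pi * Complex.I) * ((inner ℝ ξ v : ℝ) * 𝓕 f ξ) := by
  rw [SchwartzMap.fourier_lineDerivOp_eq, smul_apply,
    SchwartzMap.smulLeftCLM_apply_apply (by fun_prop)]
  simp

theorem fourier_innerMul_apply (v : E) (f : 𝓢(E, ℂ)) (ξ : E) :
    -(2 * Real.pi * Complex.I) * 𝓕 (innerMul v f) ξ = (∂_{v} (𝓕 f)) ξ := by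
  have h : innerMul v f = SchwartzMap.smulLeftCLM ℂ (fun x : E => (inner ℝ x v : ℝ)) f :=
    SchwartzMap.smulLeftCLM_ofReal ℂ (g := fun x : E => (inner ℝ x v : ℝ)) (by fun_prop) f
  rw [SchwartzMap.lineDerivOp_fourier_eq, FourierTransform.fourier_smul, smul_apply, h, smul_eq_mul]

theorem fourier_laplacian_apply (f : 𝓢(E, ℂ)) (ξ : E) :
    𝓕 (Δ f) ξ = -(2 * Real.pi) ^ 2 * ‖ξ‖ ^ 2 * 𝓕 f ξ := by
  rw [SchwartzMap.laplacian_eq_fourierMultiplierCLM, FourierTransform.fourier_smul,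
    SchwartzMap.fourierMultiplierCLM_apply, FourierTransform.fourier_fourierInv_eq, smul_apply,
    SchwartzMap.smulLeftCLM_apply_apply (by fun_prop)]
  simp only [Complex.real_smul]
  push_cast
  ring

theorem lineDerivOp_eq_of_hasFDerivAt {f : 𝓢(E, ℂ)} {v x : E} {L : E →L[ℝ] ℂ}
    (h : HasFDerivAt f L x) : (∂_{v} f) x = L v := by
  rw [SchwartzMap.lineDerivOp_apply_eq_fderiv, h.fderiv]

/-- The vector field `x - i t ∇` intertwines with the free group: `x e^{itΔ/2} = e^{itΔ/2}
(x - i t ∇)`. -/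
theorem innerMul_schrodingerGroup (t : ℝ) (v : E) (f : 𝓢(E, ℂ)) :
    innerMul v (schrodingerGroup t f) =
      schrodingerGroup t (innerMul v f - (Complex.I * t) • ∂_{v} f) := by
  refine schwartz_ext_fourier fun ξ => ?_
  have hpi : -(2 * (Real.pi : ℂ) * Complex.I) ≠ 0 := by simp [Real.pi_ne_zero]
  apply mul_left_cancel₀ hpi
  rw [fourier_innerMul_apply, fourier_schrodingerGroup_apply]
  have hsub : 𝓕 (innerMul v f - (Complex.I * t) • ∂_{v} f) =
      𝓕 (innerMul v f) - (Complex.I * t) • 𝓕 (∂_{v} f) := by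
    rw [sub_eq_add_neg, FourierTransform.fourier_add, ← neg_smul, FourierTransform.fourier_smul,
      neg_smul, ← sub_eq_add_neg]
  rw [hsub, sub_apply, smul_apply, fourier_lineDerivOp_apply]
  have hinner : HasFDerivAt (fun ξ : E => ‖ξ‖ ^ 2) (2 • (innerSL ℝ ξ)) ξ :=
    (hasStrictFDerivAt_norm_sq ξ).hasFDerivAt
  have hsym : HasFDerivAt (schrodingerSymbol t : E → ℂ)
      (schrodingerSymbol t ξ • ((Complex.I : ℂ) •
        (Complex.ofRealCLM.comp ((-(2 * Real.pi ^ 2 * t)) • (2 • (innerSL ℝ ξ)))))) ξ := by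
    have h1 := (Complex.ofRealCLM.hasFDerivAt.comp ξ
      (hinner.const_mul (-(2 * Real.pi ^ 2 * t)))).mul_const Complex.I
    exact h1.cexp
  have hprod := hsym.mul (SchwartzMap.hasFDerivAt (𝓕 f : 𝓢(E, ℂ)) ξ)
  have hfun : (schrodingerSymbol t * ⇑(𝓕 f : 𝓢(E, ℂ)) : E → ℂ) =
      ⇑(𝓕 (schrodingerGroup t f) : 𝓢(E, ℂ)) :=
    funext fun ξ => (fourier_schrodingerGroup_apply t f ξ).symm
  rw [hfun] at hprod
  rw [lineDerivOp_eq_of_hasFDerivAt hprod]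
  have h2 := fourier_innerMul_apply v f ξ
  rw [SchwartzMap.lineDerivOp_apply_eq_fderiv] at h2
  simp only [add_apply, smul_apply, smul_eq_mul, ← h2,
    ContinuousLinearMap.comp_apply, Complex.ofRealCLM_apply, innerSL_apply_apply, nsmul_eq_mul]
  push_cast
  linear_combination (-4 * schrodingerSymbol t ξ * (Real.pi : ℂ) ^ 2 * 𝓕 f ξ * t *
    (inner ℝ ξ v : ℝ) * Complex.I) * Complex.I_mul_I

theorem fourier_schwartzConj_apply (f : 𝓢(E, ℂ)) (ξ : E) :
    𝓕 (schwartzConj f) ξ = (starRingEnd ℂ) (𝓕 f (-ξ)) := by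
  rw [SchwartzMap.fourier_coe, SchwartzMap.fourier_coe, Real.fourier_eq', Real.fourier_eq',
    ← integral_conj]
  congr 1
  ext x
  rw [schwartzConj_apply, smul_eq_mul, smul_eq_mul, map_mul, ← Complex.exp_conj]
  congr 2
  simp [Complex.conj_ofNat]

end Operators

/-! ### Wiener-type norms -/

section Wiener

open FourierTransform LineDeriv
open scoped NNReal

variable {E : Type} [NormedAddCommGroup E] [InnerProductSpace ℝ E] [FiniteDimensional ℝ E]
  [MeasurableSpace E] [BorelSpace E]

theorem integrable_weight_mul_norm (ε : ℝ) (m : ℕ) (g : 𝓢(E, ℂ)) :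
    Integrable fun ξ : E => (1 + ε * ‖ξ‖) ^ m * ‖g ξ‖ := by
  have h : (fun ξ : E => (1 + ε * ‖ξ‖) ^ m * ‖g ξ‖) = fun ξ => ∑ i ∈ Finset.range (m + 1),
      (ε ^ (m - i) * (m.choose i : ℝ)) * (‖ξ‖ ^ (m - i) * ‖g ξ‖) := by
    ext ξ
    rw [add_pow, Finset.sum_mul]
    refine Finset.sum_congr rfl fun i _ => ?_
    rw [mul_pow, one_pow]
    ring
  rw [h]
  exact integrable_finsetSum _ fun i _ => (g.integrable_pow_mul volume (m - i)).const_mul _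

/-- The weighted Wiener norm `∫ (1 + ε|ξ|)^m |𝓕 f(ξ)| dξ`. It is submultiplicative, and invariant
under the free Schrödinger group. -/
def wienerSeminorm (ε : ℝ≥0) (m : ℕ) : Seminorm ℂ 𝓢(E, ℂ) :=
  Seminorm.of (fun f => ∫ ξ, (1 + ε * ‖ξ‖) ^ m * ‖𝓕 f ξ‖)
    (fun f g => by
      rw [← integral_add (integrable_weight_mul_norm _ _ _) (integrable_weight_mul_norm _ _ _)]
      refine integral_mono (integrable_weight_mul_norm _ _ _)
        ((integrable_weight_mul_norm _ _ _).add (integrable_weight_mul_norm _ _ _)) fun ξ => ?_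
      simp only [FourierTransform.fourier_add, add_apply]
      rw [← mul_add]
      gcongr
      exact norm_add_le _ _)
    (fun c f => by
      simp only [FourierTransform.fourier_smul, smul_apply, norm_smul]
      rw [← integral_const_mul]
      congr 1
      ext ξ
      ring)

theorem wienerSeminorm_apply (ε : ℝ≥0) (m : ℕ) (f : 𝓢(E, ℂ)) :
    wienerSeminorm ε m f = ∫ ξ, (1 + ε * ‖ξ‖) ^ m * ‖𝓕 f ξ‖ := rfl

theorem wienerSeminorm_zero_apply (ε : ℝ≥0) (f : 𝓢(E, ℂ)) :
    wienerSeminorm ε 0 f = ∫ ξ, ‖𝓕 f ξ‖ := by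
  simp [wienerSeminorm_apply]

theorem wienerSeminorm_le_of_le {ε : ℝ≥0} {m n : ℕ} {f g : 𝓢(E, ℂ)} {C : ℝ}
    (h : ∀ ξ, (1 + ε * ‖ξ‖) ^ m * ‖𝓕 f ξ‖ ≤ C * ((1 + ε * ‖ξ‖) ^ n * ‖𝓕 g ξ‖)) :
    wienerSeminorm ε m f ≤ C * wienerSeminorm ε n g := by
  rw [wienerSeminorm_apply, wienerSeminorm_apply, ← integral_const_mul]
  exact integral_mono (integrable_weight_mul_norm _ _ _)
    ((integrable_weight_mul_norm _ _ _).const_mul _) h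

theorem wienerSeminorm_mono (ε : ℝ≥0) {m n : ℕ} (hmn : m ≤ n) (f : 𝓢(E, ℂ)) :
    wienerSeminorm ε m f ≤ wienerSeminorm ε n f := by
  rw [← one_mul (wienerSeminorm ε n f)]
  refine wienerSeminorm_le_of_le fun ξ => ?_
  rw [one_mul]
  have : (1 : ℝ) ≤ 1 + ε * ‖ξ‖ := le_add_of_nonneg_right (by positivity)
  gcongr

theorem wienerSeminorm_eq_fourierInv (ε : ℝ≥0) (m : ℕ) (f : 𝓢(E, ℂ)) :
    wienerSeminorm ε m f = ∫ ξ, (1 + ε * ‖ξ‖) ^ m * ‖(𝓕⁻ f : 𝓢(E, ℂ)) ξ‖ := by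
  rw [wienerSeminorm_apply, ← integral_neg_eq_self]
  simp only [norm_neg]
  rfl

theorem wienerSeminorm_schwartzMul_le (ε : ℝ≥0) (m : ℕ) (f g : 𝓢(E, ℂ)) :
    wienerSeminorm ε m (schwartzMul f g) ≤ wienerSeminorm ε m f * wienerSeminorm ε m g := by
  simp only [wienerSeminorm_eq_fourierInv]
  set u : 𝓢(E, ℂ) := 𝓕⁻ f with hu
  set v : 𝓢(E, ℂ) := 𝓕⁻ g with hv
  have hconv : ∀ ξ, (𝓕⁻ (schwartzMul f g) : 𝓢(E, ℂ)) ξ = ∫ η, u η * v (ξ - η) := by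
    intro ξ
    have : (𝓕⁻ (schwartzMul f g) : 𝓢(E, ℂ)) =
        SchwartzMap.convolution (ContinuousLinearMap.mul ℂ ℂ) u v := by
      simp [SchwartzMap.convolution, hu, hv, schwartzMul]
    rw [this, SchwartzMap.convolution_apply, convolution_def]
    simp
  set wu : E → ℝ := fun ξ => (1 + ε * ‖ξ‖) ^ m * ‖u ξ‖ with hwu
  set wv : E → ℝ := fun ξ => (1 + ε * ‖ξ‖) ^ m * ‖v ξ‖ with hwv
  have iu : Integrable wu := integrable_weight_mul_norm _ _ _
  have iv : Integrable wv := integrable_weight_mul_norm _ _ _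
  have hI := integral_convolution (ContinuousLinearMap.mul ℝ ℝ) iu iv (μ := volume) (ν := volume)
  have hIc := Integrable.integrable_convolution (ContinuousLinearMap.mul ℝ ℝ) iu iv
  rw [ContinuousLinearMap.mul_apply'] at hI
  rw [← hI]
  refine integral_mono_ae (integrable_weight_mul_norm _ _ _) hIc ?_
  filter_upwards [iu.ae_convolution_exists (ContinuousLinearMap.mul ℝ ℝ) iv] with ξ hξ
  rw [convolution_def]
  simp only [hconv, ContinuousLinearMap.mul_apply']
  have hξ' : Integrable fun η => wu η * wv (ξ - η) := hξ
  calc (1 + ε * ‖ξ‖) ^ m * ‖∫ η, u η * v (ξ - η)‖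
      ≤ (1 + ε * ‖ξ‖) ^ m * ∫ η, ‖u η * v (ξ - η)‖ := by
        gcongr; exact norm_integral_le_integral_norm _
    _ = ∫ η, (1 + ε * ‖ξ‖) ^ m * ‖u η * v (ξ - η)‖ := (integral_const_mul _ _).symm
    _ ≤ ∫ η, wu η * wv (ξ - η) := by
        refine integral_mono_of_nonneg (ae_of_all _ fun η => by positivity) hξ'
          (ae_of_all _ fun η => ?_)
        have hle : 1 + ε * ‖ξ‖ ≤ (1 + ε * ‖η‖) * (1 + ε * ‖ξ - η‖) := by
          have h1 : ‖ξ‖ ≤ ‖η‖ + ‖ξ - η‖ := by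
            simpa using norm_add_le η (ξ - η)
          have h2 : (ε : ℝ) * ‖ξ‖ ≤ ε * (‖η‖ + ‖ξ - η‖) := by gcongr
          have h3 : 0 ≤ ((ε : ℝ) * ‖η‖) * (ε * ‖ξ - η‖) := by positivity
          nlinarith
        simp only [hwu, hwv, norm_mul]
        calc (1 + ε * ‖ξ‖) ^ m * (‖u η‖ * ‖v (ξ - η)‖)
            ≤ ((1 + ε * ‖η‖) * (1 + ε * ‖ξ - η‖)) ^ m * (‖u η‖ * ‖v (ξ - η)‖) := by gcongr
          _ = _ := by rw [mul_pow]; ring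

theorem wienerSeminorm_schwartzConj (ε : ℝ≥0) (m : ℕ) (f : 𝓢(E, ℂ)) :
    wienerSeminorm ε m (schwartzConj f) = wienerSeminorm ε m f := by
  rw [wienerSeminorm_apply, wienerSeminorm_apply, ← integral_neg_eq_self]
  simp [fourier_schwartzConj_apply]

theorem wienerSeminorm_schrodingerGroup (ε : ℝ≥0) (m : ℕ) (t : ℝ) (f : 𝓢(E, ℂ)) :
    wienerSeminorm ε m (schrodingerGroup t f) = wienerSeminorm ε m f := by
  simp [wienerSeminorm_apply, fourier_schrodingerGroup_apply, norm_schrodingerSymbol]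

theorem wienerSeminorm_lineDerivOp_le (ε : ℝ≥0) (m : ℕ) (v : E) (hv : ‖v‖ = 1) (f : 𝓢(E, ℂ)) :
    ε * wienerSeminorm ε m (∂_{v} f) ≤ 2 * Real.pi * wienerSeminorm ε (m + 1) f := by
  have h := wienerSeminorm_le_of_le (ε := ε) (m := m) (n := m + 1) (f := (ε : ℂ) • ∂_{v} f)
    (g := f) (C := 2 * Real.pi) fun ξ => by
      rw [FourierTransform.fourier_smul, smul_apply, fourier_lineDerivOp_apply, norm_smul]
      simp only [norm_mul, Complex.norm_real, Complex.norm_I, Complex.norm_ofNat, mul_one,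
        Real.norm_eq_abs, abs_of_pos Real.pi_pos]
      have h1 : |inner ℝ ξ v| ≤ ‖ξ‖ := by simpa [hv] using abs_real_inner_le_norm ξ v
      have h2 : |(ε : ℝ)| = ε := abs_of_nonneg ε.2
      rw [h2]
      calc (1 + ε * ‖ξ‖) ^ m * (ε * (2 * Real.pi * (|inner ℝ ξ v| * ‖𝓕 f ξ‖)))
          ≤ (1 + ε * ‖ξ‖) ^ m * (ε * (2 * Real.pi * (‖ξ‖ * ‖𝓕 f ξ‖))) := by gcongr
        _ = 2 * Real.pi * ((1 + ε * ‖ξ‖) ^ m * (ε * ‖ξ‖) * ‖𝓕 f ξ‖) := by ring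
        _ ≤ 2 * Real.pi * ((1 + ε * ‖ξ‖) ^ m * (1 + ε * ‖ξ‖) * ‖𝓕 f ξ‖) := by
            gcongr; linarith
        _ = _ := by rw [pow_succ]
  rwa [map_smul_eq_mul, show ‖(ε : ℂ)‖ = ε by simp] at h

theorem norm_cexp_ofReal_mul_I_sub_le (a b : ℝ) :
    ‖Complex.exp (a * Complex.I) - Complex.exp (b * Complex.I)‖ ≤ |a - b| := by
  have h : Complex.exp (a * Complex.I) - Complex.exp (b * Complex.I) =
      Complex.exp (b * Complex.I) * (Complex.exp (Complex.I * ((a - b : ℝ) : ℂ)) - 1) := by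
    rw [mul_sub, ← Complex.exp_add, mul_one]
    congr 2
    push_cast
    ring
  rw [h, norm_mul, Complex.norm_exp_ofReal_mul_I, one_mul]
  exact Real.norm_exp_I_mul_ofReal_sub_one_le

theorem norm_schrodingerSymbol_sub_le (s t : ℝ) (ξ : E) :
    ‖schrodingerSymbol t ξ - schrodingerSymbol s ξ‖ ≤ 2 * Real.pi ^ 2 * |t - s| * ‖ξ‖ ^ 2 := by
  refine (norm_cexp_ofReal_mul_I_sub_le _ _).trans (le_of_eq ?_)
  rw [← sub_mul, abs_mul, abs_of_nonneg (sq_nonneg ‖ξ‖), ← mul_neg_one, mul_neg_one, ← neg_sub',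
    abs_neg, ← mul_sub, abs_mul, abs_of_pos (by positivity)]

theorem wienerSeminorm_schrodingerGroup_sub_le (m : ℕ) (s t : ℝ) (f : 𝓢(E, ℂ)) :
    wienerSeminorm 1 m (schrodingerGroup t f - schrodingerGroup s f) ≤
      2 * Real.pi ^ 2 * |t - s| * wienerSeminorm 1 (m + 2) f := by
  refine wienerSeminorm_le_of_le fun ξ => ?_
  have h : 𝓕 (schrodingerGroup t f - schrodingerGroup s f) ξ =
      (schrodingerSymbol t ξ - schrodingerSymbol s ξ) * 𝓕 f ξ := by
    rw [sub_eq_add_neg, ← neg_one_smul ℂ (schrodingerGroup s f), FourierTransform.fourier_add,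
      FourierTransform.fourier_smul, add_apply, smul_apply, fourier_schrodingerGroup_apply,
      fourier_schrodingerGroup_apply, smul_eq_mul]
    ring
  rw [h, norm_mul, NNReal.coe_one, one_mul]
  have h1 : ‖ξ‖ ^ 2 ≤ (1 + ‖ξ‖) ^ 2 := by gcongr; linarith
  calc (1 + ‖ξ‖) ^ m * (‖schrodingerSymbol t ξ - schrodingerSymbol s ξ‖ * ‖𝓕 f ξ‖)
      ≤ (1 + ‖ξ‖) ^ m * (2 * Real.pi ^ 2 * |t - s| * (1 + ‖ξ‖) ^ 2 * ‖𝓕 f ξ‖) := by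
        gcongr
        exact (norm_schrodingerSymbol_sub_le s t ξ).trans (by gcongr)
    _ = _ := by rw [pow_add]; ring

theorem norm_apply_le_wienerSeminorm (ε : ℝ≥0) (f : 𝓢(E, ℂ)) (x : E) :
    ‖f x‖ ≤ wienerSeminorm ε 0 f := by
  rw [wienerSeminorm_zero_apply]
  have h : f = 𝓕⁻ (𝓕 f : 𝓢(E, ℂ)) := (FourierTransform.fourierInv_fourier_eq f).symm
  calc ‖f x‖ = ‖(𝓕⁻ (𝓕 f : 𝓢(E, ℂ)) : 𝓢(E, ℂ)) x‖ := by rw [← h]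
    _ ≤ _ := by
      rw [SchwartzMap.fourierInv_coe, Real.fourierInv_eq]
      refine (norm_integral_le_integral_norm _).trans (le_of_eq ?_)
      simp only [Circle.norm_smul]

theorem continuous_wienerSeminorm (ε : ℝ≥0) (m : ℕ) :
    Continuous (wienerSeminorm ε m : 𝓢(E, ℂ) → ℝ) := by
  have hh : (fun ξ : E => (((2 * (1 + (ε : ℝ) ^ 2 * ‖ξ‖ ^ 2)) ^ m : ℝ) : ℂ)).HasTemperateGrowth := by
    fun_prop
  let L : 𝓢(E, ℂ) →L[ℂ] Lp ℂ 1 (volume : Measure E) :=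
    (SchwartzMap.toLpCLM ℂ ℂ 1 volume).comp
      ((SchwartzMap.smulLeftCLM ℂ fun ξ : E =>
        (((2 * (1 + (ε : ℝ) ^ 2 * ‖ξ‖ ^ 2)) ^ m : ℝ) : ℂ)).comp (fourierCLM ℂ 𝓢(E, ℂ)))
  have hq : Continuous ((normSeminorm ℂ (Lp ℂ 1 (volume : Measure E))).comp L.toLinearMap) := by
    change Continuous fun f => ‖L f‖
    exact L.continuous.norm
  refine Seminorm.continuous_of_le hq fun f => ?_
  change wienerSeminorm ε m f ≤ ‖L f‖
  have hL : ‖L f‖ = ∫ ξ, ‖SchwartzMap.smulLeftCLM ℂ (fun ξ : E =>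
        (((2 * (1 + (ε : ℝ) ^ 2 * ‖ξ‖ ^ 2)) ^ m : ℝ) : ℂ)) (𝓕 f) ξ‖ :=
    SchwartzMap.norm_toLp_one
  rw [hL, wienerSeminorm_apply]
  refine integral_mono (integrable_weight_mul_norm _ _ _) (SchwartzMap.integrable _).norm
    fun ξ => ?_
  simp only [SchwartzMap.smulLeftCLM_apply_apply hh, norm_smul, Complex.norm_real]
  rw [Real.norm_of_nonneg (by positivity)]
  gcongr
  nlinarith [sq_nonneg ((ε : ℝ) * ‖ξ‖ - 1), sq_nonneg ((ε : ℝ) * ‖ξ‖)]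

end Wiener

/-! ### A family of submultiplicative seminorms generating the Schwartz topology -/

section SpatialWeights

open FourierTransform LineDeriv
open scoped NNReal

variable {E : Type} [NormedAddCommGroup E] [InnerProductSpace ℝ E] [FiniteDimensional ℝ E]
  [MeasurableSpace E] [BorelSpace E]

variable (E) in
/-- The index type of the standard orthonormal basis. -/
abbrev BasisIndex := Fin (Module.finrank ℝ E)

/-- Multiplication by the `j`-th coordinate. -/
def coordMul (j : BasisIndex E) : 𝓢(E, ℂ) →L[ℂ] 𝓢(E, ℂ) := innerMul (stdOrthonormalBasis ℝ E j)

/-- Differentiation along the `j`-th coordinate. -/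
def coordDeriv (j : BasisIndex E) (f : 𝓢(E, ℂ)) : 𝓢(E, ℂ) := ∂_{stdOrthonormalBasis ℝ E j} f

/-- Wiener norms with spatial weights: up to constants, the `m`-th one is the sum over all
monomials `x^α`, `|α| ≤ m`, of `ε^{2|α|} ∫ (1 + ε|ξ|)^{m-|α|} |𝓕(x^α f)(ξ)| dξ`. The parameter `ε`
makes the norm of a given function as close to the plain Wiener norm as desired. -/
def spatialWienerSeminorm (ε : ℝ≥0) : ℕ → Seminorm ℂ 𝓢(E, ℂ)
  | 0 => wienerSeminorm ε 0
  | m + 1 => wienerSeminorm ε (m + 1) +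
      ∑ j : BasisIndex E, (ε ^ 2) • (spatialWienerSeminorm ε m).comp (coordMul j).toLinearMap

theorem spatialWienerSeminorm_zero (ε : ℝ≥0) (f : 𝓢(E, ℂ)) :
    spatialWienerSeminorm ε 0 f = wienerSeminorm ε 0 f := rfl

theorem spatialWienerSeminorm_succ (ε : ℝ≥0) (m : ℕ) (f : 𝓢(E, ℂ)) :
    spatialWienerSeminorm ε (m + 1) f = wienerSeminorm ε (m + 1) f +
      ∑ j : BasisIndex E, (ε : ℝ) ^ 2 * spatialWienerSeminorm ε m (coordMul j f) := by
  have h : ∀ s : Finset (BasisIndex E), (∑ j ∈ s,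
      (ε ^ 2) • (spatialWienerSeminorm ε m).comp (coordMul j).toLinearMap : Seminorm ℂ 𝓢(E, ℂ)) f =
      ∑ j ∈ s, (ε : ℝ) ^ 2 * spatialWienerSeminorm ε m (coordMul j f) := by
    classical
    intro s
    induction s using Finset.induction_on with
    | empty => simp
    | insert j s hj ih =>
      rw [Finset.sum_insert hj, Finset.sum_insert hj, add_apply, ih]
      rfl
  rw [spatialWienerSeminorm, add_apply, h]

theorem wienerSeminorm_le_spatialWienerSeminorm (ε : ℝ≥0) (m : ℕ) (f : 𝓢(E, ℂ)) :
    wienerSeminorm ε m f ≤ spatialWienerSeminorm ε m f := by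
  cases m with
  | zero => exact le_rfl
  | succ m =>
    rw [spatialWienerSeminorm_succ]
    exact le_add_of_nonneg_right (Finset.sum_nonneg fun j _ => by positivity)

theorem spatialWienerSeminorm_coordMul_le (ε : ℝ≥0) (m : ℕ) (j : BasisIndex E) (f : 𝓢(E, ℂ)) :
    (ε : ℝ) ^ 2 * spatialWienerSeminorm ε m (coordMul j f) ≤ spatialWienerSeminorm ε (m + 1) f := by
  rw [spatialWienerSeminorm_succ]
  have := Finset.single_le_sum (f := fun j : BasisIndex E =>
    (ε : ℝ) ^ 2 * spatialWienerSeminorm ε m (coordMul j f)) (fun i _ => by positivity)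
    (Finset.mem_univ j)
  have h2 : 0 ≤ wienerSeminorm ε (m + 1) f := apply_nonneg _ _
  linarith

theorem spatialWienerSeminorm_mono (ε : ℝ≥0) (m : ℕ) : ∀ f : 𝓢(E, ℂ),
    spatialWienerSeminorm ε m f ≤ spatialWienerSeminorm ε (m + 1) f := by
  induction m with
  | zero =>
    intro f
    exact (wienerSeminorm_mono ε (Nat.zero_le 1) f).trans
      (wienerSeminorm_le_spatialWienerSeminorm ε 1 f)
  | succ m ih =>
    intro f
    rw [spatialWienerSeminorm_succ, spatialWienerSeminorm_succ ε (m + 1)]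
    gcongr with j
    · exact wienerSeminorm_mono ε (Nat.le_succ _) f
    · exact ih _

theorem continuous_spatialWienerSeminorm (ε : ℝ≥0) (m : ℕ) :
    Continuous (spatialWienerSeminorm ε m : 𝓢(E, ℂ) → ℝ) := by
  induction m with
  | zero => exact continuous_wienerSeminorm ε 0
  | succ m ih =>
    have : (spatialWienerSeminorm ε (m + 1) : 𝓢(E, ℂ) → ℝ) = fun f => wienerSeminorm ε (m + 1) f +
      ∑ j : BasisIndex E, (ε : ℝ) ^ 2 * spatialWienerSeminorm ε m (coordMul j f) :=
      funext (spatialWienerSeminorm_succ ε m)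
    rw [this]
    refine (continuous_wienerSeminorm ε _).add (continuous_finsetSum _ fun j _ => ?_)
    exact continuous_const.mul (ih.comp (coordMul j).continuous)

theorem coordMul_schwartzMul (j : BasisIndex E) (f g : 𝓢(E, ℂ)) :
    coordMul j (schwartzMul f g) = schwartzMul (coordMul j f) g := by
  ext x
  simp only [coordMul, innerMul_apply, schwartzMul_apply]
  ring

theorem coordMul_schwartzConj (j : BasisIndex E) (f : 𝓢(E, ℂ)) :
    coordMul j (schwartzConj f) = schwartzConj (coordMul j f) := by
  ext x
  simp [coordMul, innerMul_apply, schwartzConj_apply]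

/-- All spatial weights can be put on one factor of a product. -/
theorem spatialWienerSeminorm_schwartzMul_le_left (ε : ℝ≥0) (m : ℕ) : ∀ f g : 𝓢(E, ℂ),
    spatialWienerSeminorm ε m (schwartzMul f g) ≤
      spatialWienerSeminorm ε m f * wienerSeminorm ε m g := by
  induction m with
  | zero => exact wienerSeminorm_schwartzMul_le ε 0
  | succ m ih =>
    intro f g
    rw [spatialWienerSeminorm_succ, spatialWienerSeminorm_succ, add_mul, Finset.sum_mul]
    refine add_le_add (wienerSeminorm_schwartzMul_le ε (m + 1) f g)
      (Finset.sum_le_sum fun j _ => ?_)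
    rw [coordMul_schwartzMul, mul_assoc]
    refine mul_le_mul_of_nonneg_left ((ih _ _).trans ?_) (by positivity)
    exact mul_le_mul_of_nonneg_left (wienerSeminorm_mono ε (Nat.le_succ _) g) (apply_nonneg _ _)

theorem spatialWienerSeminorm_schwartzMul_le (ε : ℝ≥0) (m : ℕ) (f g : 𝓢(E, ℂ)) :
    spatialWienerSeminorm ε m (schwartzMul f g) ≤
      spatialWienerSeminorm ε m f * spatialWienerSeminorm ε m g :=
  (spatialWienerSeminorm_schwartzMul_le_left ε m f g).trans
    (mul_le_mul_of_nonneg_left (wienerSeminorm_le_spatialWienerSeminorm ε m g) (apply_nonneg _ _))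

theorem spatialWienerSeminorm_schwartzConj (ε : ℝ≥0) (m : ℕ) : ∀ f : 𝓢(E, ℂ),
    spatialWienerSeminorm ε m (schwartzConj f) = spatialWienerSeminorm ε m f := by
  induction m with
  | zero => exact wienerSeminorm_schwartzConj ε 0
  | succ m ih =>
    intro f
    simp only [spatialWienerSeminorm_succ, wienerSeminorm_schwartzConj, coordMul_schwartzConj, ih]

theorem coordMul_coordDeriv (i j : BasisIndex E) (f : 𝓢(E, ℂ)) :
    coordMul i (coordDeriv j f) = coordDeriv j (coordMul i f) -
      ((inner ℝ (stdOrthonormalBasis ℝ E j) (stdOrthonormalBasis ℝ E i) : ℝ) : ℂ) • f := by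
  ext x
  set bi := stdOrthonormalBasis ℝ E i with hbi
  set bj := stdOrthonormalBasis ℝ E j with hbj
  have h1 : HasFDerivAt (fun y : E => ((inner ℝ y bi : ℝ) : ℂ))
      (Complex.ofRealCLM.comp (innerSL ℝ bi)) x := by
    have := (Complex.ofRealCLM.comp (innerSL ℝ bi)).hasFDerivAt (x := x)
    refine this.congr_of_eventuallyEq (Eventually.of_forall fun y => ?_)
    simp [real_inner_comm]
  have h2 := h1.mul (f.hasFDerivAt x)
  have h3 : ((fun y : E => ((inner ℝ y bi : ℝ) : ℂ)) * ⇑f) = ⇑(coordMul i f) :=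
    funext fun y => (innerMul_apply bi f y).symm
  rw [h3] at h2
  have h4 : coordDeriv j (coordMul i f) x = _ := lineDerivOp_eq_of_hasFDerivAt h2
  have h5 : coordDeriv j f x = _ := lineDerivOp_eq_of_hasFDerivAt (f.hasFDerivAt x)
  rw [sub_apply, smul_apply, h4, coordMul, innerMul_apply, h5, real_inner_comm]
  rw [real_inner_comm bi bj]
  simp [mul_comm, ← hbj]

theorem exists_spatialWienerSeminorm_coordDeriv_le (m : ℕ) : ∃ D : ℝ, 0 ≤ D ∧
    ∀ ε : ℝ≥0, ε ≤ 1 → ∀ (j : BasisIndex E) (f : 𝓢(E, ℂ)),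
      ε * spatialWienerSeminorm ε m (coordDeriv j f) ≤ D * spatialWienerSeminorm ε (m + 1) f := by
  have hw : ∀ (ε : ℝ≥0) (m : ℕ) (j : BasisIndex E) (f : 𝓢(E, ℂ)),
      ε * wienerSeminorm ε m (coordDeriv j f) ≤
        2 * Real.pi * spatialWienerSeminorm ε (m + 1) f := fun ε m j f =>
    (wienerSeminorm_lineDerivOp_le ε m _ ((stdOrthonormalBasis ℝ E).norm_eq_one j) f).trans
      (mul_le_mul_of_nonneg_left (wienerSeminorm_le_spatialWienerSeminorm ε (m + 1) f)
        (by positivity))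
  induction m with
  | zero => exact ⟨2 * Real.pi, by positivity, fun ε _ j f => hw ε 0 j f⟩
  | succ m ih =>
    obtain ⟨D, hD0, hD⟩ := ih
    set c : ℝ := (Fintype.card (BasisIndex E) : ℝ) with hc
    refine ⟨2 * Real.pi + c * (D + 1), by positivity, fun ε hε j f => ?_⟩
    have hε' : (ε : ℝ) ≤ 1 := by exact_mod_cast hε
    have hterm : ∀ i : BasisIndex E, ε * ((ε : ℝ) ^ 2 *
        spatialWienerSeminorm ε m (coordMul i (coordDeriv j f))) ≤
        (D + 1) * spatialWienerSeminorm ε (m + 2) f := by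
      intro i
      have h1 : spatialWienerSeminorm ε m (coordMul i (coordDeriv j f)) ≤
          spatialWienerSeminorm ε m (coordDeriv j (coordMul i f)) +
            spatialWienerSeminorm ε m f := by
        rw [coordMul_coordDeriv]
        refine (map_sub_le_add _ _ _).trans ?_
        gcongr
        rw [map_smul_eq_mul]
        refine mul_le_of_le_one_left (apply_nonneg _ _) ?_
        rw [Complex.norm_real]
        refine (norm_inner_le_norm _ _).trans ?_
        simp
      have h2 := hD ε hε j (coordMul i f)
      have h3 := spatialWienerSeminorm_coordMul_le ε (m + 1) i f
      have h4 : spatialWienerSeminorm ε m f ≤ spatialWienerSeminorm ε (m + 2) f :=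
        (spatialWienerSeminorm_mono ε m f).trans (spatialWienerSeminorm_mono ε (m + 1) f)
      have h5 : (ε : ℝ) ^ 3 ≤ 1 := pow_le_one₀ ε.2 hε'
      calc ε * ((ε : ℝ) ^ 2 * spatialWienerSeminorm ε m (coordMul i (coordDeriv j f)))
          ≤ ε * ((ε : ℝ) ^ 2 * (spatialWienerSeminorm ε m (coordDeriv j (coordMul i f)) +
            spatialWienerSeminorm ε m f)) := by gcongr
        _ = (ε : ℝ) ^ 2 * (ε * spatialWienerSeminorm ε m (coordDeriv j (coordMul i f))) +
            (ε : ℝ) ^ 3 * spatialWienerSeminorm ε m f := by ring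
        _ ≤ (ε : ℝ) ^ 2 * (D * spatialWienerSeminorm ε (m + 1) (coordMul i f)) +
            1 * spatialWienerSeminorm ε (m + 2) f := by
            gcongr
        _ = D * ((ε : ℝ) ^ 2 * spatialWienerSeminorm ε (m + 1) (coordMul i f)) +
            spatialWienerSeminorm ε (m + 2) f := by ring
        _ ≤ D * spatialWienerSeminorm ε (m + 2) f + spatialWienerSeminorm ε (m + 2) f := by
            gcongr
        _ = _ := by ring
    rw [spatialWienerSeminorm_succ, mul_add, Finset.mul_sum, add_mul]
    refine add_le_add (hw ε (m + 1) j f) ((Finset.sum_le_sum fun i _ => hterm i).trans ?_)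
    rw [Finset.sum_const, Finset.card_univ, nsmul_eq_mul, mul_assoc]

theorem coordMul_schrodingerGroup (j : BasisIndex E) (t : ℝ) (f : 𝓢(E, ℂ)) :
    coordMul j (schrodingerGroup t f) =
      schrodingerGroup t (coordMul j f - (Complex.I * t) • coordDeriv j f) :=
  innerMul_schrodingerGroup t _ f

/-- On bounded time intervals the free group is almost an isometry for small `ε`. -/
theorem exists_spatialWienerSeminorm_schrodingerGroup_le (R : ℝ) (hR : 0 ≤ R) (m : ℕ) :
    ∃ K : ℝ, 0 ≤ K ∧ ∀ ε : ℝ≥0, ε ≤ 1 → ∀ t : ℝ, |t| ≤ R → ∀ f : 𝓢(E, ℂ),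
      spatialWienerSeminorm ε m (schrodingerGroup t f) ≤
        (1 + K * ε) * spatialWienerSeminorm ε m f := by
  induction m with
  | zero =>
    refine ⟨0, le_rfl, fun ε _ t _ f => ?_⟩
    rw [spatialWienerSeminorm_zero, spatialWienerSeminorm_zero, wienerSeminorm_schrodingerGroup]
    simp
  | succ m ih =>
    obtain ⟨K, hK0, hK⟩ := ih
    obtain ⟨D, hD0, hD⟩ := exists_spatialWienerSeminorm_coordDeriv_le (E := E) m
    set c : ℝ := (Fintype.card (BasisIndex E) : ℝ) with hc
    refine ⟨K + c * ((1 + K) * (R * D)), by positivity, fun ε hε t ht f => ?_⟩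
    have hε' : (ε : ℝ) ≤ 1 := by exact_mod_cast hε
    set Q := spatialWienerSeminorm ε (m + 1) f with hQ
    have hQ0 : 0 ≤ Q := apply_nonneg _ _
    have hterm : ∀ j : BasisIndex E, (ε : ℝ) ^ 2 *
        spatialWienerSeminorm ε m (coordMul j (schrodingerGroup t f)) ≤
        (1 + K * ε) * ((ε : ℝ) ^ 2 * spatialWienerSeminorm ε m (coordMul j f)) +
          ε * ((1 + K) * (R * D)) * Q := by
      intro j
      have h1 : spatialWienerSeminorm ε m (coordMul j (schrodingerGroup t f)) ≤
          (1 + K * ε) * (spatialWienerSeminorm ε m (coordMul j f) +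
            R * spatialWienerSeminorm ε m (coordDeriv j f)) := by
        rw [coordMul_schrodingerGroup]
        refine (hK ε hε t ht _).trans ?_
        gcongr
        refine (map_sub_le_add _ _ _).trans ?_
        gcongr
        rw [map_smul_eq_mul]
        gcongr
        simpa using ht
      have h2 := hD ε hε j f
      have h3 : K * ε ≤ K := mul_le_of_le_one_right hK0 hε'
      calc (ε : ℝ) ^ 2 * spatialWienerSeminorm ε m (coordMul j (schrodingerGroup t f))
          ≤ (ε : ℝ) ^ 2 * ((1 + K * ε) * (spatialWienerSeminorm ε m (coordMul j f) +
            R * spatialWienerSeminorm ε m (coordDeriv j f))) := by gcongr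
        _ = (1 + K * ε) * ((ε : ℝ) ^ 2 * spatialWienerSeminorm ε m (coordMul j f)) +
            ε * (1 + K * ε) * (R * (ε * spatialWienerSeminorm ε m (coordDeriv j f))) := by ring
        _ ≤ (1 + K * ε) * ((ε : ℝ) ^ 2 * spatialWienerSeminorm ε m (coordMul j f)) +
            ε * (1 + K) * (R * (D * Q)) := by gcongr
        _ = _ := by ring
    have hsum := Finset.sum_le_sum fun j (_ : j ∈ Finset.univ) => hterm j
    rw [Finset.sum_add_distrib, ← Finset.mul_sum (s := Finset.univ)
      (f := fun j : BasisIndex E => (ε : ℝ) ^ 2 * spatialWienerSeminorm ε m (coordMul j f)),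
      Finset.sum_const, Finset.card_univ, nsmul_eq_mul] at hsum
    rw [spatialWienerSeminorm_succ, wienerSeminorm_schrodingerGroup]
    have hQe : Q = wienerSeminorm ε (m + 1) f +
      ∑ j : BasisIndex E, (ε : ℝ) ^ 2 * spatialWienerSeminorm ε m (coordMul j f) :=
      spatialWienerSeminorm_succ ε m f
    set S := ∑ j : BasisIndex E, (ε : ℝ) ^ 2 * spatialWienerSeminorm ε m (coordMul j f) with hS
    have hw0 : 0 ≤ wienerSeminorm ε (m + 1) f := apply_nonneg _ _
    have hKε : 0 ≤ K * ε := by positivity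
    calc _ ≤ wienerSeminorm ε (m + 1) f + ((1 + K * ε) * S + c * (ε * ((1 + K) * (R * D)) * Q)) :=
            add_le_add le_rfl hsum
      _ ≤ (1 + K * ε) * (wienerSeminorm ε (m + 1) f + S) + c * (ε * ((1 + K) * (R * D)) * Q) := by
            nlinarith
      _ = _ := by rw [← hQe]; ring

theorem exists_spatialWienerSeminorm_schrodingerGroup_sub_le (R : ℝ) (hR : 0 ≤ R) (m : ℕ) :
    ∃ C : ℝ, 0 ≤ C ∧ ∀ s t : ℝ, |s| ≤ R → |t| ≤ R → ∀ f : 𝓢(E, ℂ),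
      spatialWienerSeminorm 1 m (schrodingerGroup t f - schrodingerGroup s f) ≤
        C * |t - s| * spatialWienerSeminorm 1 (m + 2) f := by
  have hw : ∀ (m : ℕ) (s t : ℝ) (f : 𝓢(E, ℂ)),
      wienerSeminorm 1 m (schrodingerGroup t f - schrodingerGroup s f) ≤
        2 * Real.pi ^ 2 * |t - s| * spatialWienerSeminorm 1 (m + 2) f := fun m s t f =>
    (wienerSeminorm_schrodingerGroup_sub_le m s t f).trans
      (mul_le_mul_of_nonneg_left (wienerSeminorm_le_spatialWienerSeminorm 1 (m + 2) f)
        (by positivity))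
  induction m with
  | zero => exact ⟨2 * Real.pi ^ 2, by positivity, fun s t _ _ f => hw 0 s t f⟩
  | succ m ih =>
    obtain ⟨C, hC0, hC⟩ := ih
    obtain ⟨D, hD0, hD⟩ := exists_spatialWienerSeminorm_coordDeriv_le (E := E) m
    obtain ⟨D', hD0', hD'⟩ := exists_spatialWienerSeminorm_coordDeriv_le (E := E) (m + 2)
    obtain ⟨K, hK0, hK⟩ := exists_spatialWienerSeminorm_schrodingerGroup_le (E := E) R hR m
    set c : ℝ := (Fintype.card (BasisIndex E) : ℝ) with hc
    refine ⟨2 * Real.pi ^ 2 + c * (C * (1 + R * D') + (1 + K) * D), by positivity,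
      fun s t hs ht f => ?_⟩
    have hterm : ∀ j : BasisIndex E,
        spatialWienerSeminorm 1 m (coordMul j (schrodingerGroup t f - schrodingerGroup s f)) ≤
        (C * (1 + R * D') + (1 + K) * D) * |t - s| * spatialWienerSeminorm 1 (m + 3) f := by
      intro j
      have hrepr : coordMul j (schrodingerGroup t f - schrodingerGroup s f) =
          (schrodingerGroup t (coordMul j f - (Complex.I * t) • coordDeriv j f) -
            schrodingerGroup s (coordMul j f - (Complex.I * t) • coordDeriv j f)) -
          (Complex.I * ((t - s : ℝ) : ℂ)) • schrodingerGroup s (coordDeriv j f) := by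
        rw [map_sub, coordMul_schrodingerGroup, coordMul_schrodingerGroup]
        simp only [map_sub, map_smul]
        push_cast
        module
      have h1 := hC s t hs ht (coordMul j f - (Complex.I * t) • coordDeriv j f)
      have h2 : spatialWienerSeminorm 1 (m + 2) (coordMul j f - (Complex.I * t) • coordDeriv j f) ≤
          (1 + R * D') * spatialWienerSeminorm 1 (m + 3) f := by
        refine (map_sub_le_add _ _ _).trans ?_
        rw [map_smul_eq_mul, add_mul, one_mul]
        have h3 := spatialWienerSeminorm_coordMul_le 1 (m + 2) j f
        have h4 := hD' 1 le_rfl j f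
        simp only [NNReal.coe_one, one_pow, one_mul] at h3 h4
        refine add_le_add h3 ?_
        rw [mul_assoc]
        gcongr
        simpa using ht
      have h5 : spatialWienerSeminorm 1 m (schrodingerGroup s (coordDeriv j f)) ≤
          (1 + K) * D * spatialWienerSeminorm 1 (m + 3) f := by
        have h6 := hK 1 le_rfl s hs (coordDeriv j f)
        have h7 := hD 1 le_rfl j f
        simp only [NNReal.coe_one, one_mul, mul_one] at h6 h7
        refine h6.trans ?_
        rw [mul_assoc]
        gcongr
        refine h7.trans ?_
        gcongr
        exact (spatialWienerSeminorm_mono 1 (m + 1) f).trans (spatialWienerSeminorm_mono 1 (m + 2) f)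
      rw [hrepr]
      refine (map_sub_le_add _ _ _).trans ?_
      rw [map_smul_eq_mul]
      have h8 : ‖Complex.I * ((t - s : ℝ) : ℂ)‖ = |t - s| := by
        rw [norm_mul, Complex.norm_I, one_mul, Complex.norm_real, Real.norm_eq_abs]
      rw [h8]
      calc _ ≤ C * |t - s| * ((1 + R * D') * spatialWienerSeminorm 1 (m + 3) f) +
            |t - s| * ((1 + K) * D * spatialWienerSeminorm 1 (m + 3) f) := by
              refine add_le_add (h1.trans ?_) ?_ <;> gcongr
        _ = _ := by ring
    rw [spatialWienerSeminorm_succ]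
    simp only [NNReal.coe_one, one_pow, one_mul]
    refine (add_le_add (hw (m + 1) s t f) (Finset.sum_le_sum fun j _ => hterm j)).trans ?_
    rw [Finset.sum_const, Finset.card_univ, nsmul_eq_mul]
    apply le_of_eq
    ring

theorem one_add_mul_pow_le (m : ℕ) {x y : ℝ} (hx : 0 ≤ x) (hx1 : x ≤ 1) (hy : 0 ≤ y) :
    (1 + x * y) ^ m ≤ 1 + x * ((1 + y) ^ m - 1) := by
  induction m with
  | zero => simp
  | succ m ih =>
    set a := (1 + y) ^ m - 1 with ha
    have ha0 : 0 ≤ a := sub_nonneg.2 (one_le_pow₀ (by linarith))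
    have ha' : (1 + y) ^ m = 1 + a := by rw [ha]; ring
    have h2 : x * (x * (a * y)) ≤ 1 * (x * (a * y)) := by gcongr
    calc (1 + x * y) ^ (m + 1) = (1 + x * y) ^ m * (1 + x * y) := pow_succ _ _
      _ ≤ (1 + x * a) * (1 + x * y) := by gcongr
      _ ≤ 1 + x * ((1 + a) * (1 + y) - 1) := by nlinarith
      _ = _ := by rw [← ha', pow_succ]

theorem wienerSeminorm_le_add {ε : ℝ≥0} (hε : ε ≤ 1) (m : ℕ) (f : 𝓢(E, ℂ)) :
    wienerSeminorm ε m f ≤ wienerSeminorm 1 0 f + ε * wienerSeminorm 1 m f := by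
  have hε' : (ε : ℝ) ≤ 1 := by exact_mod_cast hε
  have h0 : Integrable fun ξ : E => 1 * ‖𝓕 f ξ‖ := by
    simpa using integrable_weight_mul_norm 1 0 (𝓕 f)
  simp only [wienerSeminorm_apply, NNReal.coe_one, pow_zero]
  rw [← integral_const_mul, ← integral_add]
  · refine integral_mono (integrable_weight_mul_norm _ _ _) ?_ fun ξ => ?_
    · exact h0.add ((integrable_weight_mul_norm 1 m (𝓕 f)).const_mul _)
    · have h := one_add_mul_pow_le m ε.2 hε' (norm_nonneg ξ)
      have h0 : 0 ≤ (ε : ℝ) := ε.2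
      calc (1 + ε * ‖ξ‖) ^ m * ‖𝓕 f ξ‖ ≤ (1 + ε * ((1 + ‖ξ‖) ^ m - 1)) * ‖𝓕 f ξ‖ := by gcongr; exact h
        _ ≤ (1 + ε * (1 + 1 * ‖ξ‖) ^ m) * ‖𝓕 f ξ‖ := by
          gcongr
          rw [one_mul]
          linarith
        _ = _ := by ring
  · exact h0
  · exact (integrable_weight_mul_norm 1 m (𝓕 f)).const_mul _

theorem exists_spatialWienerSeminorm_le_add (m : ℕ) : ∀ f : 𝓢(E, ℂ), ∃ C : ℝ, 0 ≤ C ∧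
    ∀ ε : ℝ≥0, ε ≤ 1 → spatialWienerSeminorm ε m f ≤ wienerSeminorm 1 0 f + C * ε := by
  induction m with
  | zero =>
    intro f
    refine ⟨0, le_rfl, fun ε _ => ?_⟩
    rw [spatialWienerSeminorm_zero, wienerSeminorm_zero_apply, wienerSeminorm_zero_apply]
    simp
  | succ m ih =>
    intro f
    choose C hC0 hC using fun j => ih (coordMul j f)
    refine ⟨wienerSeminorm 1 (m + 1) f + ∑ j, (wienerSeminorm 1 0 (coordMul j f) + C j),
      add_nonneg (apply_nonneg _ _)
        (Finset.sum_nonneg fun j _ => add_nonneg (apply_nonneg _ _) (hC0 j)), fun ε hε => ?_⟩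
    have hε' : (ε : ℝ) ≤ 1 := by exact_mod_cast hε
    have hε0 : 0 ≤ (ε : ℝ) := ε.2
    rw [spatialWienerSeminorm_succ, add_mul, ← add_assoc, Finset.sum_mul]
    refine add_le_add ((wienerSeminorm_le_add hε _ f).trans (le_of_eq (by ring)))
      (Finset.sum_le_sum fun j _ => ?_)
    have h0 : 0 ≤ wienerSeminorm 1 0 (coordMul j f) := apply_nonneg _ _
    have h1 : spatialWienerSeminorm ε m (coordMul j f) ≤ wienerSeminorm 1 0 (coordMul j f) + C j :=
      (hC j ε hε).trans (by gcongr; exact mul_le_of_le_one_right (hC0 j) hε')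
    calc (ε : ℝ) ^ 2 * spatialWienerSeminorm ε m (coordMul j f)
        ≤ ε * (wienerSeminorm 1 0 (coordMul j f) + C j) := by
          gcongr
          rw [sq]
          exact mul_le_of_le_one_right hε0 hε'
      _ = _ := mul_comm _ _

theorem norm_le_sum_abs_inner_basis (x : E) :
    ‖x‖ ≤ ∑ j : BasisIndex E, |inner ℝ x (stdOrthonormalBasis ℝ E j)| := by
  conv_lhs => rw [← (stdOrthonormalBasis ℝ E).sum_repr' x]
  refine (norm_sum_le _ _).trans (Finset.sum_le_sum fun j _ => ?_)
  rw [norm_smul, (stdOrthonormalBasis ℝ E).norm_eq_one, mul_one, Real.norm_eq_abs,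
    real_inner_comm]

/-- The derivative is determined by the coordinate derivatives. -/
theorem fderiv_eq_sum_coordDeriv (f : 𝓢(E, ℂ)) :
    fderiv ℝ f = fun x => ∑ j : BasisIndex E, ContinuousLinearMap.smulRightL ℝ E ℂ
      (innerSL ℝ (stdOrthonormalBasis ℝ E j)) (coordDeriv j f x) := by
  ext x v
  have h : ∀ j : BasisIndex E, coordDeriv j f x = fderiv ℝ f x (stdOrthonormalBasis ℝ E j) :=
    fun j => lineDerivOp_eq_of_hasFDerivAt (f.hasFDerivAt x)
  conv_lhs => rw [← (stdOrthonormalBasis ℝ E).sum_repr' v, map_sum]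
  simp [h]

theorem exists_seminorm_zero_le_spatialWienerSeminorm (ε : ℝ≥0) (hε0 : ε ≠ 0) (k : ℕ) :
    ∃ C : ℝ, 0 ≤ C ∧ ∀ (f : 𝓢(E, ℂ)) (x : E),
      ‖x‖ ^ k * ‖f x‖ ≤ C * spatialWienerSeminorm ε k f := by
  have hpos : 0 < (ε : ℝ) := NNReal.coe_pos.2 (pos_iff_ne_zero.2 hε0)
  induction k with
  | zero =>
    refine ⟨1, zero_le_one, fun f x => ?_⟩
    simpa [spatialWienerSeminorm_zero] using norm_apply_le_wienerSeminorm ε f x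
  | succ k ih =>
    obtain ⟨C, hC0, hC⟩ := ih
    refine ⟨(Fintype.card (BasisIndex E) : ℝ) * (C * ((ε : ℝ) ^ 2)⁻¹), by positivity,
      fun f x => ?_⟩
    have hterm : ∀ j : BasisIndex E, ‖x‖ ^ k *
        (|inner ℝ x (stdOrthonormalBasis ℝ E j)| * ‖f x‖) ≤
          C * ((ε : ℝ) ^ 2)⁻¹ * spatialWienerSeminorm ε (k + 1) f := by
      intro j
      have h1 : |inner ℝ x (stdOrthonormalBasis ℝ E j)| * ‖f x‖ = ‖coordMul j f x‖ := by
        rw [coordMul, innerMul_apply, norm_mul, Complex.norm_real, Real.norm_eq_abs]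
      have h2 := spatialWienerSeminorm_coordMul_le ε k j f
      rw [h1, mul_assoc]
      refine (hC _ x).trans ?_
      gcongr
      rwa [le_inv_mul_iff₀ (by positivity)]
    calc ‖x‖ ^ (k + 1) * ‖f x‖ = ‖x‖ ^ k * (‖x‖ * ‖f x‖) := by ring
      _ ≤ ‖x‖ ^ k * ((∑ j : BasisIndex E, |inner ℝ x (stdOrthonormalBasis ℝ E j)|) * ‖f x‖) := by
          gcongr; exact norm_le_sum_abs_inner_basis x
      _ = ∑ j : BasisIndex E, ‖x‖ ^ k *
        (|inner ℝ x (stdOrthonormalBasis ℝ E j)| * ‖f x‖) := by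
          rw [Finset.sum_mul, Finset.mul_sum]
      _ ≤ ∑ j : BasisIndex E, C * ((ε : ℝ) ^ 2)⁻¹ * spatialWienerSeminorm ε (k + 1) f :=
          Finset.sum_le_sum fun j _ => hterm j
      _ = _ := by
          rw [Finset.sum_const, Finset.card_univ, nsmul_eq_mul]
          ring

/-- The weighted Wiener norms control all Schwartz seminorms. -/
theorem exists_seminorm_le_spatialWienerSeminorm (ε : ℝ≥0) (hε0 : ε ≠ 0) (hε : ε ≤ 1) (k n : ℕ) :
    ∃ C : ℝ, 0 ≤ C ∧ ∀ f : 𝓢(E, ℂ),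
      SchwartzMap.seminorm ℝ k n f ≤ C * spatialWienerSeminorm ε (k + n) f := by
  have hpos : 0 < (ε : ℝ) := NNReal.coe_pos.2 (pos_iff_ne_zero.2 hε0)
  induction n with
  | zero =>
    obtain ⟨C, hC0, hC⟩ := exists_seminorm_zero_le_spatialWienerSeminorm (E := E) ε hε0 k
    refine ⟨C, hC0, fun f => SchwartzMap.seminorm_le_bound ℝ k 0 f (by positivity) fun x => ?_⟩
    rw [norm_iteratedFDeriv_zero]
    exact hC f x
  | succ n ih =>
    obtain ⟨C, hC0, hC⟩ := ih
    obtain ⟨D, hD0, hD⟩ := exists_spatialWienerSeminorm_coordDeriv_le (E := E) (k + n)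
    let L : BasisIndex E → ℂ →L[ℝ] (E →L[ℝ] ℂ) := fun j =>
      ContinuousLinearMap.smulRightL ℝ E ℂ (innerSL ℝ (stdOrthonormalBasis ℝ E j))
    refine ⟨∑ j, ‖L j‖ * (C * ((ε : ℝ)⁻¹ * D)), Finset.sum_nonneg fun j _ => by positivity,
      fun f => SchwartzMap.seminorm_le_bound ℝ k _ f (mul_nonneg
        (Finset.sum_nonneg fun j _ => by positivity) (apply_nonneg _ _)) fun x => ?_⟩
    have hterm : ∀ j : BasisIndex E,
        ‖x‖ ^ k * ‖iteratedFDeriv ℝ n (fun y => L j (coordDeriv j f y)) x‖ ≤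
          ‖L j‖ * (C * ((ε : ℝ)⁻¹ * D)) * spatialWienerSeminorm ε (k + (n + 1)) f := by
      intro j
      have h1 : ‖iteratedFDeriv ℝ n (fun y => L j (coordDeriv j f y)) x‖ ≤
          ‖L j‖ * ‖iteratedFDeriv ℝ n (coordDeriv j f) x‖ :=
        (L j).norm_iteratedFDeriv_comp_left ((coordDeriv j f).smooth n).contDiffAt le_rfl
      have h2 := hD ε hε j f
      calc _ ≤ ‖x‖ ^ k * (‖L j‖ * ‖iteratedFDeriv ℝ n (coordDeriv j f) x‖) := by gcongr
        _ = ‖L j‖ * (‖x‖ ^ k * ‖iteratedFDeriv ℝ n (coordDeriv j f) x‖) := by ring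
        _ ≤ ‖L j‖ * (C * spatialWienerSeminorm ε (k + n) (coordDeriv j f)) := by
            exact mul_le_mul_of_nonneg_left
              ((SchwartzMap.le_seminorm ℝ k n _ x).trans (hC _)) (by positivity)
        _ ≤ ‖L j‖ * (C * ((ε : ℝ)⁻¹ * (D * spatialWienerSeminorm ε (k + n + 1) f))) := by
            gcongr
            rwa [le_inv_mul_iff₀ hpos]
        _ = _ := by rw [← add_assoc]; ring
    rw [← norm_iteratedFDeriv_fderiv, fderiv_eq_sum_coordDeriv]
    have hsum : iteratedFDeriv ℝ n (fun y => ∑ j : BasisIndex E, L j (coordDeriv j f y)) x =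
        ∑ j : BasisIndex E, iteratedFDeriv ℝ n (fun y => L j (coordDeriv j f y)) x := by
      exact iteratedFDeriv_fun_sum_apply fun j _ =>
        ((L j).contDiff.comp ((coordDeriv j f).smooth n)).contDiffAt
    calc ‖x‖ ^ k * ‖iteratedFDeriv ℝ n (fun y => ∑ j : BasisIndex E, L j (coordDeriv j f y)) x‖
        ≤ ‖x‖ ^ k * ∑ j : BasisIndex E,
            ‖iteratedFDeriv ℝ n (fun y => L j (coordDeriv j f y)) x‖ := by
          rw [hsum]
          gcongr
          exact norm_sum_le _ _
      _ ≤ ∑ j : BasisIndex E, ‖L j‖ * (C * ((ε : ℝ)⁻¹ * D)) *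
            spatialWienerSeminorm ε (k + (n + 1)) f := by
          rw [Finset.mul_sum]
          exact Finset.sum_le_sum fun j _ => hterm j
      _ = _ := by rw [Finset.sum_mul]

end SpatialWeights

/-! ### Local existence by Picard iteration -/

section Existence

open FourierTransform LineDeriv
open scoped NNReal

variable {E : Type} [NormedAddCommGroup E] [InnerProductSpace ℝ E] [FiniteDimensional ℝ E]
  [MeasurableSpace E] [BorelSpace E]

theorem tendsto_schwartz_of_spatialWienerSeminorm {ι : Type*} {l : Filter ι} {u : ι → 𝓢(E, ℂ)}
    {f : 𝓢(E, ℂ)} (h : ∀ m, Tendsto (fun i => spatialWienerSeminorm 1 m (u i - f)) l (𝓝 0)) :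
    Tendsto u l (𝓝 f) := by
  rw [(schwartz_withSeminorms ℝ E ℂ).tendsto_nhds]
  rintro ⟨k, n⟩ ε hε
  obtain ⟨C, hC0, hC⟩ := exists_seminorm_le_spatialWienerSeminorm (E := E) 1 one_ne_zero le_rfl k n
  have h1 := (h (k + n)).const_mul C
  rw [mul_zero] at h1
  filter_upwards [h1.eventually (gt_mem_nhds hε)] with i hi
  exact (hC _).trans_lt hi

theorem tendsto_seminorm_sub {ι : Type*} {l : Filter ι} {u : ι → 𝓢(E, ℂ)}
    {f : 𝓢(E, ℂ)} (h : Tendsto u l (𝓝 f)) {Q : Seminorm ℂ 𝓢(E, ℂ)} (hQ : Continuous Q) :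
    Tendsto (fun i => Q (u i - f)) l (𝓝 0) := by
  have := (hQ.tendsto (f - f)).comp (h.sub_const f)
  rwa [sub_self, map_zero] at this

/-- The free Schrödinger group acts jointly continuously on the Schwartz space. -/
theorem continuous_schrodingerGroup :
    Continuous fun p : ℝ × 𝓢(E, ℂ) => schrodingerGroup p.1 p.2 := by
  rw [continuous_iff_continuousAt]
  rintro ⟨t, f⟩
  refine tendsto_schwartz_of_spatialWienerSeminorm fun m => ?_
  obtain ⟨K, hK0, hK⟩ := exists_spatialWienerSeminorm_schrodingerGroup_le (E := E) (|t| + 1)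
    (by positivity) m
  obtain ⟨C, hC0, hC⟩ := exists_spatialWienerSeminorm_schrodingerGroup_sub_le (E := E) (|t| + 1)
    (by positivity) m
  have h1 : Tendsto (fun p : ℝ × 𝓢(E, ℂ) => (1 + K) * spatialWienerSeminorm 1 m (p.2 - f) +
      C * |p.1 - t| * spatialWienerSeminorm 1 (m + 2) f) (𝓝 (t, f)) (𝓝 0) := by
    have ha : Tendsto (fun p : ℝ × 𝓢(E, ℂ) => spatialWienerSeminorm 1 m (p.2 - f))
        (𝓝 (t, f)) (𝓝 0) :=
      tendsto_seminorm_sub (continuous_snd.tendsto (t, f)) (continuous_spatialWienerSeminorm 1 m)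
    have hb : Tendsto (fun p : ℝ × 𝓢(E, ℂ) => |p.1 - t|) (𝓝 (t, f)) (𝓝 0) := by
      have hc : Continuous fun p : ℝ × 𝓢(E, ℂ) => |p.1 - t| := by fun_prop
      simpa using hc.tendsto (t, f)
    simpa using (ha.const_mul (1 + K)).add
      ((hb.const_mul C).mul_const (spatialWienerSeminorm 1 (m + 2) f))
  refine squeeze_zero' (Eventually.of_forall fun _ => apply_nonneg _ _) ?_ h1
  have hnear : ∀ᶠ p : ℝ × 𝓢(E, ℂ) in 𝓝 (t, f), |p.1| ≤ |t| + 1 := by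
    have hc : Continuous fun p : ℝ × 𝓢(E, ℂ) => |p.1| := by fun_prop
    filter_upwards [(hc.tendsto (t, f)).eventually (gt_mem_nhds (lt_add_one |t|))] with p hp
    exact hp.le
  filter_upwards [hnear] with p hp
  have hrepr : schrodingerGroup p.1 p.2 - schrodingerGroup t f =
      schrodingerGroup p.1 (p.2 - f) + (schrodingerGroup p.1 f - schrodingerGroup t f) := by
    rw [map_sub]; abel
  rw [hrepr]
  refine (map_add_le_add _ _ _).trans (add_le_add ?_ ?_)
  · simpa using hK 1 le_rfl p.1 hp (p.2 - f)
  · exact hC t p.1 (by linarith) hp f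

theorem continuous_schrodingerGroup_comp {g : ℝ → ℝ} {w : ℝ → 𝓢(E, ℂ)} (hg : Continuous g)
    (hw : Continuous w) : Continuous fun τ => schrodingerGroup (g τ) (w τ) :=
  Continuous.comp (g := fun p : ℝ × 𝓢(E, ℂ) => schrodingerGroup p.1 p.2)
    (f := fun τ => (g τ, w τ)) continuous_schrodingerGroup (hg.prodMk hw)

/-- Seminorms for which the nonlinearity and the free group on `[-1, 1]` obey uniform bounds; the
time of existence produced by the Picard iteration is the same for all of them. -/
structure IsPicardSeminorm (Q : Seminorm ℂ 𝓢(E, ℂ)) : Prop where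
  continuous : Continuous Q
  mul_le : ∀ f g, Q (schwartzMul f g) ≤ Q f * Q g
  conj_eq : ∀ f, Q (schwartzConj f) = Q f
  group_le : ∀ t : ℝ, |t| ≤ 1 → ∀ f, Q (schrodingerGroup t f) ≤ 2 * Q f

theorem isPicardSeminorm_wienerSeminorm : IsPicardSeminorm (wienerSeminorm (E := E) 1 0) where
  continuous := continuous_wienerSeminorm 1 0
  mul_le := wienerSeminorm_schwartzMul_le 1 0
  conj_eq := wienerSeminorm_schwartzConj 1 0
  group_le t _ f := by
    rw [wienerSeminorm_schrodingerGroup]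
    linarith [apply_nonneg (wienerSeminorm (E := E) 1 0) f]

theorem exists_isPicardSeminorm (m : ℕ) {φ : 𝓢(E, ℂ)} {M : ℝ} (hφ : wienerSeminorm 1 0 φ < M) :
    ∃ ε : ℝ≥0, ε ≠ 0 ∧ ε ≤ 1 ∧ IsPicardSeminorm (spatialWienerSeminorm (E := E) ε m) ∧
      spatialWienerSeminorm ε m φ ≤ M := by
  obtain ⟨K, hK0, hK⟩ := exists_spatialWienerSeminorm_schrodingerGroup_le (E := E) 1 zero_le_one m
  obtain ⟨C, hC0, hC⟩ := exists_spatialWienerSeminorm_le_add m φ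
  have hδ : 0 < M - wienerSeminorm 1 0 φ := sub_pos.2 hφ
  set r : ℝ := min 1 (min (1 / (K + 1)) ((M - wienerSeminorm 1 0 φ) / (C + 1))) with hr
  have hr0 : 0 < r := by positivity
  have hr1 : r ≤ 1 := min_le_left _ _
  have hrK : r ≤ 1 / (K + 1) := (min_le_right _ _).trans (min_le_left _ _)
  have hrC : r ≤ (M - wienerSeminorm 1 0 φ) / (C + 1) := (min_le_right _ _).trans (min_le_right _ _)
  rw [le_div_iff₀ (by positivity)] at hrK hrC
  have hle : (⟨r, hr0.le⟩ : ℝ≥0) ≤ 1 := hr1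
  refine ⟨⟨r, hr0.le⟩, fun h => hr0.ne' (congrArg NNReal.toReal h), hle, ⟨?_, ?_, ?_, ?_⟩, ?_⟩
  · exact continuous_spatialWienerSeminorm _ m
  · exact spatialWienerSeminorm_schwartzMul_le _ m
  · exact spatialWienerSeminorm_schwartzConj _ m
  · intro t ht f
    refine (hK _ hle t ht f).trans ?_
    have : 1 + K * r ≤ 2 := by linarith
    exact mul_le_mul_of_nonneg_right this (apply_nonneg _ _)
  · refine (hC _ hle).trans ?_
    change wienerSeminorm 1 0 φ + C * r ≤ M
    linarith

theorem schwartzMul_sub_left (f g h : 𝓢(E, ℂ)) :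
    schwartzMul (f - g) h = schwartzMul f h - schwartzMul g h := by
  ext x; simp [schwartzMul_apply, sub_mul]

theorem schwartzMul_sub_right (f g h : 𝓢(E, ℂ)) :
    schwartzMul f (g - h) = schwartzMul f g - schwartzMul f h := by
  ext x; simp [schwartzMul_apply, mul_sub]

theorem powerNonlinearity_zero (σ : ℕ) : powerNonlinearity σ (0 : 𝓢(E, ℂ)) = 0 := by
  ext x; simp [powerNonlinearity_apply]

section Nonlinear

variable {Q : Seminorm ℂ 𝓢(E, ℂ)} (hmul : ∀ f g, Q (schwartzMul f g) ≤ Q f * Q g)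
  (hconj : ∀ f, Q (schwartzConj f) = Q f)
include hmul hconj

theorem seminorm_powerNonlinearity_le (σ : ℕ) (f : 𝓢(E, ℂ)) :
    Q (powerNonlinearity σ f) ≤ Q f ^ (2 * σ + 1) := by
  induction σ with
  | zero => simp [powerNonlinearity]
  | succ σ ih =>
    have h0 : 0 ≤ Q f := apply_nonneg _ _
    calc Q (powerNonlinearity (σ + 1) f)
        ≤ Q (schwartzMul f (schwartzConj f)) * Q (powerNonlinearity σ f) := hmul _ _
      _ ≤ (Q f * Q f) * Q f ^ (2 * σ + 1) := by
          gcongr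
          exact (hmul _ _).trans_eq (by rw [hconj])
      _ = _ := by ring

theorem seminorm_powerNonlinearity_sub_le (σ : ℕ) {f g : 𝓢(E, ℂ)} {R : ℝ} (hf : Q f ≤ R)
    (hg : Q g ≤ R) : Q (powerNonlinearity σ f - powerNonlinearity σ g) ≤
      (2 * σ + 1) * R ^ (2 * σ) * Q (f - g) := by
  have hR : 0 ≤ R := (apply_nonneg _ _).trans hf
  induction σ with
  | zero => simp [powerNonlinearity]
  | succ σ ih =>
    have hrepr : powerNonlinearity (σ + 1) f - powerNonlinearity (σ + 1) g =
        schwartzMul (schwartzMul (f - g) (schwartzConj f)) (powerNonlinearity σ f) +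
        schwartzMul (schwartzMul g (schwartzConj (f - g))) (powerNonlinearity σ f) +
        schwartzMul (schwartzMul g (schwartzConj g))
          (powerNonlinearity σ f - powerNonlinearity σ g) := by
      simp only [powerNonlinearity, map_sub, schwartzMul_sub_left, schwartzMul_sub_right]
      abel
    have hN : Q (powerNonlinearity σ f) ≤ R ^ (2 * σ + 1) :=
      (seminorm_powerNonlinearity_le hmul hconj σ f).trans (by gcongr)
    have h3 : ∀ a b c : 𝓢(E, ℂ), Q (schwartzMul (schwartzMul a (schwartzConj b)) c) ≤
        Q a * Q b * Q c := fun a b c => by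
      refine (hmul _ _).trans ?_
      gcongr
      exact (hmul _ _).trans_eq (by rw [hconj])
    rw [hrepr]
    calc _ ≤ Q (f - g) * Q f * Q (powerNonlinearity σ f) +
          Q g * Q (f - g) * Q (powerNonlinearity σ f) +
          Q g * Q g * Q (powerNonlinearity σ f - powerNonlinearity σ g) :=
          (map_add_le_add _ _ _).trans (add_le_add ((map_add_le_add _ _ _).trans
            (add_le_add (h3 _ _ _) (h3 _ _ _))) (h3 _ _ _))
      _ ≤ Q (f - g) * R * R ^ (2 * σ + 1) + R * Q (f - g) * R ^ (2 * σ + 1) +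
          R * R * ((2 * σ + 1) * R ^ (2 * σ) * Q (f - g)) := by gcongr
      _ = _ := by push_cast; ring

end Nonlinear

theorem continuous_powerNonlinearity (σ : ℕ) :
    Continuous (powerNonlinearity σ : 𝓢(E, ℂ) → 𝓢(E, ℂ)) := by
  rw [continuous_iff_continuousAt]
  intro f
  refine tendsto_schwartz_of_spatialWienerSeminorm fun m => ?_
  set Q := spatialWienerSeminorm (E := E) 1 m with hQ
  have hQc : Continuous Q := continuous_spatialWienerSeminorm 1 m
  have h1 : Tendsto (fun g => (2 * σ + 1) * (Q f + 1) ^ (2 * σ) * Q (g - f)) (𝓝 f) (𝓝 0) := by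
    simpa using (tendsto_seminorm_sub tendsto_id hQc).const_mul
      ((2 * σ + 1) * (Q f + 1) ^ (2 * σ))
  refine squeeze_zero' (Eventually.of_forall fun _ => apply_nonneg _ _) ?_ h1
  filter_upwards [(hQc.tendsto f).eventually (gt_mem_nhds (lt_add_one (Q f)))] with g hg
  exact seminorm_powerNonlinearity_sub_le (spatialWienerSeminorm_schwartzMul_le 1 m)
    (spatialWienerSeminorm_schwartzConj 1 m) σ hg.le (by linarith)

/-- The nonlinearity in the interaction picture, `e^{-iτΔ/2} (|u|^{2σ} u)` with
`u = e^{iτΔ/2} w(τ)`. -/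
def interactionForcing (σ : ℕ) (w : C(ℝ, 𝓢(E, ℂ))) : C(ℝ, 𝓢(E, ℂ)) where
  toFun τ := schrodingerGroup (-τ) (powerNonlinearity σ (schrodingerGroup τ (w τ)))
  continuous_toFun := continuous_schrodingerGroup_comp continuous_neg
    ((continuous_powerNonlinearity σ).comp
      (continuous_schrodingerGroup_comp continuous_id w.continuous))

theorem interactionForcing_apply (σ : ℕ) (w : C(ℝ, 𝓢(E, ℂ))) (τ : ℝ) :
    interactionForcing σ w τ =
      schrodingerGroup (-τ) (powerNonlinearity σ (schrodingerGroup τ (w τ))) := rfl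

/-- The Lipschitz constant of the interaction picture nonlinearity on a ball of radius `2M`. -/
def picardLipschitz (σ : ℕ) (M : ℝ) : ℝ := 4 * (2 * σ + 1) * (4 * M) ^ (2 * σ)

theorem IsPicardSeminorm.forcing_sub_le {Q : Seminorm ℂ 𝓢(E, ℂ)} (hQ : IsPicardSeminorm Q) (σ : ℕ)
    {τ M : ℝ} (hτ : |τ| ≤ 1) {f g : 𝓢(E, ℂ)} (hf : Q f ≤ 2 * M) (hg : Q g ≤ 2 * M) :
    Q (schrodingerGroup (-τ) (powerNonlinearity σ (schrodingerGroup τ f)) -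
      schrodingerGroup (-τ) (powerNonlinearity σ (schrodingerGroup τ g))) ≤
      picardLipschitz σ M * Q (f - g) := by
  have hM : 0 ≤ M := by linarith [apply_nonneg Q f]
  have hf' : Q (schrodingerGroup τ f) ≤ 4 * M := (hQ.group_le τ hτ f).trans (by linarith)
  have hg' : Q (schrodingerGroup τ g) ≤ 4 * M := (hQ.group_le τ hτ g).trans (by linarith)
  rw [← map_sub]
  calc _ ≤ 2 * Q (powerNonlinearity σ (schrodingerGroup τ f) -
        powerNonlinearity σ (schrodingerGroup τ g)) := hQ.group_le _ (by rwa [abs_neg]) _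
    _ ≤ 2 * ((2 * σ + 1) * (4 * M) ^ (2 * σ) *
        Q (schrodingerGroup τ f - schrodingerGroup τ g)) := by
        gcongr
        exact seminorm_powerNonlinearity_sub_le hQ.mul_le hQ.conj_eq σ hf' hg'
    _ ≤ 2 * ((2 * σ + 1) * (4 * M) ^ (2 * σ) * (2 * Q (f - g))) := by
        rw [← map_sub]
        gcongr
        exact hQ.group_le τ hτ _
    _ = _ := by rw [picardLipschitz]; ring

theorem schwartzIntegral_sub (G H : C(ℝ, 𝓢(E, ℂ))) (a b : ℝ) :
    schwartzIntegral (G - H) a b = schwartzIntegral G a b - schwartzIntegral H a b := by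
  ext x
  rw [sub_apply, schwartzIntegral_apply, schwartzIntegral_apply, schwartzIntegral_apply,
    ← intervalIntegral.integral_sub
      ((continuous_schwartz_eval G.continuous x).intervalIntegrable _ _)
      ((continuous_schwartz_eval H.continuous x).intervalIntegrable _ _)]
  rfl

theorem complexSeminorm_schwartzIntegral_le (G : C(ℝ, 𝓢(E, ℂ))) {b M : ℝ}
    (hb : 0 ≤ b) {Q : Seminorm ℂ 𝓢(E, ℂ)} (hQ : Continuous Q)
    (hM : ∀ τ ∈ Set.Icc 0 b, Q (G τ) ≤ M) :
    Q (schwartzIntegral G 0 b) ≤ M * b := by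
  simpa using seminorm_schwartzIntegral_le_of_continuous G hb (Q.restrictScalars ℝ) hQ hM

/-- Truncation of time to the interval `[0, T]`. -/
def clampTime (T t : ℝ) : ℝ := max 0 (min t T)

theorem continuous_clampTime (T : ℝ) : Continuous (clampTime T) := by
  unfold clampTime; fun_prop

theorem clampTime_mem {T : ℝ} (hT : 0 ≤ T) (t : ℝ) : clampTime T t ∈ Set.Icc 0 T :=
  ⟨le_max_left _ _, max_le hT (min_le_right _ _)⟩

theorem clampTime_of_mem {T t : ℝ} (ht : t ∈ Set.Icc 0 T) : clampTime T t = t := by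
  rw [clampTime, min_eq_left ht.2, max_eq_right ht.1]

/-- One Picard step for the interaction picture equation, with time truncated to `[0, T]`. -/
def picardStep (σ : ℕ) (c : ℂ) (T : ℝ) (φ : 𝓢(E, ℂ)) (w : C(ℝ, 𝓢(E, ℂ))) : C(ℝ, 𝓢(E, ℂ)) where
  toFun t := φ + c • schwartzIntegral (interactionForcing σ w) 0 (clampTime T t)
  continuous_toFun := continuous_const.add (((continuous_schwartzIntegral _ 0).comp
    (continuous_clampTime T)).const_smul c)

/-- The Picard iterates. -/
def picardIterate (σ : ℕ) (c : ℂ) (T : ℝ) (φ : 𝓢(E, ℂ)) : ℕ → C(ℝ, 𝓢(E, ℂ))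
  | 0 => ContinuousMap.const ℝ φ
  | m + 1 => picardStep σ c T φ (picardIterate σ c T φ m)

section Picard

variable {σ : ℕ} {c : ℂ} {T M : ℝ} {φ : 𝓢(E, ℂ)} (hc : ‖c‖ ≤ 1) (hT0 : 0 ≤ T) (hT1 : T ≤ 1)
  (hTM : T * picardLipschitz σ M ≤ 1 / 2)
include hc hT0 hT1 hTM

theorem seminorm_picardStep_sub_le {Q : Seminorm ℂ 𝓢(E, ℂ)} (hQ : IsPicardSeminorm Q)
    {v w : C(ℝ, 𝓢(E, ℂ))} (hv : ∀ t, Q (v t) ≤ 2 * M) (hw : ∀ t, Q (w t) ≤ 2 * M) {D : ℝ}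
    (hD : ∀ t, Q (v t - w t) ≤ D) (t : ℝ) :
    Q (picardStep σ c T φ v t - picardStep σ c T φ w t) ≤ D / 2 := by
  have hM : 0 ≤ M := by linarith [apply_nonneg Q (v 0), hv 0]
  have hD0 : 0 ≤ D := (apply_nonneg _ _).trans (hD 0)
  have hL : 0 ≤ picardLipschitz σ M := by unfold picardLipschitz; positivity
  have hrepr : picardStep σ c T φ v t - picardStep σ c T φ w t = c • schwartzIntegral
      (interactionForcing σ v - interactionForcing σ w) 0 (clampTime T t) := by
    rw [schwartzIntegral_sub, smul_sub]
    exact add_sub_add_left_eq_sub _ _ _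
  have ht := clampTime_mem hT0 t
  rw [hrepr, map_smul_eq_mul]
  have hI : Q (schwartzIntegral (interactionForcing σ v - interactionForcing σ w) 0
      (clampTime T t)) ≤ picardLipschitz σ M * D * clampTime T t := by
    refine complexSeminorm_schwartzIntegral_le _ ht.1 hQ.continuous fun τ hτ => ?_
    have hτ1 : |τ| ≤ 1 := by
      rw [abs_of_nonneg hτ.1]; exact hτ.2.trans (ht.2.trans hT1)
    refine (hQ.forcing_sub_le σ hτ1 (hv τ) (hw τ)).trans ?_
    gcongr
    exact hD τ
  calc _ ≤ 1 * (picardLipschitz σ M * D * T) := by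
        gcongr
        refine hI.trans ?_
        gcongr
        exact ht.2
    _ = T * picardLipschitz σ M * D := by ring
    _ ≤ 1 / 2 * D := by gcongr
    _ = _ := by ring

theorem seminorm_picardStep_sub_data_le {Q : Seminorm ℂ 𝓢(E, ℂ)} (hQ : IsPicardSeminorm Q)
    {v : C(ℝ, 𝓢(E, ℂ))} (hv : ∀ t, Q (v t) ≤ 2 * M) (t : ℝ) :
    Q (picardStep σ c T φ v t - φ) ≤ M := by
  have hM : 0 ≤ M := by linarith [apply_nonneg Q (v 0), hv 0]
  have h0 : picardStep σ c T φ 0 t = φ := by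
    have : interactionForcing σ (0 : C(ℝ, 𝓢(E, ℂ))) = 0 := by
      ext τ x
      simp [interactionForcing_apply, powerNonlinearity_zero]
    have hz : schwartzIntegral (0 : C(ℝ, 𝓢(E, ℂ))) 0 (clampTime T t) = 0 := by
      ext x
      simp [schwartzIntegral_apply]
    change φ + c • schwartzIntegral (interactionForcing σ 0) 0 (clampTime T t) = φ
    rw [this, hz, smul_zero, add_zero]
  have := seminorm_picardStep_sub_le (φ := φ) hc hT0 hT1 hTM hQ hv (w := 0)
    (fun t => by simpa using hM) (D := 2 * M) (fun t => by simpa using hv t) t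
  rw [h0] at this
  linarith

theorem seminorm_picardIterate {Q : Seminorm ℂ 𝓢(E, ℂ)} (hQ : IsPicardSeminorm Q)
    (hφ : Q φ ≤ M) (m : ℕ) : (∀ t, Q (picardIterate σ c T φ m t) ≤ 2 * M) ∧
      ∀ t, Q (picardIterate σ c T φ (m + 1) t - picardIterate σ c T φ m t) ≤ M * (1 / 2) ^ m := by
  have hM : 0 ≤ M := (apply_nonneg _ _).trans hφ
  have hbd : ∀ m, ∀ t, Q (picardIterate σ c T φ m t) ≤ 2 * M := by
    intro m
    induction m with
    | zero => exact fun t => hφ.trans (by linarith)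
    | succ m ih =>
      intro t
      have := seminorm_picardStep_sub_data_le (φ := φ) hc hT0 hT1 hTM hQ ih t
      have h2 := map_add_le_add Q (picardIterate σ c T φ (m + 1) t - φ) φ
      rw [sub_add_cancel] at h2
      exact h2.trans (by rw [two_mul]; exact add_le_add this hφ)
  refine ⟨hbd m, ?_⟩
  induction m with
  | zero =>
    intro t
    rw [pow_zero, mul_one]
    exact seminorm_picardStep_sub_data_le (φ := φ) hc hT0 hT1 hTM hQ (hbd 0) t
  | succ m ih =>
    intro t
    refine (seminorm_picardStep_sub_le (φ := φ) hc hT0 hT1 hTM hQ (hbd (m + 1)) (hbd m)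
      ih t).trans (le_of_eq ?_)
    rw [pow_succ]; ring

/-- Local existence for the interaction picture equation, on a time interval that depends only on
the Wiener norm of the datum. -/
theorem exists_interaction_solution (hφ : wienerSeminorm 1 0 φ < M) :
    ∃ w : C(ℝ, 𝓢(E, ℂ)), (∀ t, wienerSeminorm 1 0 (w t) ≤ 2 * M) ∧
      ∀ t ∈ Set.Icc 0 T, w t = φ + c • schwartzIntegral (interactionForcing σ w) 0 t := by
  set u := picardIterate σ c T φ with hu
  -- geometric convergence in every Schwartz seminorm, uniformly in time
  have hconv : ∀ k n : ℕ, ∃ C : ℝ, ∀ t m,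
      SchwartzMap.seminorm ℝ k n (u (m + 1) t - u m t) ≤ C * (1 / 2) ^ m := by
    intro k n
    obtain ⟨ε, hε0, hε1, hQ, hQφ⟩ := exists_isPicardSeminorm (k + n) hφ
    obtain ⟨C, hC0, hC⟩ := exists_seminorm_le_spatialWienerSeminorm (E := E) ε hε0 hε1 k n
    refine ⟨C * M, fun t m => (hC _).trans ?_⟩
    rw [mul_assoc]
    gcongr
    exact (seminorm_picardIterate hc hT0 hT1 hTM hQ hQφ m).2 t
  choose C hC using hconv
  choose v hv using fun t => exists_schwartz_limit (fun m => u m t) C fun k n m => hC k n t m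
  have hpow : ∀ a : ℝ, Tendsto (fun m : ℕ => a * (1 / 2 : ℝ) ^ m) atTop (𝓝 0) := fun a => by
    simpa using (tendsto_pow_atTop_nhds_zero_of_lt_one (by norm_num : (0 : ℝ) ≤ 1 / 2)
      (by norm_num)).const_mul a
  have hvc : Continuous v := by
    rw [continuous_iff_continuousAt]
    intro t
    rw [ContinuousAt, (schwartz_withSeminorms ℝ E ℂ).tendsto_nhds]
    rintro ⟨k, n⟩ ε hε
    obtain ⟨m, hm⟩ := ((hpow (C k n * 2)).eventually (gt_mem_nhds (show 0 < ε / 3 by positivity))).exists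
    have h1 : ∀ᶠ s in 𝓝 t, SchwartzMap.seminorm ℝ k n (u m s - u m t) < ε / 3 := by
      have hcont : Continuous fun s => SchwartzMap.seminorm ℝ k n (u m s - u m t) :=
        (continuous_seminorm k n).comp ((u m).continuous.sub continuous_const)
      have := hcont.tendsto t
      rw [sub_self, map_zero] at this
      exact this.eventually (gt_mem_nhds (by positivity))
    filter_upwards [h1] with s hs
    change SchwartzMap.seminorm ℝ k n (v s - v t) < ε
    have hsplit : v s - v t = (v s - u m s) + ((u m s - u m t) - (v t - u m t)) := by abel
    have h2 := map_add_le_add (SchwartzMap.seminorm ℝ k n) (v s - u m s)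
      ((u m s - u m t) - (v t - u m t))
    have h3 := map_sub_le_add (SchwartzMap.seminorm ℝ k n) (u m s - u m t) (v t - u m t)
    rw [hsplit]
    linarith [hv s k n m, hv t k n m]
  have hlim : ∀ t, Tendsto (fun m => u m t) atTop (𝓝 (v t)) := by
    intro t
    rw [(schwartz_withSeminorms ℝ E ℂ).tendsto_nhds]
    rintro ⟨k, n⟩ ε hε
    filter_upwards [(hpow (C k n * 2)).eventually (gt_mem_nhds hε)] with m hm
    change SchwartzMap.seminorm ℝ k n (u m t - v t) < ε
    rw [map_sub_rev]
    exact (hv t k n m).trans_lt hm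
  set A := wienerSeminorm (E := E) 1 0 with hA
  have hAP : IsPicardSeminorm A := isPicardSeminorm_wienerSeminorm
  have hit := fun m => seminorm_picardIterate (φ := φ) hc hT0 hT1 hTM hAP hφ.le m
  have hM : 0 ≤ M := (apply_nonneg _ _).trans hφ.le
  have hAv : ∀ t, A (v t) ≤ 2 * M := fun t =>
    le_of_tendsto ((hAP.continuous.tendsto _).comp (hlim t))
      (Eventually.of_forall fun m => (hit m).1 t)
  have hAuv : ∀ m t, A (u m t - v t) ≤ 2 * M * (1 / 2) ^ m := by
    intro m t
    have h1 : Tendsto (fun j => A (u m t - u (m + j) t)) atTop (𝓝 (A (u m t - v t))) :=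
      (hAP.continuous.tendsto _).comp (tendsto_const_nhds.sub
        ((hlim t).comp (tendsto_add_atTop_nat m |>.congr fun j => add_comm j m)))
    refine le_of_tendsto h1 (Eventually.of_forall fun j => ?_)
    have h2 : A (u m t - u (m + j) t) ≤ 2 * M * (1 / 2) ^ m * (1 - (1 / 2) ^ j) := by
      induction j with
      | zero => simp
      | succ j ih =>
        have h3 := map_sub_le_add A (u m t - u (m + j) t) (u (m + j + 1) t - u (m + j) t)
        rw [sub_sub_sub_cancel_right] at h3
        have h4 := (hit (m + j)).2 t
        calc _ ≤ _ := h3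
          _ ≤ 2 * M * (1 / 2) ^ m * (1 - (1 / 2) ^ j) + M * (1 / 2) ^ (m + j) := add_le_add ih h4
          _ = _ := by rw [pow_add, pow_succ]; ring
    refine h2.trans (mul_le_of_le_one_right (by positivity) ?_)
    have : (0 : ℝ) ≤ (1 / 2) ^ j := by positivity
    linarith
  refine ⟨⟨v, hvc⟩, hAv, fun t ht => ?_⟩
  have hfix : picardStep σ c T φ ⟨v, hvc⟩ t = v t := by
    have hle : A (picardStep σ c T φ ⟨v, hvc⟩ t - v t) ≤ 0 := by
      refine ge_of_tendsto (hpow (2 * M)) (Eventually.of_forall fun m => ?_)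
      have h1 := seminorm_picardStep_sub_le (φ := φ) hc hT0 hT1 hTM hAP (v := ⟨v, hvc⟩) (w := u m)
        hAv (hit m).1 (D := 2 * M * (1 / 2) ^ m)
        (fun t => by
          have := hAuv m t
          rwa [map_sub_rev] at this) t
      have h2 := hAuv (m + 1) t
      have h3 := map_add_le_add A (picardStep σ c T φ ⟨v, hvc⟩ t - u (m + 1) t) (u (m + 1) t - v t)
      rw [sub_add_sub_cancel] at h3
      refine h3.trans ((add_le_add h1 h2).trans (le_of_eq ?_))
      rw [pow_succ]; ring
    ext x
    have h5 := (norm_apply_le_wienerSeminorm 1 (picardStep σ c T φ ⟨v, hvc⟩ t - v t) x).trans hle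
    rw [sub_apply] at h5
    exact sub_eq_zero.1 (norm_le_zero_iff.1 h5)
  have hct : clampTime T t = t := clampTime_of_mem ht
  calc v t = picardStep σ c T φ ⟨v, hvc⟩ t := hfix.symm
    _ = φ + c • schwartzIntegral (interactionForcing σ ⟨v, hvc⟩) 0 (clampTime T t) := rfl
    _ = _ := by rw [hct]

end Picard

end Existence

/-! ### Classical solutions and the interaction picture -/

section FreeFlow

open FourierTransform

variable {E : Type} [NormedAddCommGroup E] [InnerProductSpace ℝ E] [FiniteDimensional ℝ E]
  [MeasurableSpace E] [BorelSpace E]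

/-- Evaluation of the Fourier transform at a frequency, as a continuous linear functional. -/
def fourierEvalCLM (ξ : E) : 𝓢(E, ℂ) →L[ℝ] ℂ :=
  (evalCLMAt ξ).comp ((FourierTransform.fourierCLM ℂ 𝓢(E, ℂ)).restrictScalars ℝ)

theorem fourierEvalCLM_apply (ξ : E) (f : 𝓢(E, ℂ)) : fourierEvalCLM ξ f = 𝓕 f ξ := rfl

theorem hasDerivAt_schrodingerSymbol (c t : ℝ) (ξ : E) :
    HasDerivAt (fun τ => schrodingerSymbol (c * τ) ξ)
      (schrodingerSymbol (c * t) ξ * (c * (-(2 * Real.pi ^ 2) * ‖ξ‖ ^ 2) * Complex.I)) t := by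
  have h1 : HasDerivAt (fun τ : ℝ => ((-(2 * Real.pi ^ 2 * (c * τ)) * ‖ξ‖ ^ 2 : ℝ) : ℂ) * Complex.I)
      (c * (-(2 * Real.pi ^ 2) * ‖ξ‖ ^ 2) * Complex.I) t := by
    have h2 : HasDerivAt (fun τ : ℝ => -(2 * Real.pi ^ 2 * (c * τ)) * ‖ξ‖ ^ 2)
        (c * (-(2 * Real.pi ^ 2) * ‖ξ‖ ^ 2)) t := by
      have := (hasDerivAt_id t).mul_const (c * (-(2 * Real.pi ^ 2) * ‖ξ‖ ^ 2))
      rw [one_mul] at this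
      refine this.congr_of_eventuallyEq (Eventually.of_forall fun τ => ?_)
      simp only [id]; ring
    have := (h2.ofReal_comp).mul_const Complex.I
    push_cast at this ⊢
    exact this
  exact h1.cexp

/-- The Duhamel form `e^{icτΔ/2} f` of the free evolution, as an integral in the Schwartz
space. -/
theorem schrodingerGroup_eq_add_schwartzIntegral (c t : ℝ) (f : 𝓢(E, ℂ)) :
    schrodingerGroup (c * t) f = f + schwartzIntegral
      ⟨fun τ => schrodingerGroup (c * τ) ((c * (Complex.I / 2)) • Δ f),
        continuous_schrodingerGroup_comp (continuous_const.mul continuous_id)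
          continuous_const⟩ 0 t := by
  refine schwartz_ext_fourier fun ξ => ?_
  rw [← fourierEvalCLM_apply, ← fourierEvalCLM_apply, map_add, clm_schwartzIntegral]
  simp only [ContinuousMap.coe_mk, fourierEvalCLM_apply, fourier_schrodingerGroup_apply,
    FourierTransform.fourier_smul, smul_apply, fourier_laplacian_apply, smul_eq_mul]
  have h := intervalIntegral.integral_eq_sub_of_hasDerivAt (a := 0) (b := t)
    (fun τ _ => (hasDerivAt_schrodingerSymbol c τ ξ).mul_const (𝓕 f ξ))
    (Continuous.intervalIntegrable (by unfold schrodingerSymbol; fun_prop) _ _)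
  rw [mul_zero, schrodingerSymbol_zero, one_mul] at h
  rw [← sub_eq_iff_eq_add', ← h]
  congr 1
  ext τ
  ring

theorem tendsto_slope_schrodingerGroup (c t : ℝ) (f : 𝓢(E, ℂ)) :
    Tendsto (slope (fun τ => schrodingerGroup (c * τ) f) t) (𝓝[≠] t)
      (𝓝 (schrodingerGroup (c * t) ((c * (Complex.I / 2)) • Δ f))) := by
  refine (tendsto_slope_schwartzIntegral ⟨fun τ => schrodingerGroup (c * τ)
    ((c * (Complex.I / 2)) • Δ f), continuous_schrodingerGroup_comp
      (continuous_const.mul continuous_id) continuous_const⟩ 0 t).congr fun τ => ?_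
  simp only [slope, vsub_eq_sub]
  rw [schrodingerGroup_eq_add_schwartzIntegral c τ f, schrodingerGroup_eq_add_schwartzIntegral c t f,
    add_sub_add_left_eq_sub]

/-- The product rule for `τ ↦ e^{icτΔ/2} w(τ)`. -/
theorem tendsto_slope_schrodingerGroup_comp (c : ℝ) {w : ℝ → 𝓢(E, ℂ)} {v : 𝓢(E, ℂ)} {s : Set ℝ}
    {t : ℝ} (h : Tendsto (slope w t) (𝓝[s \ {t}] t) (𝓝 v)) :
    Tendsto (slope (fun τ => schrodingerGroup (c * τ) (w τ)) t) (𝓝[s \ {t}] t)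
      (𝓝 (schrodingerGroup (c * t) v +
        schrodingerGroup (c * t) ((c * (Complex.I / 2)) • Δ (w t)))) := by
  have h1 : Tendsto (fun τ => schrodingerGroup (c * τ) (slope w t τ)) (𝓝[s \ {t}] t)
      (𝓝 (schrodingerGroup (c * t) v)) := by
    have h2 : Tendsto (fun τ : ℝ => c * τ) (𝓝[s \ {t}] t) (𝓝 (c * t)) :=
      ((continuous_const.mul continuous_id).tendsto t).mono_left nhdsWithin_le_nhds
    exact Tendsto.comp (g := fun p : ℝ × 𝓢(E, ℂ) => schrodingerGroup p.1 p.2)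
      (f := fun τ => (c * τ, slope w t τ)) (y := 𝓝 (c * t, v))
      (continuous_schrodingerGroup.tendsto (c * t, v)) (h2.prodMk_nhds h)
  refine (h1.add ((tendsto_slope_schrodingerGroup c t (w t)).mono_left
    (nhdsWithin_mono _ fun z hz => hz.2))).congr fun τ => ?_
  simp only [slope, vsub_eq_sub]
  have h3 : schrodingerGroup (c * τ) ((τ - t)⁻¹ • (w τ - w t)) =
      (τ - t)⁻¹ • schrodingerGroup (c * τ) (w τ - w t) :=
    ((schrodingerGroup (c * τ)).restrictScalars ℝ).map_smul _ _
  rw [h3, map_sub, ← smul_add, sub_add_sub_cancel]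

theorem laplacian_schrodingerGroup (t : ℝ) (f : 𝓢(E, ℂ)) :
    Δ (schrodingerGroup t f) = schrodingerGroup t (Δ f) := by
  refine schwartz_ext_fourier fun ξ => ?_
  rw [fourier_laplacian_apply, fourier_schrodingerGroup_apply, fourier_schrodingerGroup_apply,
    fourier_laplacian_apply]
  ring

theorem slope_congr_on {V : Type*} [AddCommGroup V] [Module ℝ V] [TopologicalSpace V]
    {f g : ℝ → V} {s : Set ℝ} {t : ℝ} {v : V} (ht : t ∈ s) (hfg : Set.EqOn f g s)
    (h : Tendsto (slope g t) (𝓝[s \ {t}] t) (𝓝 v)) :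
    Tendsto (slope f t) (𝓝[s \ {t}] t) (𝓝 v) := by
  refine h.congr' ?_
  filter_upwards [self_mem_nhdsWithin] with τ hτ
  rw [slope, slope, hfg ht, hfg hτ.1]

end FreeFlow

section Solutions

variable {d σ : ℕ} {μ T : ℝ}

/-- Undoing the interaction picture turns a solution of Duhamel's equation into a classical
solution. -/
theorem isNLSSolution_of_interaction {w : C(ℝ, 𝓢(EuclideanSpace ℝ (Fin d), ℂ))}
    {φ : 𝓢(EuclideanSpace ℝ (Fin d), ℂ)}
    (hw : ∀ t ∈ Set.Icc 0 T, w t =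
      φ + (-(Complex.I * μ)) • schwartzIntegral (interactionForcing σ w) 0 t) :
    IsNLSSolution σ μ T fun t => schrodingerGroup t (w t) := by
  refine ⟨(continuous_schrodingerGroup_comp continuous_id w.continuous).continuousOn,
    fun t ht x => ?_⟩
  have h1 : Tendsto (slope w t) (𝓝[Set.Icc 0 T \ {t}] t)
      (𝓝 ((-(Complex.I * μ)) • interactionForcing σ w t)) := by
    refine slope_congr_on ht hw ?_
    have h2 := (tendsto_slope_schwartzIntegral (interactionForcing σ w) 0 t).const_smul
      (-(Complex.I * μ))
    refine (h2.mono_left (nhdsWithin_mono _ fun z hz => hz.2)).congr fun τ => ?_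
    simp only [slope, vsub_eq_sub, add_sub_add_left_eq_sub, ← smul_sub]
    rw [smul_comm]
  have h3 := tendsto_slope_schrodingerGroup_comp 1 h1
  simp only [one_mul] at h3
  have h4 := hasDerivWithinAt_clm_comp (evalCLMAt x) h3
  refine ⟨_, h4, ?_⟩
  have h5 : schrodingerGroup t ((-(Complex.I * μ)) • interactionForcing σ w t) =
      (-(Complex.I * μ)) • powerNonlinearity σ (schrodingerGroup t (w t)) := by
    rw [map_smul, interactionForcing_apply, ← schrodingerGroup_add, add_neg_cancel,
      schrodingerGroup_zero]
  rw [h5, map_smul, ← laplacian_schrodingerGroup, evalCLMAt_apply, add_apply, smul_apply,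
    smul_apply, powerNonlinearity_apply, smul_eq_mul, smul_eq_mul]
  push_cast
  linear_combination (-(μ : ℂ) * (‖schrodingerGroup t (w t) x‖ : ℂ) ^ (2 * σ) *
    schrodingerGroup t (w t) x + 1 / 2 * (Δ (schrodingerGroup t (w t))) x) * Complex.I_mul_I

/-- The right-hand side `∂ₜψ = (i/2) Δψ - i μ |ψ|^{2σ} ψ` of the equation. -/
def nlsVectorField (σ : ℕ) (μ : ℝ) (f : 𝓢(EuclideanSpace ℝ (Fin d), ℂ)) :
    𝓢(EuclideanSpace ℝ (Fin d), ℂ) :=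
  (Complex.I / 2) • Δ f - (Complex.I * μ) • powerNonlinearity σ f

theorem continuous_nlsVectorField (σ : ℕ) (μ : ℝ) :
    Continuous (nlsVectorField (d := d) σ μ) := by
  have h : Continuous fun f : 𝓢(EuclideanSpace ℝ (Fin d), ℂ) => Δ f :=
    (LineDeriv.laplacianCLM ℝ (EuclideanSpace ℝ (Fin d))
      𝓢(EuclideanSpace ℝ (Fin d), ℂ)).continuous
  exact (h.const_smul (Complex.I / 2)).sub
    ((continuous_powerNonlinearity σ).const_smul (Complex.I * μ))

/-- A classical solution is differentiable in time with respect to the Schwartz topology. -/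
theorem IsNLSSolution.tendsto_slope {χ : ℝ → 𝓢(EuclideanSpace ℝ (Fin d), ℂ)} (hT : 0 ≤ T)
    (hχ : IsNLSSolution σ μ T χ) {t : ℝ} (ht : t ∈ Set.Icc 0 T) :
    Tendsto (slope χ t) (𝓝[Set.Icc 0 T \ {t}] t) (𝓝 (nlsVectorField σ μ (χ t))) := by
  have hcl : Continuous fun τ => χ (clampTime T τ) :=
    hχ.continuousOn.comp_continuous (continuous_clampTime T) (clampTime_mem hT)
  set G : C(ℝ, 𝓢(EuclideanSpace ℝ (Fin d), ℂ)) :=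
    ⟨fun τ => nlsVectorField σ μ (χ (clampTime T τ)), (continuous_nlsVectorField σ μ).comp hcl⟩
    with hG
  have hder : ∀ τ ∈ Set.Icc 0 T, ∀ x, HasDerivWithinAt (fun τ => χ τ x) (G τ x)
      (Set.Icc 0 T) τ := by
    intro τ hτ x
    obtain ⟨v, hv, hv'⟩ := hχ.equation τ hτ x
    have : G τ x = v := by
      rw [hG]
      simp only [ContinuousMap.coe_mk, nlsVectorField, sub_apply, smul_apply, smul_eq_mul,
        powerNonlinearity_apply, clampTime_of_mem hτ]
      linear_combination Complex.I * hv' - v * Complex.I_mul_I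
    rwa [this]
  have hint : ∀ τ ∈ Set.Icc 0 T, χ τ = χ 0 + schwartzIntegral G 0 τ := by
    intro τ hτ
    ext x
    rw [add_apply, schwartzIntegral_apply]
    have := intervalIntegral.integral_eq_sub_of_hasDeriv_right (a := 0) (b := τ)
      (f := fun τ => χ τ x) (f' := fun τ => G τ x)
      (by
        rw [Set.uIcc_of_le hτ.1]
        exact fun r hr => ((hder r ⟨hr.1, hr.2.trans hτ.2⟩ x).continuousWithinAt).mono
          (Set.Icc_subset_Icc_right hτ.2))
      (by
        rw [min_eq_left hτ.1, max_eq_right hτ.1]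
        intro r hr
        refine ((hder r ⟨hr.1.le, hr.2.le.trans hτ.2⟩ x).hasDerivAt ?_).hasDerivWithinAt
        exact Icc_mem_nhds hr.1 (hr.2.trans_le hτ.2))
      ((continuous_schwartz_eval G.continuous x).intervalIntegrable _ _)
    rw [this]
    ring
  refine slope_congr_on ht hint ?_
  have h2 := tendsto_slope_schwartzIntegral G 0 t
  have h3 : G t = nlsVectorField σ μ (χ t) := by
    simp only [hG, ContinuousMap.coe_mk, clampTime_of_mem ht]
  rw [h3] at h2
  refine (h2.mono_left (nhdsWithin_mono _ fun z hz => hz.2)).congr fun τ => ?_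
  simp only [slope, vsub_eq_sub, add_sub_add_left_eq_sub]

/-- In the interaction picture `e^{-iτΔ/2} χ(τ)` the Laplacian drops out of the equation. -/
theorem IsNLSSolution.tendsto_slope_interaction {χ : ℝ → 𝓢(EuclideanSpace ℝ (Fin d), ℂ)}
    (hT : 0 ≤ T) (hχ : IsNLSSolution σ μ T χ) {t : ℝ} (ht : t ∈ Set.Icc 0 T) :
    Tendsto (slope (fun τ => schrodingerGroup (-τ) (χ τ)) t) (𝓝[Set.Icc 0 T \ {t}] t)
      (𝓝 (schrodingerGroup (-t) (-(Complex.I * μ) • powerNonlinearity σ (χ t)))) := by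
  have h := tendsto_slope_schrodingerGroup_comp (-1) (hχ.tendsto_slope hT ht)
  simp only [neg_one_mul, ← map_add] at h
  convert h using 3
  rw [nlsVectorField]
  push_cast
  module

/-- Classical solutions are determined by their initial datum: in the interaction picture the
difference of two solutions satisfies a Gronwall inequality in the Wiener norm. -/
theorem IsNLSSolution.unique {χ ψ : ℝ → 𝓢(EuclideanSpace ℝ (Fin d), ℂ)} (hT : 0 ≤ T)
    (hμ : |μ| = 1) (hχ : IsNLSSolution σ μ T χ) (hψ : IsNLSSolution σ μ T ψ)
    (h0 : χ 0 = ψ 0) : ∀ t ∈ Set.Icc 0 T, χ t = ψ t := by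
  set Q : Seminorm ℂ 𝓢(EuclideanSpace ℝ (Fin d), ℂ) := wienerSeminorm 1 0 with hQ
  have hQc : Continuous Q := continuous_wienerSeminorm 1 0
  obtain ⟨R, hR⟩ : ∃ R, ∀ t ∈ Set.Icc 0 T, Q (χ t) ≤ R ∧ Q (ψ t) ≤ R := by
    obtain ⟨R1, h1⟩ := isCompact_Icc.bddAbove_image (hQc.comp_continuousOn hχ.continuousOn)
    obtain ⟨R2, h2⟩ := isCompact_Icc.bddAbove_image (hQc.comp_continuousOn hψ.continuousOn)
    exact ⟨max R1 R2, fun t ht => ⟨(h1 ⟨t, ht, rfl⟩).trans (le_max_left _ _),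
      (h2 ⟨t, ht, rfl⟩).trans (le_max_right _ _)⟩⟩
  set u : ℝ → 𝓢(EuclideanSpace ℝ (Fin d), ℂ) :=
    fun τ => schrodingerGroup (-τ) (χ τ) - schrodingerGroup (-τ) (ψ τ) with hu
  set v : ℝ → 𝓢(EuclideanSpace ℝ (Fin d), ℂ) := fun t =>
    schrodingerGroup (-t) (-(Complex.I * μ) • powerNonlinearity σ (χ t)) -
    schrodingerGroup (-t) (-(Complex.I * μ) • powerNonlinearity σ (ψ t)) with hv
  have hQu : ∀ t, Q (u t) = Q (χ t - ψ t) := fun t => by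
    rw [hu]
    simp only [← map_sub]
    exact wienerSeminorm_schrodingerGroup 1 0 _ _
  have hslope : ∀ t ∈ Set.Icc 0 T, Tendsto (slope u t) (𝓝[Set.Icc 0 T \ {t}] t) (𝓝 (v t)) := by
    intro t ht
    refine ((hχ.tendsto_slope_interaction hT ht).sub
      (hψ.tendsto_slope_interaction hT ht)).congr fun τ => ?_
    simp only [slope, vsub_eq_sub, ← smul_sub, hu]
    congr 1
    abel
  have hQv : ∀ t ∈ Set.Icc 0 T, Q (v t) ≤ (2 * σ + 1) * R ^ (2 * σ) * Q (u t) := by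
    intro t ht
    rw [hQu, hv]
    simp only [← map_sub, ← smul_sub]
    rw [hQ, wienerSeminorm_schrodingerGroup, ← hQ, map_smul_eq_mul, norm_neg, norm_mul,
      Complex.norm_I, Complex.norm_real, Real.norm_eq_abs, hμ, one_mul, one_mul]
    exact seminorm_powerNonlinearity_sub_le isPicardSeminorm_wienerSeminorm.mul_le
      isPicardSeminorm_wienerSeminorm.conj_eq σ (hR t ht).1 (hR t ht).2
  have hgr := le_gronwallBound_of_liminf_deriv_right_le (f := fun t => Q (u t))
    (f' := fun t => Q (v t)) (δ := 0) (K := (2 * σ + 1) * R ^ (2 * σ)) (ε := 0) (a := 0) (b := T)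
    (hQc.comp_continuousOn fun t ht => continuousWithinAt_of_tendsto_slope (hslope t ht))
    (by
      intro x hx r hr
      have hs : Tendsto (slope u x) (𝓝[>] x) (𝓝 (v x)) := by
        refine (hslope x (Set.Ico_subset_Icc_self hx)).mono_left ?_
        refine nhdsWithin_le_iff.2 ?_
        filter_upwards [Ioo_mem_nhdsGT hx.2] with z hz
        exact ⟨⟨hx.1.trans hz.1.le, hz.2.le⟩, hz.1.ne'⟩
      have h1 : Tendsto (fun z => Q (slope u x z)) (𝓝[>] x) (𝓝 (Q (v x))) :=
        (hQc.tendsto _).comp hs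
      refine Eventually.frequently ?_
      filter_upwards [h1.eventually (gt_mem_nhds hr), self_mem_nhdsWithin] with z hz hxz
      refine lt_of_le_of_lt ?_ hz
      have hpos : 0 < z - x := sub_pos.2 hxz
      have h2 : Q (slope u x z) = (z - x)⁻¹ * Q (u z - u x) := by
        rw [slope, vsub_eq_sub, ← Complex.coe_smul, map_smul_eq_mul, Complex.norm_real,
          Real.norm_eq_abs, abs_of_pos (inv_pos.2 hpos)]
      rw [h2]
      gcongr
      have := map_add_le_add Q (u z - u x) (u x)
      rw [sub_add_cancel] at this
      linarith)
    (by simp [hu, h0])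
    (fun x hx => by simpa using hQv x (Set.Ico_subset_Icc_self hx))
  intro t ht
  have h1 : Q (χ t - ψ t) ≤ 0 := by
    have := hgr t ht
    rw [gronwallBound_ε0_δ0] at this
    rwa [← hQu]
  ext x
  have h2 := (norm_apply_le_wienerSeminorm 1 (χ t - ψ t) x).trans h1
  rw [sub_apply] at h2
  exact sub_eq_zero.1 (norm_le_zero_iff.1 h2)

end Solutions

/-! ### Fourier–Lebesgue norms -/

section Modulation

open FourierTransform

variable {E : Type} [NormedAddCommGroup E] [InnerProductSpace ℝ E] [FiniteDimensional ℝ E]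
  [MeasurableSpace E] [BorelSpace E]

/-- Multiplication by the plane wave `e^{2πi x·η}`. -/
def modulation (η : E) : 𝓢(E, ℂ) →L[ℂ] 𝓢(E, ℂ) :=
  SchwartzMap.smulLeftCLM ℂ
    (fun x : E => Complex.exp (((2 * Real.pi * inner ℝ x η : ℝ) : ℂ) * Complex.I))

theorem modulation_apply (η : E) (f : 𝓢(E, ℂ)) (x : E) :
    modulation η f x = Complex.exp (((2 * Real.pi * inner ℝ x η : ℝ) : ℂ) * Complex.I) * f x := by
  rw [modulation, SchwartzMap.smulLeftCLM_apply_apply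
    (hasTemperateGrowth_cexp_comp (h := fun x : E => 2 * Real.pi * inner ℝ x η)
      ((Function.HasTemperateGrowth.const _).mul (by fun_prop))), smul_eq_mul]

theorem fourier_modulation_apply (η : E) (f : 𝓢(E, ℂ)) (ξ : E) :
    𝓕 (modulation η f) ξ = 𝓕 f (ξ - η) := by
  rw [SchwartzMap.fourier_coe, SchwartzMap.fourier_coe, Real.fourier_eq', Real.fourier_eq']
  congr 1
  ext x
  rw [modulation_apply, smul_eq_mul, smul_eq_mul, ← mul_assoc, ← Complex.exp_add]
  congr 2
  rw [inner_sub_right]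
  push_cast
  ring

theorem wienerSeminorm_modulation (η : E) (f : 𝓢(E, ℂ)) :
    wienerSeminorm 1 0 (modulation η f) = wienerSeminorm 1 0 f := by
  simp only [wienerSeminorm_zero_apply, fourier_modulation_apply]
  exact integral_sub_right_eq_self (fun ξ => ‖(𝓕 f : 𝓢(E, ℂ)) ξ‖) η

theorem eLpNorm_schwartz_lt_top (f : 𝓢(E, ℂ)) (p : ℝ≥0∞) :
    eLpNorm f p (volume : Measure E) < ∞ :=
  f.eLpNorm_lt_top p volume

end Modulation

section Weights

variable {E : Type} [NormedAddCommGroup E] [InnerProductSpace ℝ E]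

/-- The Japanese bracket `⟨ξ⟩ᵏ = (1 + |ξ|²)^{k/2}`. -/
def bracket (k : ℝ) (ξ : E) : ℝ := (1 + ‖ξ‖ ^ 2) ^ (k / 2)

theorem bracket_pos (k : ℝ) (ξ : E) : 0 < bracket k ξ := by unfold bracket; positivity

theorem bracket_neg_mul (k : ℝ) (ξ : E) : bracket (-k) ξ * bracket k ξ = 1 := by
  rw [bracket, bracket, ← Real.rpow_add (by positivity)]
  simp [neg_div]

theorem hasTemperateGrowth_bracket (k : ℝ) :
    (fun ξ : E => ((bracket k ξ : ℝ) : ℂ)).HasTemperateGrowth :=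
  Function.Complex.hasTemperateGrowth_ofReal.comp
    (Function.hasTemperateGrowth_one_add_norm_sq_rpow E (k / 2))

/-- Peetre's inequality for negative exponents. -/
theorem bracket_le_of_neg {s : ℝ} (hs : s ≤ 0) (ξ ζ : E) :
    bracket s ξ ≤ 2 ^ (-s / 2) * bracket s ζ * bracket (-s) (ξ - ζ) := by
  have h1 : 1 + ‖ζ‖ ^ 2 ≤ 2 * (1 + ‖ξ‖ ^ 2) * (1 + ‖ξ - ζ‖ ^ 2) := by
    have h2 : ‖ζ‖ ≤ ‖ξ‖ + ‖ξ - ζ‖ := by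
      have := norm_sub_le ξ (ξ - ζ)
      rwa [sub_sub_cancel] at this
    have h3 : ‖ζ‖ ^ 2 ≤ (‖ξ‖ + ‖ξ - ζ‖) ^ 2 := by gcongr
    nlinarith [sq_nonneg (‖ξ‖ - ‖ξ - ζ‖), mul_nonneg (sq_nonneg ‖ξ‖) (sq_nonneg ‖ξ - ζ‖)]
  have h4 : (1 + ‖ζ‖ ^ 2) ^ (-s / 2) ≤
      2 ^ (-s / 2) * (1 + ‖ξ‖ ^ 2) ^ (-s / 2) * (1 + ‖ξ - ζ‖ ^ 2) ^ (-s / 2) := by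
    rw [← Real.mul_rpow (by positivity) (by positivity),
      ← Real.mul_rpow (by positivity) (by positivity)]
    exact Real.rpow_le_rpow (by positivity) h1 (by linarith)
  change bracket (-s) ζ ≤ 2 ^ (-s / 2) * bracket (-s) ξ * bracket (-s) (ξ - ζ) at h4
  have h5 := mul_le_mul_of_nonneg_left h4 (mul_nonneg (bracket_pos s ζ).le (bracket_pos s ξ).le)
  calc bracket s ξ = bracket s ζ * bracket s ξ * bracket (-s) ζ := by
        linear_combination (-bracket s ξ) * bracket_neg_mul s ζ
    _ ≤ _ := h5
    _ = _ := by
        linear_combination (2 ^ (-s / 2) * bracket s ζ * bracket (-s) (ξ - ζ)) *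
          bracket_neg_mul s ξ

theorem bracket_smul_le {s : ℝ} (hs : s ≤ 0) {N : ℝ} (hN : 0 < N) {ζ : E} (hζ : ζ ≠ 0) :
    bracket s (N • ζ) ≤ N ^ s * ‖ζ‖ ^ s := by
  have hpos : 0 < N * ‖ζ‖ := mul_pos hN (norm_pos_iff.2 hζ)
  rw [← Real.mul_rpow hN.le (norm_nonneg _), bracket, norm_smul, Real.norm_eq_abs, abs_of_pos hN]
  have h1 : (N * ‖ζ‖) ^ s = ((N * ‖ζ‖) ^ 2) ^ (s / 2) := by
    rw [← Real.rpow_natCast, ← Real.rpow_mul hpos.le]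
    congr 1
    push_cast
    ring
  rw [h1]
  exact Real.rpow_le_rpow_of_nonpos (by positivity) (by linarith) (by linarith)

end Weights

section FourierLebesgue

open FourierTransform

variable {d : ℕ}

local notation "𝔼" => EuclideanSpace ℝ (Fin d)

theorem fourierHat_eq (f : 𝓢(𝔼, ℂ)) (ξ : 𝔼) :
    fourierHat f ξ = (1 / (2 * (Real.pi : ℂ)) ^ d) * 𝓕 f ((2 * Real.pi)⁻¹ • ξ) := by
  rw [fourierHat, SchwartzMap.fourier_coe, Real.fourier_eq']
  congr 2
  ext x
  rw [smul_eq_mul, inner_smul_right]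
  congr 2
  have : (Real.pi : ℂ) ≠ 0 := by exact_mod_cast Real.pi_ne_zero
  push_cast
  field_simp

/-- The dilation `ξ ↦ ξ / (2π)` relating the two normalizations of the Fourier transform. -/
def frequencyDilation : 𝔼 ≃L[ℝ] 𝔼 :=
  ContinuousLinearEquiv.smulLeft (Units.mk0 (2 * Real.pi)⁻¹ (by positivity))

theorem frequencyDilation_apply (ξ : 𝔼) :
    frequencyDilation ξ = (2 * Real.pi)⁻¹ • ξ := rfl

/-- The function `⟨·⟩ᵏ f̂` as a Schwartz function. -/
def weightedHat (k : ℝ) (f : 𝓢(𝔼, ℂ)) : 𝓢(𝔼, ℂ) :=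
  SchwartzMap.smulLeftCLM ℂ (fun ξ : 𝔼 => ((bracket k ξ : ℝ) : ℂ))
    ((1 / (2 * (Real.pi : ℂ)) ^ d) • SchwartzMap.compCLMOfContinuousLinearEquiv ℂ
      frequencyDilation (𝓕 f : 𝓢(𝔼, ℂ)))

theorem weightedHat_apply (k : ℝ) (f : 𝓢(𝔼, ℂ)) (ξ : 𝔼) :
    weightedHat k f ξ = (bracket k ξ : ℂ) * fourierHat f ξ := by
  rw [weightedHat, SchwartzMap.smulLeftCLM_apply_apply (hasTemperateGrowth_bracket k),
    fourierHat_eq, smul_apply, SchwartzMap.compCLMOfContinuousLinearEquiv_apply,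
    Function.comp_apply, frequencyDilation_apply, smul_eq_mul, smul_eq_mul]

theorem fourierLebesgueNorm_eq (p : ℝ≥0∞) (k : ℝ) (f : 𝓢(𝔼, ℂ)) :
    fourierLebesgueNorm p k f = eLpNorm (weightedHat k f) p volume := by
  rw [fourierLebesgueNorm]
  congr 1
  ext ξ
  rw [weightedHat_apply, bracket]

theorem fourierLebesgueNorm_lt_top (p : ℝ≥0∞) (k : ℝ) (f : 𝓢(𝔼, ℂ)) :
    fourierLebesgueNorm p k f < ∞ := by
  rw [fourierLebesgueNorm_eq]
  exact eLpNorm_schwartz_lt_top _ p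

theorem fourierLebesgueNorm_schrodingerGroup (p : ℝ≥0∞) (k t : ℝ) (f : 𝓢(𝔼, ℂ)) :
    fourierLebesgueNorm p k (schrodingerGroup t f) = fourierLebesgueNorm p k f := by
  refine eLpNorm_congr_norm_ae (Eventually.of_forall fun ξ => ?_)
  simp only [fourierHat_eq, fourier_schrodingerGroup_apply, norm_mul, norm_schrodingerSymbol,
    one_mul]

theorem weightedHat_add (k : ℝ) (f g : 𝓢(𝔼, ℂ)) :
    weightedHat k (f + g) = weightedHat k f + weightedHat k g := by
  ext ξ
  simp only [weightedHat_apply, add_apply, fourierHat_eq, FourierTransform.fourier_add]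
  ring

theorem weightedHat_smul (k : ℝ) (c : ℂ) (f : 𝓢(𝔼, ℂ)) :
    weightedHat k (c • f) = c • weightedHat k f := by
  ext ξ
  simp only [weightedHat_apply, smul_apply, fourierHat_eq, FourierTransform.fourier_smul,
    smul_eq_mul]
  ring

theorem fourierLebesgueNorm_add_le {p : ℝ≥0∞} (hp : 1 ≤ p) (k : ℝ) (f g : 𝓢(𝔼, ℂ)) :
    fourierLebesgueNorm p k (f + g) ≤ fourierLebesgueNorm p k f + fourierLebesgueNorm p k g := by
  simp only [fourierLebesgueNorm_eq, weightedHat_add]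
  exact eLpNorm_add_le (weightedHat k f).continuous.aestronglyMeasurable
    (weightedHat k g).continuous.aestronglyMeasurable hp

theorem fourierLebesgueNorm_smul (p : ℝ≥0∞) (k : ℝ) (c : ℂ) (f : 𝓢(𝔼, ℂ)) :
    fourierLebesgueNorm p k (c • f) = ‖c‖ₑ * fourierLebesgueNorm p k f := by
  simp only [fourierLebesgueNorm_eq, weightedHat_smul]
  exact eLpNorm_const_smul c _ p volume

theorem fourierLebesgueNorm_sum_le {ι : Type*} {p : ℝ≥0∞} (hp : 1 ≤ p) (k : ℝ) (s : Finset ι)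
    (f : ι → 𝓢(𝔼, ℂ)) :
    fourierLebesgueNorm p k (∑ i ∈ s, f i) ≤ ∑ i ∈ s, fourierLebesgueNorm p k (f i) := by
  classical
  induction s using Finset.induction_on with
  | empty =>
    have := fourierLebesgueNorm_smul p k 0 (0 : 𝓢(𝔼, ℂ))
    simp only [smul_zero, enorm_zero, zero_mul] at this
    simp [this]
  | insert i s hi ih =>
    rw [Finset.sum_insert hi, Finset.sum_insert hi]
    exact (fourierLebesgueNorm_add_le hp k _ _).trans (by gcongr)

theorem fourierHat_modulation (η : 𝔼) (f : 𝓢(𝔼, ℂ)) (ξ : 𝔼) :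
    fourierHat (modulation η f) ξ = fourierHat f (ξ - (2 * Real.pi) • η) := by
  rw [fourierHat_eq, fourierHat_eq, fourier_modulation_apply, smul_sub, smul_smul,
    inv_mul_cancel₀ (by positivity), one_smul]

/-- Modulating by a large frequency gains a power of that frequency in Fourier–Lebesgue norms of
negative order. -/
theorem fourierLebesgueNorm_modulation_le (p : ℝ≥0∞) {s : ℝ} (hs : s ≤ 0) {N : ℝ} (hN : 0 < N)
    {κ : 𝔼} (hκ : κ ≠ 0) (f : 𝓢(𝔼, ℂ)) :
    fourierLebesgueNorm p s (modulation (N • κ) f) ≤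
      ENNReal.ofReal (N ^ s) *
        (ENNReal.ofReal (2 ^ (-s / 2) * ‖(2 * Real.pi) • κ‖ ^ s) *
          fourierLebesgueNorm p (-s) f) := by
  set ζ : 𝔼 := (2 * Real.pi) • κ with hζ
  have hζ0 : ζ ≠ 0 := smul_ne_zero (by positivity) hκ
  have h1 : eLpNorm (fun ξ => weightedHat (-s) f (ξ - N • ζ)) p volume =
      fourierLebesgueNorm p (-s) f := by
    rw [fourierLebesgueNorm_eq]
    exact eLpNorm_comp_measurePreserving (weightedHat (-s) f).continuous.aestronglyMeasurable
      (measurePreserving_sub_right volume (N • ζ))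
  have h2 : ∀ ξ, ‖weightedHat s (modulation (N • κ) f) ξ‖ ≤
      ‖((2 ^ (-s / 2) * bracket s (N • ζ) : ℝ) • fun ξ => weightedHat (-s) f (ξ - N • ζ)) ξ‖ := by
    intro ξ
    have hsm : (2 * Real.pi) • N • κ = N • ζ := smul_comm _ _ _
    rw [Pi.smul_apply, norm_smul, weightedHat_apply, weightedHat_apply, fourierHat_modulation, hsm,
      norm_mul, norm_mul, norm_mul, ← mul_assoc]
    refine mul_le_mul_of_nonneg_right ?_ (norm_nonneg _)
    have h3 : ∀ (r : ℝ) (η : 𝔼), ‖((bracket r η : ℝ) : ℂ)‖ = bracket r η := fun r η => by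
      rw [Complex.norm_real, Real.norm_eq_abs, abs_of_pos (bracket_pos _ _)]
    have h4 : ‖(2 : ℝ) ^ (-s / 2)‖ * ‖bracket s (N • ζ)‖ = 2 ^ (-s / 2) * bracket s (N • ζ) := by
      rw [Real.norm_eq_abs, Real.norm_eq_abs, abs_of_pos (by positivity),
        abs_of_pos (bracket_pos _ _)]
    rw [h3, h3, h4]
    exact bracket_le_of_neg hs ξ (N • ζ)
  rw [fourierLebesgueNorm_eq]
  refine (eLpNorm_mono h2).trans ?_
  rw [eLpNorm_const_smul, h1, ← mul_assoc]
  gcongr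
  rw [← ENNReal.ofReal_mul (by positivity), Real.enorm_eq_ofReal_abs, abs_of_pos
    (mul_pos (by positivity) (bracket_pos _ _))]
  refine ENNReal.ofReal_le_ofReal ?_
  calc (2 : ℝ) ^ (-s / 2) * bracket s (N • ζ) ≤ 2 ^ (-s / 2) * (N ^ s * ‖ζ‖ ^ s) := by
        gcongr
        exact bracket_smul_le hs hN hζ0
    _ = _ := by ring

/-- By Hölder's inequality, pairing with a fixed Schwartz function is bounded in every
Fourier–Lebesgue norm. -/
theorem exists_enorm_integral_mul_le {p : ℝ≥0∞} (hp : 1 ≤ p) (k : ℝ) (G : 𝓢(𝔼, ℂ)) :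
    ∃ C : ℝ≥0∞, C ≠ ∞ ∧ ∀ f : 𝓢(𝔼, ℂ), ‖∫ x, f x * G x‖ₑ ≤ C * fourierLebesgueNorm p k f := by
  set h : 𝓢(𝔼, ℂ) := 𝓕⁻ G with hh
  set H : 𝓢(𝔼, ℂ) := SchwartzMap.smulLeftCLM ℂ (fun ξ : 𝔼 => ((bracket (-k) ξ : ℝ) : ℂ))
    (SchwartzMap.compCLMOfContinuousLinearEquiv ℂ frequencyDilation h) with hH
  obtain ⟨q, hq⟩ : ∃ q : ℝ≥0∞, ENNReal.HolderConjugate q p := by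
    refine ⟨(1 - p⁻¹)⁻¹, ENNReal.holderConjugate_iff.2 ?_⟩
    rw [inv_inv]
    exact tsub_add_cancel_of_le (ENNReal.inv_le_one.2 hp)
  refine ⟨eLpNorm H q volume, (eLpNorm_schwartz_lt_top H q).ne, fun f => ?_⟩
  have h1 : ∫ x, f x * G x = ∫ ξ, H ξ * weightedHat k f ξ := by
    have h2 : ∀ ξ, H ξ * weightedHat k f ξ =
        (1 / (2 * (Real.pi : ℂ)) ^ d) * (fun η => (𝓕 f : 𝓢(𝔼, ℂ)) η * h η) ((2 * Real.pi)⁻¹ • ξ) := by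
      intro ξ
      rw [weightedHat_apply, hH, SchwartzMap.smulLeftCLM_apply_apply
        (hasTemperateGrowth_bracket (-k)), SchwartzMap.compCLMOfContinuousLinearEquiv_apply,
        Function.comp_apply, frequencyDilation_apply, fourierHat_eq, smul_eq_mul]
      have := bracket_neg_mul k ξ
      have h3 : ((bracket (-k) ξ : ℝ) : ℂ) * ((bracket k ξ : ℝ) : ℂ) = 1 := by exact_mod_cast this
      linear_combination (h ((2 * Real.pi)⁻¹ • ξ) * (1 / (2 * (Real.pi : ℂ)) ^ d *
        𝓕 f ((2 * Real.pi)⁻¹ • ξ))) * h3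
    rw [integral_congr_ae (Eventually.of_forall h2), integral_const_mul,
      Measure.integral_comp_smul volume (fun η => (𝓕 f : 𝓢(𝔼, ℂ)) η * h η),
      SchwartzMap.integral_fourier_mul_eq f h]
    have h3 : (𝓕 h : 𝓢(𝔼, ℂ)) = G := FourierTransform.fourier_fourierInv_eq G
    rw [h3, finrank_euclideanSpace, Fintype.card_fin, abs_of_pos (by positivity),
      Complex.real_smul, ← mul_assoc]
    have hpi : (Real.pi : ℂ) ≠ 0 := by exact_mod_cast Real.pi_ne_zero
    push_cast
    have : (1 / (2 * (Real.pi : ℂ)) ^ d) * ((2 * (Real.pi : ℂ))⁻¹ ^ d)⁻¹ = 1 := by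
      rw [inv_pow, inv_inv]
      field_simp
    rw [this, one_mul]
  rw [h1, fourierLebesgueNorm_eq]
  refine (enorm_integral_le_lintegral_enorm _).trans ?_
  rw [← eLpNorm_one_eq_lintegral_enorm]
  have hHolder := eLpNorm_smul_le_mul_eLpNorm (μ := (volume : Measure 𝔼)) (p := q) (q := p) (r := 1)
    (f := fun ξ => weightedHat k f ξ) (φ := fun ξ => H ξ)
    (weightedHat k f).continuous.aestronglyMeasurable H.continuous.aestronglyMeasurable
  exact hHolder

end FourierLebesgue

/-! ### Wave packets and pairings -/

section Packets

open FourierTransform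

variable {E : Type} [NormedAddCommGroup E] [InnerProductSpace ℝ E] [FiniteDimensional ℝ E]
  [MeasurableSpace E] [BorelSpace E]

/-- The bilinear pairing `f ↦ ∫ G f` with a fixed Schwartz function. -/
def pairingCLM (G : 𝓢(E, ℂ)) : 𝓢(E, ℂ) →L[ℂ] ℂ :=
  (SchwartzMap.integralCLM ℂ volume).comp (SchwartzMap.pairing (ContinuousLinearMap.mul ℂ ℂ) G)

theorem pairingCLM_apply (G f : 𝓢(E, ℂ)) : pairingCLM G f = ∫ x, G x * f x := rfl

theorem pairingCLM_eq_fourier (G f : 𝓢(E, ℂ)) :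
    pairingCLM G f = ∫ ξ, 𝓕 f ξ * (𝓕⁻ G : 𝓢(E, ℂ)) ξ := by
  have h : (𝓕 (𝓕⁻ G : 𝓢(E, ℂ)) : 𝓢(E, ℂ)) = G := FourierTransform.fourier_fourierInv_eq G
  rw [SchwartzMap.integral_fourier_mul_eq f (𝓕⁻ G : 𝓢(E, ℂ)), h, pairingCLM_apply]
  simp only [mul_comm]

/-- A fixed pairing is bounded in the Wiener norm, and it barely sees the free flow for short
times. -/
theorem exists_norm_pairingCLM_le (G : 𝓢(E, ℂ)) : ∃ C, 0 ≤ C ∧ ∀ f : 𝓢(E, ℂ),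
    ‖pairingCLM G f‖ ≤ C * wienerSeminorm 1 0 f ∧
    ∀ r : ℝ, ‖pairingCLM G (schrodingerGroup r f) - pairingCLM G f‖ ≤
      C * |r| * wienerSeminorm 1 0 f := by
  set h : 𝓢(E, ℂ) := 𝓕⁻ G with hh
  set C0 := SchwartzMap.seminorm ℂ 0 0 h with hC0
  set C2 := SchwartzMap.seminorm ℂ 2 0 h with hC2
  have hC0' : 0 ≤ C0 := apply_nonneg _ _
  have hC2' : 0 ≤ C2 := apply_nonneg _ _
  have hint : ∀ f : 𝓢(E, ℂ), Integrable fun ξ => ‖(𝓕 f : 𝓢(E, ℂ)) ξ‖ := fun f =>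
    (𝓕 f : 𝓢(E, ℂ)).integrable.norm
  refine ⟨C0 + 2 * Real.pi ^ 2 * C2, by positivity, fun f => ⟨?_, fun r => ?_⟩⟩
  · calc ‖pairingCLM G f‖ ≤ ∫ ξ, C0 * ‖(𝓕 f : 𝓢(E, ℂ)) ξ‖ := by
          rw [pairingCLM_eq_fourier]
          refine norm_integral_le_of_norm_le ((hint f).const_mul _) (Eventually.of_forall fun ξ => ?_)
          rw [norm_mul, mul_comm]
          gcongr
          exact SchwartzMap.norm_le_seminorm ℂ h ξ
      _ = C0 * wienerSeminorm 1 0 f := by rw [integral_const_mul, wienerSeminorm_zero_apply]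
      _ ≤ _ := by
          gcongr
          exact le_add_of_nonneg_right (by positivity)
  · have hint2 : ∀ g : 𝓢(E, ℂ), Integrable fun ξ => (𝓕 g : 𝓢(E, ℂ)) ξ * h ξ := fun g =>
      (schwartzMul (𝓕 g) h).integrable
    calc ‖pairingCLM G (schrodingerGroup r f) - pairingCLM G f‖
        ≤ ∫ ξ, 2 * Real.pi ^ 2 * |r| * C2 * ‖(𝓕 f : 𝓢(E, ℂ)) ξ‖ := by
          rw [pairingCLM_eq_fourier, pairingCLM_eq_fourier, ← integral_sub (hint2 _) (hint2 _)]
          refine norm_integral_le_of_norm_le ((hint f).const_mul _) (Eventually.of_forall fun ξ => ?_)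
          have h1 : (𝓕 (schrodingerGroup r f) : 𝓢(E, ℂ)) ξ * h ξ - (𝓕 f : 𝓢(E, ℂ)) ξ * h ξ =
              (schrodingerSymbol r ξ - schrodingerSymbol 0 ξ) * h ξ * (𝓕 f : 𝓢(E, ℂ)) ξ := by
            rw [fourier_schrodingerGroup_apply, schrodingerSymbol_zero]
            ring
          rw [h1, norm_mul, norm_mul]
          refine mul_le_mul_of_nonneg_right ?_ (norm_nonneg _)
          calc _ ≤ 2 * Real.pi ^ 2 * |r - 0| * ‖ξ‖ ^ 2 * ‖h ξ‖ := by
                gcongr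
                exact norm_schrodingerSymbol_sub_le 0 r ξ
            _ = 2 * Real.pi ^ 2 * |r| * (‖ξ‖ ^ 2 * ‖h ξ‖) := by rw [sub_zero]; ring
            _ ≤ _ := by
                gcongr
                exact SchwartzMap.norm_pow_mul_le_seminorm ℂ h 2 ξ
      _ = 2 * Real.pi ^ 2 * C2 * |r| * wienerSeminorm 1 0 f := by
          rw [integral_const_mul, wienerSeminorm_zero_apply]; ring
      _ ≤ _ := by
          gcongr
          exact le_add_of_nonneg_left hC0'

/-- On functions concentrated near the frequency `η`, the free flow acts like multiplication by
its symbol at `η`, up to an error of size `|τ| (1 + |η|)`. -/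
theorem wienerSeminorm_schrodingerGroup_modulation_sub_le (τ : ℝ) (η : E) (f : 𝓢(E, ℂ)) :
    wienerSeminorm 1 0 (schrodingerGroup τ (modulation η f) -
      schrodingerSymbol τ η • modulation η f) ≤
      2 * Real.pi ^ 2 * |τ| * (1 + 2 * ‖η‖) * wienerSeminorm 1 2 f := by
  have h1 : ∀ ξ, (𝓕 (schrodingerGroup τ (modulation η f) -
      schrodingerSymbol τ η • modulation η f) : 𝓢(E, ℂ)) ξ =
      (schrodingerSymbol τ ξ - schrodingerSymbol τ η) * 𝓕 f (ξ - η) := by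
    intro ξ
    rw [← fourierEvalCLM_apply, map_sub, fourierEvalCLM_apply, fourierEvalCLM_apply,
      FourierTransform.fourier_smul, smul_apply,
      fourier_schrodingerGroup_apply, fourier_modulation_apply, smul_eq_mul]
    ring
  rw [wienerSeminorm_zero_apply, wienerSeminorm_apply, ← integral_const_mul,
    ← integral_sub_right_eq_self (fun ξ => 2 * Real.pi ^ 2 * |τ| * (1 + 2 * ‖η‖) *
      ((1 + ((1 : ℝ≥0) : ℝ) * ‖ξ‖) ^ 2 * ‖𝓕 f ξ‖)) η]
  refine integral_mono (SchwartzMap.integrable _).norm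
    (((integrable_weight_mul_norm ((1 : ℝ≥0) : ℝ) 2 (𝓕 f : 𝓢(E, ℂ))).const_mul
      (2 * Real.pi ^ 2 * |τ| * (1 + 2 * ‖η‖))).comp_sub_right η) fun ξ => ?_
  simp only [h1, norm_mul, ← mul_assoc]
  refine mul_le_mul_of_nonneg_right ?_ (norm_nonneg _)
  refine (norm_cexp_ofReal_mul_I_sub_le _ _).trans ?_
  rw [← mul_sub, abs_mul, abs_neg, abs_mul, abs_of_pos (by positivity : (0 : ℝ) < 2 * Real.pi ^ 2),
    NNReal.coe_one, one_mul, mul_assoc (2 * Real.pi ^ 2 * |τ|)]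
  refine mul_le_mul_of_nonneg_left ?_ (by positivity)
  have h2 : |‖ξ‖ - ‖η‖| ≤ ‖ξ - η‖ := abs_norm_sub_norm_le ξ η
  have h3 : ‖ξ‖ + ‖η‖ ≤ ‖ξ - η‖ + 2 * ‖η‖ := by
    have := norm_add_le (ξ - η) η
    rw [sub_add_cancel] at this
    linarith
  calc |‖ξ‖ ^ 2 - ‖η‖ ^ 2| = |‖ξ‖ - ‖η‖| * (‖ξ‖ + ‖η‖) := by
        rw [sq_sub_sq, mul_comm, abs_mul, abs_of_nonneg (by positivity : 0 ≤ ‖ξ‖ + ‖η‖)]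
    _ ≤ ‖ξ - η‖ * (‖ξ - η‖ + 2 * ‖η‖) := by gcongr
    _ ≤ (1 + 2 * ‖η‖) * (1 + ‖ξ - η‖) ^ 2 := by
        nlinarith [norm_nonneg η, norm_nonneg (ξ - η), mul_nonneg (norm_nonneg η) (norm_nonneg (ξ - η)),
          mul_nonneg (norm_nonneg η) (sq_nonneg ‖ξ - η‖)]

/-- The sum over `j` of the plane waves of frequency `N κ_j` with envelope `a`, each rotated by
the phase it acquires under the free flow up to time `τ`. -/
def wavePacket {ι : Type*} [Fintype ι] (κ : ι → E) (a : 𝓢(E, ℂ)) (N τ : ℝ) : 𝓢(E, ℂ) :=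
  ∑ j, schrodingerSymbol τ (N • κ j) • modulation (N • κ j) a

variable {ι : Type*} [Fintype ι] (κ : ι → E) (a : 𝓢(E, ℂ))

theorem wavePacket_zero (N : ℝ) : wavePacket κ a N 0 = ∑ j, modulation (N • κ j) a := by
  simp [wavePacket, schrodingerSymbol_zero]

theorem wienerSeminorm_wavePacket_le (N τ : ℝ) :
    wienerSeminorm 1 0 (wavePacket κ a N τ) ≤ Fintype.card ι * wienerSeminorm 1 0 a := by
  refine (Finset.le_sum_of_subadditive _ (map_zero _).le (map_add_le_add _) _ _).trans (le_of_eq ?_)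
  simp [map_smul_eq_mul, norm_schrodingerSymbol, wienerSeminorm_modulation]

theorem exists_wienerSeminorm_schrodingerGroup_wavePacket_sub_le : ∃ K, 0 ≤ K ∧
    ∀ N τ : ℝ, 1 ≤ N → 0 ≤ τ → wienerSeminorm 1 0
      (schrodingerGroup τ (wavePacket κ a N 0) - wavePacket κ a N τ) ≤ K * (τ * N) := by
  refine ⟨∑ j, 2 * Real.pi ^ 2 * (1 + 2 * ‖κ j‖) * wienerSeminorm 1 2 a,
    Finset.sum_nonneg fun j _ => mul_nonneg (by positivity) (apply_nonneg _ _),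
    fun N τ hN hτ => ?_⟩
  rw [wavePacket_zero, wavePacket, map_sum, ← Finset.sum_sub_distrib]
  refine (Finset.le_sum_of_subadditive _ (map_zero _).le (map_add_le_add _) _ _).trans ?_
  rw [Finset.sum_mul]
  refine Finset.sum_le_sum fun j _ =>
    (wienerSeminorm_schrodingerGroup_modulation_sub_le τ (N • κ j) a).trans ?_
  rw [abs_of_nonneg hτ, norm_smul, Real.norm_eq_abs, abs_of_nonneg (by linarith)]
  calc _ = 2 * Real.pi ^ 2 * τ * wienerSeminorm 1 2 a * (1 + 2 * (N * ‖κ j‖)) := by ring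
    _ ≤ 2 * Real.pi ^ 2 * τ * wienerSeminorm 1 2 a * (N * (1 + 2 * ‖κ j‖)) := by
        refine mul_le_mul_of_nonneg_left ?_ (mul_nonneg (by positivity) (apply_nonneg _ _))
        nlinarith [norm_nonneg (κ j)]
    _ = _ := by ring

end Packets

/-! ### The resonant part of the nonlinearity -/

section Resonance

open FourierTransform

variable {E : Type} [NormedAddCommGroup E] [InnerProductSpace ℝ E] [FiniteDimensional ℝ E]
  [MeasurableSpace E] [BorelSpace E] {ι : Type*} [Fintype ι]

/-- The output frequency of the interaction of the modes `p.1` with the conjugated modes `p.2`. -/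
def momentumDefect (κ : ι → E) {σ : ℕ} (p : (Fin (σ + 1) → ι) × (Fin σ → ι)) : E :=
  ∑ i, κ (p.1 i) - ∑ i, κ (p.2 i)

/-- The temporal frequency of the interaction of the modes `p.1` with the conjugated modes `p.2`,
up to the factor `2π² N²`. -/
def energyDefect (κ : ι → E) {σ : ℕ} (p : (Fin (σ + 1) → ι) × (Fin σ → ι)) : ℝ :=
  ∑ i, ‖κ (p.1 i)‖ ^ 2 - ∑ i, ‖κ (p.2 i)‖ ^ 2

/-- The expansion of `|S|^{2σ} S = S^{σ+1} S̄^σ` for a sum `S` of unimodular numbers. -/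
theorem norm_pow_mul_sum_cexp (σ : ℕ) (θ : ι → ℝ) :
    (‖∑ j, Complex.exp (θ j * Complex.I)‖ : ℂ) ^ (2 * σ) * ∑ j, Complex.exp (θ j * Complex.I) =
      ∑ p : (Fin (σ + 1) → ι) × (Fin σ → ι),
        Complex.exp (((∑ i, θ (p.1 i) - ∑ i, θ (p.2 i) : ℝ) : ℂ) * Complex.I) := by
  set S := ∑ j, Complex.exp (θ j * Complex.I) with hS
  have h1 : (starRingEnd ℂ) S = ∑ j, Complex.exp (-(θ j * Complex.I)) := by
    rw [hS, map_sum]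
    refine Finset.sum_congr rfl fun j _ => ?_
    rw [← Complex.exp_conj]
    simp
  have h2 : (‖S‖ : ℂ) ^ (2 * σ) * S = S ^ (σ + 1) * (starRingEnd ℂ) S ^ σ := by
    rw [pow_mul, ← Complex.mul_conj', mul_pow]
    ring
  rw [h2, h1, hS, Fintype.sum_pow, Fintype.sum_pow, Finset.sum_mul_sum, ← Finset.univ_product_univ,
    Finset.sum_product]
  refine Finset.sum_congr rfl fun f _ => Finset.sum_congr rfl fun g _ => ?_
  rw [← Complex.exp_sum, ← Complex.exp_sum, ← Complex.exp_add]
  congr 1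
  push_cast
  rw [sub_mul, Finset.sum_mul, Finset.sum_mul, Finset.sum_neg_distrib, sub_eq_add_neg]

theorem pairingCLM_modulation (G b : 𝓢(E, ℂ)) (η : E) :
    pairingCLM G (modulation η b) = 𝓕 (schwartzMul G b) (-η) := by
  rw [← zero_sub, ← fourier_modulation_apply, SchwartzMap.fourier_coe, Real.fourier_eq',
    pairingCLM_apply]
  congr 1
  ext x
  simp only [inner_zero_right, mul_zero, Complex.ofReal_zero, zero_mul, Complex.exp_zero, one_smul,
    modulation_apply, schwartzMul_apply]
  ring

/-- The nonlinearity applied to a wave packet is a superposition of plane waves. -/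
theorem pairingCLM_powerNonlinearity_wavePacket (G : 𝓢(E, ℂ)) (σ : ℕ) (κ : ι → E) (a : 𝓢(E, ℂ))
    (N τ : ℝ) : pairingCLM G (powerNonlinearity σ (wavePacket κ a N τ)) =
      ∑ p : (Fin (σ + 1) → ι) × (Fin σ → ι),
        𝓕 (schwartzMul G (powerNonlinearity σ a)) (-(N • momentumDefect κ p)) *
          Complex.exp (-(2 * Real.pi ^ 2 * N ^ 2 * energyDefect κ p) * Complex.I * τ) := by
  set b := powerNonlinearity σ a with hb
  have h1 : powerNonlinearity σ (wavePacket κ a N τ) =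
      ∑ p : (Fin (σ + 1) → ι) × (Fin σ → ι),
        Complex.exp (-(2 * Real.pi ^ 2 * N ^ 2 * energyDefect κ p) * Complex.I * τ) •
          modulation (N • momentumDefect κ p) b := by
    ext x
    set θ : ι → ℝ := fun j => 2 * Real.pi * inner ℝ x (N • κ j) -
      2 * Real.pi ^ 2 * τ * ‖N • κ j‖ ^ 2 with hθ
    have h2 : wavePacket κ a N τ x = (∑ j, Complex.exp (θ j * Complex.I)) * a x := by
      rw [wavePacket, sum_apply, Finset.sum_mul]
      refine Finset.sum_congr rfl fun j _ => ?_
      rw [smul_apply, modulation_apply, smul_eq_mul, ← mul_assoc, schrodingerSymbol,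
        ← Complex.exp_add]
      congr 2
      rw [hθ]
      push_cast
      ring
    rw [powerNonlinearity_apply, h2, norm_mul, Complex.ofReal_mul, mul_pow, sum_apply]
    have h3 := norm_pow_mul_sum_cexp σ θ
    have h4 : b x = (‖a x‖ : ℂ) ^ (2 * σ) * a x := powerNonlinearity_apply σ a x
    calc _ = ((‖∑ j, Complex.exp (θ j * Complex.I)‖ : ℂ) ^ (2 * σ) *
          ∑ j, Complex.exp (θ j * Complex.I)) * b x := by rw [h4]; ring
      _ = _ := by
        rw [h3, Finset.sum_mul]
        refine Finset.sum_congr rfl fun p _ => ?_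
        rw [smul_apply, modulation_apply, smul_eq_mul, ← mul_assoc, ← Complex.exp_add]
        congr 2
        have h5 : ∑ i, θ (p.1 i) - ∑ i, θ (p.2 i) =
            2 * Real.pi * inner ℝ x (N • momentumDefect κ p) -
              2 * Real.pi ^ 2 * N ^ 2 * energyDefect κ p * τ := by
          simp only [hθ, Finset.sum_sub_distrib, momentumDefect, energyDefect, inner_smul_right,
            inner_sub_right, inner_sum, norm_smul, mul_pow, Real.norm_eq_abs, sq_abs, mul_sub,
            Finset.mul_sum, sub_mul, Finset.sum_mul]
          have h6 : ∀ (n : ℕ) (f : Fin n → ι),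
              ∑ i, 2 * Real.pi ^ 2 * τ * (N ^ 2 * ‖κ (f i)‖ ^ 2) =
                ∑ i, 2 * Real.pi ^ 2 * N ^ 2 * ‖κ (f i)‖ ^ 2 * τ :=
            fun n f => Finset.sum_congr rfl fun i _ => by ring
          rw [h6, h6]
          ring
        rw [h5]
        push_cast
        ring
  rw [h1, map_sum]
  refine Finset.sum_congr rfl fun p _ => ?_
  rw [map_smul, pairingCLM_modulation, smul_eq_mul, mul_comm]

theorem norm_integral_cexp_le {r : ℝ} (hr : r ≠ 0) (t : ℝ) :
    ‖∫ τ in (0 : ℝ)..t, Complex.exp (-r * Complex.I * τ)‖ ≤ 2 / |r| := by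
  have hc : -(r : ℂ) * Complex.I ≠ 0 :=
    mul_ne_zero (neg_ne_zero.2 (by exact_mod_cast hr)) Complex.I_ne_zero
  have h1 : ∀ s : ℝ, ‖Complex.exp (-r * Complex.I * s)‖ = 1 := fun s => by
    rw [show -(r : ℂ) * Complex.I * s = ((-r * s : ℝ) : ℂ) * Complex.I by push_cast; ring,
      Complex.norm_exp_ofReal_mul_I]
  rw [integral_exp_mul_complex hc, norm_div, norm_mul, norm_neg, Complex.norm_I, mul_one,
    Complex.norm_real, Real.norm_eq_abs]
  gcongr
  refine (norm_sub_le _ _).trans ?_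
  rw [h1, h1]
  norm_num

theorem tendsto_fourier_cocompact (h : 𝓢(E, ℂ)) : Tendsto (𝓕 h : 𝓢(E, ℂ)) (cocompact E) (𝓝 0) := by
  have := ((𝓕 h : 𝓢(E, ℂ)).isBigO_cocompact_rpow (-1)).trans_tendsto
    ((tendsto_rpow_neg_atTop one_pos).comp (tendsto_norm_cocompact_atTop (E := E)))
  exact this

open scoped Classical in
/-- The number of interactions preserving both momentum and energy. -/
def resonanceCount (κ : ι → E) (σ : ℕ) : ℕ :=
  (Finset.univ.filter fun p : (Fin (σ + 1) → ι) × (Fin σ → ι) =>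
    momentumDefect κ p = 0 ∧ energyDefect κ p = 0).card

/-- Only the resonant interactions survive in the time average of the nonlinearity: the others
vanish in the limit, by the Riemann–Lebesgue lemma in `x` when the momentum is not preserved and
by oscillation in `τ` when the energy is not. -/
theorem tendsto_average_pairingCLM_wavePacket (G : 𝓢(E, ℂ)) (σ : ℕ) (κ : ι → E) (a : 𝓢(E, ℂ))
    {N t : ℕ → ℝ} (hN : Tendsto N atTop atTop) (ht : ∀ n, 0 < t n)
    (htN : Tendsto (fun n => t n * N n ^ 2) atTop atTop) :
    Tendsto (fun n => ((t n : ℝ) : ℂ)⁻¹ * ∫ τ in (0 : ℝ)..t n,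
      pairingCLM G (powerNonlinearity σ (wavePacket κ a (N n) τ))) atTop
      (𝓝 (resonanceCount κ σ * pairingCLM G (powerNonlinearity σ a))) := by
  classical
  set h := schwartzMul G (powerNonlinearity σ a) with hh
  have h0 : pairingCLM G (powerNonlinearity σ a) = 𝓕 h 0 := by
    have := pairingCLM_modulation G (powerNonlinearity σ a) 0
    rw [neg_zero] at this
    rw [← this]
    congr 1
    ext x
    simp [modulation_apply]
  have hlim : ((resonanceCount κ σ : ℂ) * pairingCLM G (powerNonlinearity σ a)) =
      ∑ p : (Fin (σ + 1) → ι) × (Fin σ → ι),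
        if momentumDefect κ p = 0 ∧ energyDefect κ p = 0 then 𝓕 h 0 else 0 := by
    rw [← Finset.sum_filter, Finset.sum_const, nsmul_eq_mul, h0, resonanceCount]
  have hfun : ∀ n, ((t n : ℝ) : ℂ)⁻¹ * ∫ τ in (0 : ℝ)..t n,
      pairingCLM G (powerNonlinearity σ (wavePacket κ a (N n) τ)) =
      ∑ p : (Fin (σ + 1) → ι) × (Fin σ → ι), 𝓕 h (-(N n • momentumDefect κ p)) *
        (((t n : ℝ) : ℂ)⁻¹ * ∫ τ in (0 : ℝ)..t n, Complex.exp
          (-((2 * Real.pi ^ 2 * N n ^ 2 * energyDefect κ p : ℝ) : ℂ) * Complex.I * τ)) := by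
    intro n
    simp only [pairingCLM_powerNonlinearity_wavePacket]
    rw [intervalIntegral.integral_finsetSum, Finset.mul_sum]
    · refine Finset.sum_congr rfl fun p _ => ?_
      rw [intervalIntegral.integral_const_mul]
      push_cast
      ring
    · intro p _
      exact Continuous.intervalIntegrable (by fun_prop) _ _
  simp only [hfun]
  rw [hlim]
  refine tendsto_finsetSum _ fun p _ => ?_
  have hone : ∀ n, ‖((t n : ℝ) : ℂ)⁻¹ * ∫ τ in (0 : ℝ)..t n, Complex.exp
      (-((2 * Real.pi ^ 2 * N n ^ 2 * energyDefect κ p : ℝ) : ℂ) * Complex.I * τ)‖ ≤ 1 := by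
    intro n
    have h1 := intervalIntegral.norm_integral_le_of_norm_le_const (a := 0) (b := t n) (C := 1)
      (f := fun τ : ℝ => Complex.exp
        (-((2 * Real.pi ^ 2 * N n ^ 2 * energyDefect κ p : ℝ) : ℂ) * Complex.I * τ))
      (fun τ _ => by
        rw [show -((2 * Real.pi ^ 2 * N n ^ 2 * energyDefect κ p : ℝ) : ℂ) * Complex.I * τ =
          ((-(2 * Real.pi ^ 2 * N n ^ 2 * energyDefect κ p) * τ : ℝ) : ℂ) * Complex.I by
            push_cast; ring, Complex.norm_exp_ofReal_mul_I])
    rw [sub_zero, one_mul, abs_of_pos (ht n)] at h1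
    rw [norm_mul, norm_inv, Complex.norm_real, Real.norm_eq_abs, abs_of_pos (ht n)]
    calc _ ≤ (t n)⁻¹ * t n := mul_le_mul_of_nonneg_left h1 (inv_nonneg.2 (ht n).le)
      _ = 1 := inv_mul_cancel₀ (ht n).ne'
  by_cases hm : momentumDefect κ p = 0
  · by_cases hω : energyDefect κ p = 0
    · rw [if_pos ⟨hm, hω⟩]
      refine tendsto_const_nhds.congr fun n => ?_
      have : ((t n : ℝ) : ℂ) ≠ 0 := by exact_mod_cast (ht n).ne'
      simp [hm, hω, this]
    · rw [if_neg fun h => hω h.2]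
      simp only [hm, smul_zero, neg_zero]
      rw [← mul_zero (𝓕 h 0)]
      refine Tendsto.const_mul _ ?_
      rw [tendsto_zero_iff_norm_tendsto_zero]
      have hev : ∀ᶠ n in atTop, 0 < N n := hN.eventually_gt_atTop 0
      refine squeeze_zero' (Eventually.of_forall fun n => norm_nonneg _)
        (g := fun n => 2 / (2 * Real.pi ^ 2 * |energyDefect κ p|) * (t n * N n ^ 2)⁻¹) ?_ ?_
      · filter_upwards [hev] with n hn
        rw [norm_mul, norm_inv, Complex.norm_real, Real.norm_eq_abs, abs_of_pos (ht n)]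
        have hr : 2 * Real.pi ^ 2 * N n ^ 2 * energyDefect κ p ≠ 0 :=
          mul_ne_zero (by positivity) hω
        calc _ ≤ (t n)⁻¹ * (2 / |2 * Real.pi ^ 2 * N n ^ 2 * energyDefect κ p|) :=
              mul_le_mul_of_nonneg_left (norm_integral_cexp_le hr _) (inv_nonneg.2 (ht n).le)
          _ = _ := by
              rw [abs_mul, abs_of_pos (by positivity : 0 < 2 * Real.pi ^ 2 * N n ^ 2)]
              have := abs_pos.2 hω
              have := ht n
              field_simp
      · have h1 := (tendsto_inv_atTop_zero.comp htN).const_mul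
          (2 / (2 * Real.pi ^ 2 * |energyDefect κ p|))
        rwa [mul_zero] at h1
  · rw [if_neg fun h => hm h.1]
    rw [tendsto_zero_iff_norm_tendsto_zero]
    have h1 : Tendsto (fun n => -(N n • momentumDefect κ p)) atTop (cocompact E) := by
      rw [← Metric.cobounded_eq_cocompact, ← tendsto_norm_atTop_iff_cobounded]
      simp only [norm_neg, norm_smul, Real.norm_eq_abs]
      exact (tendsto_abs_atTop_atTop.comp hN).atTop_mul_const (norm_pos_iff.2 hm)
    have h2 := ((tendsto_fourier_cocompact h).comp h1).norm
    rw [norm_zero] at h2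
    refine squeeze_zero (fun n => norm_nonneg _) (fun n => ?_) h2
    rw [norm_mul]
    exact mul_le_of_le_one_right (norm_nonneg _) (hone n)

end Resonance

/-! ### The leading term of the solution -/

section MainTerm

variable {E : Type} [NormedAddCommGroup E] [InnerProductSpace ℝ E] [FiniteDimensional ℝ E]
  [MeasurableSpace E] [BorelSpace E] {ι : Type*} [Fintype ι]

theorem powerNonlinearity_smul (σ : ℕ) {A : ℝ} (hA : 0 ≤ A) (f : 𝓢(E, ℂ)) :
    powerNonlinearity σ ((A : ℂ) • f) = ((A : ℂ) ^ (2 * σ + 1)) • powerNonlinearity σ f := by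
  ext x
  rw [powerNonlinearity_apply, smul_apply, smul_apply, powerNonlinearity_apply, smul_eq_mul,
    smul_eq_mul, norm_mul, Complex.norm_real, Real.norm_eq_abs, abs_of_nonneg hA]
  push_cast
  ring

/-- A bound for the Wiener norm of all wave packets with envelope `a` and modes indexed by `ι`. -/
def packetBound (ι : Type*) [Fintype ι] (a : 𝓢(E, ℂ)) : ℝ :=
  Fintype.card ι * wienerSeminorm 1 0 a + 1

theorem packetBound_pos (a : 𝓢(E, ℂ)) : 0 < packetBound ι a := by
  have : 0 ≤ wienerSeminorm 1 0 a := apply_nonneg _ _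
  unfold packetBound
  positivity

theorem wienerSeminorm_wavePacket_lt (κ : ι → E) (a : 𝓢(E, ℂ)) (N τ : ℝ) :
    wienerSeminorm 1 0 (wavePacket κ a N τ) < packetBound ι a :=
  (wienerSeminorm_wavePacket_le κ a N τ).trans_lt (lt_add_one _)

/-- For short times a pairing with the solution is the sum of its linear part and of the first
Duhamel iterate, in which the free flow may be replaced by the rotation of each plane wave. -/
theorem exists_norm_pairingCLM_solution_sub_le (G : 𝓢(E, ℂ)) (σ : ℕ) (κ : ι → E) (a : 𝓢(E, ℂ)) :
    ∃ C : ℝ, ∀ (A N t : ℝ) (c : ℂ) (w : C(ℝ, 𝓢(E, ℂ))), 0 < A → 1 ≤ N → 0 ≤ t → ‖c‖ = 1 →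
      (∀ τ, wienerSeminorm 1 0 (w τ) ≤ 2 * (A * packetBound ι a)) →
      (∀ τ ∈ Set.Icc 0 t, w τ = (A : ℂ) • wavePacket κ a N 0 +
        c • schwartzIntegral (interactionForcing σ w) 0 τ) →
      ‖pairingCLM G (schrodingerGroup t (w t)) -
        pairingCLM G (schrodingerGroup t ((A : ℂ) • wavePacket κ a N 0)) -
        c * (A : ℂ) ^ (2 * σ + 1) * ∫ τ in (0 : ℝ)..t,
          pairingCLM G (powerNonlinearity σ (wavePacket κ a N τ))‖ ≤
      t * A ^ (2 * σ + 1) * (C * (t + t * A ^ (2 * σ) + t * N)) := by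
  obtain ⟨C, hC0, hC⟩ := exists_norm_pairingCLM_le G
  obtain ⟨K2, hK20, hK2⟩ := exists_wienerSeminorm_schrodingerGroup_wavePacket_sub_le κ a
  set M := packetBound ι a with hM
  have hM0 : 0 < M := packetBound_pos a
  set Q : Seminorm ℂ 𝓢(E, ℂ) := wienerSeminorm 1 0 with hQ
  set K1 := (2 * M) ^ (2 * σ + 1) with hK1
  set K3 := (2 * σ + 1) * (2 * M) ^ (2 * σ) with hK3
  have hK10 : 0 ≤ K1 := by positivity
  have hK30 : 0 ≤ K3 := by positivity
  refine ⟨C * (K1 + K3 * K1 + K3 * K2), fun A N t c w hA hN ht hc hwM hw => ?_⟩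
  have hmul := isPicardSeminorm_wienerSeminorm (E := E).mul_le
  have hconj := isPicardSeminorm_wienerSeminorm (E := E).conj_eq
  have hUQ : ∀ τ f, Q (schrodingerGroup τ f) = Q f := wienerSeminorm_schrodingerGroup 1 0
  have hNL : ∀ τ, Q (powerNonlinearity σ (schrodingerGroup τ (w τ))) ≤ K1 * A ^ (2 * σ + 1) := by
    intro τ
    refine (seminorm_powerNonlinearity_le hmul hconj σ _).trans ?_
    rw [hK1, ← mul_pow]
    refine pow_le_pow_left₀ (apply_nonneg _ _) ?_ _
    rw [← hQ, hUQ]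
    exact (hwM τ).trans (le_of_eq (by ring))
  -- the solution stays close to the wave packet
  have hclose : ∀ τ ∈ Set.Icc 0 t, Q (schrodingerGroup τ (w τ) - (A : ℂ) • wavePacket κ a N τ) ≤
      K1 * A ^ (2 * σ + 1) * t + A * (K2 * (t * N)) := by
    intro τ hτ
    have h1 : schrodingerGroup τ (w τ) - (A : ℂ) • wavePacket κ a N τ =
        schrodingerGroup τ (c • schwartzIntegral (interactionForcing σ w) 0 τ) +
        (A : ℂ) • (schrodingerGroup τ (wavePacket κ a N 0) - wavePacket κ a N τ) := by
      rw [hw τ hτ, map_add, map_smul (schrodingerGroup τ) (A : ℂ), smul_sub]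
      abel
    rw [h1]
    refine (map_add_le_add Q _ _).trans (add_le_add ?_ ?_)
    · rw [hUQ, map_smul_eq_mul, hc, one_mul]
      refine (complexSeminorm_schwartzIntegral_le _ hτ.1 (continuous_wienerSeminorm 1 0)
        (M := K1 * A ^ (2 * σ + 1)) fun r _ => ?_).trans ?_
      · rw [interactionForcing_apply, ← hQ, hUQ]
        exact hNL r
      · exact mul_le_mul_of_nonneg_left hτ.2 (by positivity)
    · rw [map_smul_eq_mul, Complex.norm_real, Real.norm_eq_abs, abs_of_pos hA]
      refine mul_le_mul_of_nonneg_left ((hK2 N τ hN hτ.1).trans ?_) hA.le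
      exact mul_le_mul_of_nonneg_left (mul_le_mul_of_nonneg_right hτ.2 (by linarith)) hK20
  set L : 𝓢(E, ℂ) →L[ℝ] ℂ :=
    ((pairingCLM G).comp (schrodingerGroup t)).restrictScalars ℝ with hL
  have hLapply : ∀ f, L f = pairingCLM G (schrodingerGroup t f) := fun f => rfl
  have hcont1 : Continuous fun τ => L (interactionForcing σ w τ) :=
    L.continuous.comp (interactionForcing σ w).continuous
  have hcont2 : Continuous fun τ => (A : ℂ) ^ (2 * σ + 1) *
      pairingCLM G (powerNonlinearity σ (wavePacket κ a N τ)) := by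
    refine continuous_const.mul ((pairingCLM G).continuous.comp
      ((continuous_powerNonlinearity σ).comp ?_))
    refine continuous_finsetSum _ fun j _ => ?_
    have hsym : Continuous fun τ => schrodingerSymbol τ (N • κ j) := by
      unfold schrodingerSymbol
      fun_prop
    exact hsym.smul continuous_const
  have hexp : pairingCLM G (schrodingerGroup t (w t)) -
      pairingCLM G (schrodingerGroup t ((A : ℂ) • wavePacket κ a N 0)) -
      c * (A : ℂ) ^ (2 * σ + 1) * ∫ τ in (0 : ℝ)..t,
        pairingCLM G (powerNonlinearity σ (wavePacket κ a N τ)) =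
      c * ∫ τ in (0 : ℝ)..t, (L (interactionForcing σ w τ) - (A : ℂ) ^ (2 * σ + 1) *
        pairingCLM G (powerNonlinearity σ (wavePacket κ a N τ))) := by
    rw [intervalIntegral.integral_sub (hcont1.intervalIntegrable _ _)
      (hcont2.intervalIntegrable _ _), intervalIntegral.integral_const_mul,
      ← clm_schwartzIntegral L, hLapply]
    nth_rewrite 1 [hw t (Set.right_mem_Icc.2 ht)]
    rw [map_add, map_add, map_smul (schrodingerGroup t) c, map_smul (pairingCLM G) c, smul_eq_mul]
    ring
  rw [hexp, norm_mul, hc, one_mul]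
  have hbound : ∀ τ ∈ Set.uIoc 0 t, ‖L (interactionForcing σ w τ) - (A : ℂ) ^ (2 * σ + 1) *
      pairingCLM G (powerNonlinearity σ (wavePacket κ a N τ))‖ ≤
      A ^ (2 * σ + 1) * (C * (K1 + K3 * K1 + K3 * K2) * (t + t * A ^ (2 * σ) + t * N)) := by
    intro τ hτ'
    rw [Set.uIoc_of_le ht] at hτ'
    have hτ : τ ∈ Set.Icc 0 t := Set.Ioc_subset_Icc_self hτ'
    set F := powerNonlinearity σ (schrodingerGroup τ (w τ)) with hF
    have h1 : L (interactionForcing σ w τ) = pairingCLM G (schrodingerGroup (t - τ) F) := by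
      rw [hLapply, interactionForcing_apply, ← schrodingerGroup_add, sub_eq_add_neg]
    have h2 : (A : ℂ) ^ (2 * σ + 1) * pairingCLM G (powerNonlinearity σ (wavePacket κ a N τ)) =
        pairingCLM G (powerNonlinearity σ ((A : ℂ) • wavePacket κ a N τ)) := by
      rw [powerNonlinearity_smul σ hA.le, map_smul, smul_eq_mul]
    have h3 : ‖pairingCLM G (schrodingerGroup (t - τ) F) - pairingCLM G F‖ ≤
        C * t * (K1 * A ^ (2 * σ + 1)) := by
      refine ((hC F).2 (t - τ)).trans ?_
      have : |t - τ| ≤ t := by rw [abs_of_nonneg (by linarith [hτ.2])]; linarith [hτ.1]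
      have := hNL τ
      gcongr
    have h4 : ‖pairingCLM G F - pairingCLM G (powerNonlinearity σ ((A : ℂ) • wavePacket κ a N τ))‖ ≤
        C * (K3 * A ^ (2 * σ) * (K1 * A ^ (2 * σ + 1) * t + A * (K2 * (t * N)))) := by
      rw [← map_sub]
      refine ((hC _).1).trans (mul_le_mul_of_nonneg_left ?_ hC0)
      refine (seminorm_powerNonlinearity_sub_le hmul hconj σ (R := 2 * (A * M)) ?_ ?_).trans ?_
      · rw [← hQ, hUQ]
        exact hwM τ
      · rw [← hQ, map_smul_eq_mul, Complex.norm_real, Real.norm_eq_abs, abs_of_pos hA]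
        have h5 := (wienerSeminorm_wavePacket_lt κ a N τ).le
        have h6 : A * Q (wavePacket κ a N τ) ≤ A * M := mul_le_mul_of_nonneg_left h5 hA.le
        have h7 : 0 < A * M := mul_pos hA hM0
        linarith
      · have h8 : (2 * (σ : ℝ) + 1) * (2 * (A * M)) ^ (2 * σ) = K3 * A ^ (2 * σ) := by
          rw [hK3, mul_left_comm 2 A M, mul_pow]
          ring
        rw [h8]
        exact mul_le_mul_of_nonneg_left (hclose τ hτ) (by positivity)
    rw [h1, h2, ← sub_add_sub_cancel _ (pairingCLM G F)]
    refine (norm_add_le _ _).trans ((add_le_add h3 h4).trans ?_)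
    have hA2 : A ^ (2 * σ + 1) = A ^ (2 * σ) * A := pow_succ _ _
    have hp : 0 ≤ A ^ (2 * σ) * A * C := by positivity
    have hB : 0 ≤ A ^ (2 * σ) := by positivity
    have hN0 : 0 ≤ N := by linarith
    rw [hA2]
    have e : A ^ (2 * σ) * A * (C * (K1 + K3 * K1 + K3 * K2) * (t + t * A ^ (2 * σ) + t * N)) -
        (C * t * (K1 * (A ^ (2 * σ) * A)) +
        C * (K3 * A ^ (2 * σ) * (K1 * (A ^ (2 * σ) * A) * t + A * (K2 * (t * N))))) =
        A ^ (2 * σ) * A * C * (K1 * (t * A ^ (2 * σ) + t * N) + K3 * K1 * (t + t * N) +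
          K3 * K2 * (t + t * A ^ (2 * σ))) := by ring
    rw [← sub_nonneg, e]
    positivity
  refine (intervalIntegral.norm_integral_le_of_norm_le_const hbound).trans (le_of_eq ?_)
  rw [sub_zero, abs_of_nonneg ht]
  ring

end MainTerm

/-! ### Resonant configurations -/

section Configurations

/-- In dimension at least two, or for a nonlinearity of degree at least five, three modes suffice
to transfer energy to the zero frequency resonantly. -/
theorem exists_resonant_modes {d σ : ℕ} (hdσ : 2 ≤ d * σ) :
    ∃ κ : Fin 3 → EuclideanSpace ℝ (Fin d), (∀ j, κ j ≠ 0) ∧ 0 < resonanceCount κ σ := by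
  have key : ∀ (κ : Fin 3 → EuclideanSpace ℝ (Fin d))
      (p : (Fin (σ + 1) → Fin 3) × (Fin σ → Fin 3)), momentumDefect κ p = 0 →
      energyDefect κ p = 0 → 0 < resonanceCount κ σ := by
    intro κ p h1 h2
    classical
    rw [resonanceCount, Finset.card_pos]
    exact ⟨p, by simp [h1, h2]⟩
  have hd : 0 < d := Nat.pos_of_ne_zero fun h => by simp [h] at hdσ
  have hσ : 0 < σ := Nat.pos_of_ne_zero fun h => by simp [h] at hdσ
  set e : EuclideanSpace ℝ (Fin d) := EuclideanSpace.single ⟨0, hd⟩ 1 with he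
  have hne : ‖e‖ = 1 := by simp [he]
  have he0 : e ≠ 0 := fun h => by simp [h] at hne
  -- for `σ = 1` a rectangle with a vertex at the origin; otherwise, on a line,
  -- `4 + 1 + 1 = 3 + 3` and `4² + 1² + 1² = 3² + 3²`, padded with further ones
  obtain rfl | hσ2 : σ = 1 ∨ 2 ≤ σ := by omega
  · have hd2 : 1 < d := by omega
    set e' : EuclideanSpace ℝ (Fin d) := EuclideanSpace.single ⟨1, hd2⟩ 1 with he'
    have hne' : ‖e'‖ = 1 := by simp [he']
    have horth : inner ℝ e e' = 0 := by
      simp [he, he', EuclideanSpace.inner_single_left]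
    have hsum : ‖e + e'‖ ^ 2 = 2 := by
      rw [norm_add_sq_real, horth, hne, hne']; norm_num
    refine ⟨![e, e', e + e'], fun j => ?_, key _ (![0, 1], ![2]) ?_ ?_⟩
    · fin_cases j
      · exact he0
      · exact fun h => by simp [show e' = 0 from h] at hne'
      · exact fun h => by simp [show e + e' = 0 from h] at hsum
    · simp [momentumDefect, Fin.sum_univ_two]
    · simp [energyDefect, Fin.sum_univ_two, hsum, hne, hne']
      norm_num
  · obtain ⟨m, rfl⟩ := Nat.exists_eq_add_of_le' hσ2
    refine ⟨fun j => (![1, 4, 3] j : ℝ) • e, fun j => smul_ne_zero ?_ he0,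
      key _ (Fin.cons 1 fun _ => 0, Fin.cons 2 (Fin.cons 2 fun _ => 0)) ?_ ?_⟩
    · fin_cases j <;> norm_num
    · simp only [momentumDefect, Fin.sum_univ_succ (n := m + 2), Fin.sum_univ_succ (n := m + 1),
        Fin.sum_univ_succ (n := m), Fin.cons_zero, Fin.cons_succ]
      simp
      module
    · simp only [energyDefect, Fin.sum_univ_succ (n := m + 2), Fin.sum_univ_succ (n := m + 1),
        Fin.sum_univ_succ (n := m), Fin.cons_zero, Fin.cons_succ, norm_smul, hne]
      simp
      ring

end Configurations

/-! ### Scales -/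

/-- The amplitudes `A`, frequencies `N` and times `t`: powers `A = Nᵅ` and `t = N^{-1-η}` with
`1 / (2σ + 1) < α < min (-s) (1 / (2σ))` and `(2σ + 1) α = 1 + 2η`. -/
theorem exists_scales {σ : ℕ} (hσ : 0 < σ) {s : ℝ} (hs : s < -(1 / (2 * (σ : ℝ) + 1))) (K : ℝ) :
    ∃ A N t : ℕ → ℝ, (∀ n, 0 < A n ∧ 1 ≤ N n ∧ 0 < t n ∧ t n ≤ 1 ∧
        t n * A n ^ (2 * σ) * K ≤ 1 / 2) ∧
      Tendsto N atTop atTop ∧ Tendsto t atTop (𝓝 0) ∧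
      Tendsto (fun n => A n * N n ^ s) atTop (𝓝 0) ∧
      Tendsto (fun n => t n * A n ^ (2 * σ)) atTop (𝓝 0) ∧
      Tendsto (fun n => t n * A n ^ (2 * σ + 1)) atTop atTop ∧
      Tendsto (fun n => t n * N n) atTop (𝓝 0) ∧
      Tendsto (fun n => t n * N n ^ 2) atTop atTop := by
  have hσ' : (1 : ℝ) ≤ σ := by exact_mod_cast hσ
  obtain ⟨α, hα1, hα2⟩ : ∃ α, 1 / (2 * (σ : ℝ) + 1) < α ∧ α < min (-s) (1 / (2 * σ)) := by
    refine exists_between (lt_min (by linarith) ?_)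
    exact one_div_lt_one_div_of_lt (by positivity) (by linarith)
  have hα3 : α < -s := hα2.trans_le (min_le_left _ _)
  have hα4 : α * (2 * σ) < 1 := by
    rw [← lt_div_iff₀ (by positivity)]
    exact hα2.trans_le (min_le_right _ _)
  have hα5 : 1 < α * (2 * σ + 1) := by
    rwa [div_lt_iff₀ (by positivity)] at hα1
  have hα6 : α < 1 := by nlinarith
  set η := (α * (2 * σ + 1) - 1) / 2 with hη
  have hη0 : 0 < η := by rw [hη]; linarith
  have hη1 : η < 1 := by rw [hη]; linarith
  set N : ℕ → ℝ := fun n => n + 1 with hN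
  have hNpos : ∀ n, 0 < N n := fun n => by positivity
  have hN1 : ∀ n, 1 ≤ N n := fun n => by simp [hN]
  have hNt : Tendsto N atTop atTop :=
    tendsto_atTop_add_const_right _ _ tendsto_natCast_atTop_atTop
  set A : ℕ → ℝ := fun n => N n ^ α with hA
  set t : ℕ → ℝ := fun n => N n ^ (-1 - η) with ht
  have hApow : ∀ (m : ℕ) n, A n ^ m = N n ^ (α * m) := fun m n => by
    rw [hA, Real.rpow_mul_natCast (hNpos n).le]
  have hdecay : ∀ {f : ℕ → ℝ} {r : ℝ}, 0 < r → (∀ n, f n = N n ^ (-r)) →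
      Tendsto f atTop (𝓝 0) := by
    intro f r hr hf
    rw [funext hf]
    exact (tendsto_rpow_neg_atTop hr).comp hNt
  have hgrow : ∀ {f : ℕ → ℝ} {r : ℝ}, 0 < r → (∀ n, f n = N n ^ r) →
      Tendsto f atTop atTop := by
    intro f r hr hf
    rw [funext hf]
    exact (tendsto_rpow_atTop hr).comp hNt
  have t1 : Tendsto t atTop (𝓝 0) := hdecay (r := 1 + η) (by linarith) fun n => by
    simp only [ht, neg_add']
  have t2 : Tendsto (fun n => A n * N n ^ s) atTop (𝓝 0) :=
    hdecay (r := -s - α) (by linarith) fun n => by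
      rw [hA, ← Real.rpow_add (hNpos n)]; congr 1; ring
  have t3 : Tendsto (fun n => t n * A n ^ (2 * σ)) atTop (𝓝 0) :=
    hdecay (r := 1 + η - α * (2 * σ)) (by linarith) fun n => by
      rw [hApow, ht, ← Real.rpow_add (hNpos n)]; congr 1; push_cast; ring
  have t4 : Tendsto (fun n => t n * A n ^ (2 * σ + 1)) atTop atTop :=
    hgrow (r := η) hη0 fun n => by
      rw [hApow, ht, ← Real.rpow_add (hNpos n)]; congr 1; push_cast; rw [hη]; ring
  have t5 : Tendsto (fun n => t n * N n) atTop (𝓝 0) :=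
    hdecay (r := η) hη0 fun n => by
      rw [ht, ← Real.rpow_add_one (hNpos n).ne']; congr 1; ring
  have t6 : Tendsto (fun n => t n * N n ^ 2) atTop atTop :=
    hgrow (r := 1 - η) (by linarith) fun n => by
      rw [ht, ← Real.rpow_natCast (N n) 2, ← Real.rpow_add (hNpos n)]; congr 1; push_cast; ring
  have t7 : Tendsto (fun n => t n * A n ^ (2 * σ) * K) atTop (𝓝 0) := by
    simpa using t3.mul_const K
  obtain ⟨n₀, hn₀⟩ := eventually_atTop.1
    (t7.eventually (ge_mem_nhds (by norm_num : (0 : ℝ) < 1 / 2)))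
  have hshift := tendsto_add_atTop_nat n₀
  refine ⟨fun n => A (n + n₀), fun n => N (n + n₀), fun n => t (n + n₀), fun n =>
    ⟨Real.rpow_pos_of_pos (hNpos _) _, hN1 _, Real.rpow_pos_of_pos (hNpos _) _,
      Real.rpow_le_one_of_one_le_of_nonpos (hN1 _) (by linarith), hn₀ _ (Nat.le_add_left _ _)⟩,
    hNt.comp hshift, t1.comp hshift, t2.comp hshift, t3.comp hshift, t4.comp hshift,
    t5.comp hshift, t6.comp hshift⟩

/-! ### Norm inflation -/

section Inflation

theorem exists_schwartz_apply_ne_zero (E : Type) [NormedAddCommGroup E] [InnerProductSpace ℝ E]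
    [FiniteDimensional ℝ E] : ∃ a : 𝓢(E, ℂ), a 0 ≠ 0 := by
  let f : ContDiffBump (0 : E) := ⟨1, 2, one_pos, one_lt_two⟩
  have hf : HasCompactSupport fun x => ((f x : ℝ) : ℂ) :=
    f.hasCompactSupport.comp_left Complex.ofReal_zero
  refine ⟨hf.toSchwartzMap (Complex.ofRealCLM.contDiff.comp f.contDiff), ?_⟩
  have h1 : f 0 = 1 := f.one_of_mem_closedBall (Metric.mem_closedBall_self f.rIn_pos.le)
  change ((f 0 : ℝ) : ℂ) ≠ 0
  simp [h1]

variable {E : Type} [NormedAddCommGroup E] [InnerProductSpace ℝ E] [FiniteDimensional ℝ E]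
  [MeasurableSpace E] [BorelSpace E]

theorem pairingCLM_schwartzConj_self_ne_zero {b : 𝓢(E, ℂ)} (hb : b ≠ 0) :
    pairingCLM (schwartzConj b) b ≠ 0 := by
  intro h
  have h1 : pairingCLM (schwartzConj b) b = ((∫ x, ‖b x‖ ^ 2 : ℝ) : ℂ) := by
    rw [pairingCLM_apply, ← integral_complex_ofReal]
    congr 1
    ext x
    rw [schwartzConj_apply, Complex.conj_mul']
    push_cast
    rfl
  rw [h1, Complex.ofReal_eq_zero, integral_eq_zero_iff_of_nonneg (fun x => by positivity)] at h
  · have h2 := (Continuous.ae_eq_iff_eq volume (b.continuous.norm.pow 2) continuous_const).1 h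
    refine hb ?_
    ext x
    have h3 : ‖b x‖ ^ 2 = 0 := congrFun h2 x
    simpa using h3
  · have h3 := (schwartzMul (schwartzConj b) b).integrable (μ := volume) |>.norm
    refine h3.congr (Eventually.of_forall fun x => ?_)
    simp [schwartzMul_apply, schwartzConj_apply, sq]

theorem picardLipschitz_mul (σ : ℕ) (A M : ℝ) :
    picardLipschitz σ (A * M) = A ^ (2 * σ) * picardLipschitz σ M := by
  rw [picardLipschitz, picardLipschitz, mul_left_comm 4 A M, mul_pow]
  ring

/-- If the pairing of `f n` with a fixed Schwartz function blows up, so do all the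
Fourier–Lebesgue norms of `f n`. -/
theorem tendsto_fourierLebesgueNorm_top {d : ℕ} {G : 𝓢(EuclideanSpace ℝ (Fin d), ℂ)}
    {f : ℕ → 𝓢(EuclideanSpace ℝ (Fin d), ℂ)}
    (h : Tendsto (fun n => ‖pairingCLM G (f n)‖) atTop atTop) {p : ℝ≥0∞} (hp : 1 ≤ p) (k : ℝ) :
    Tendsto (fun n => fourierLebesgueNorm p k (f n)) atTop (𝓝 ∞) := by
  obtain ⟨C, hC, hle⟩ := exists_enorm_integral_mul_le hp k G
  have h1 : Tendsto (fun n => ‖pairingCLM G (f n)‖ₑ / C) atTop (𝓝 ∞) := by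
    have h2 : Tendsto (fun n => ‖pairingCLM G (f n)‖ₑ) atTop (𝓝 ∞) := by
      simp only [← ofReal_norm]
      exact ENNReal.tendsto_ofReal_atTop.comp h
    have h3 := ENNReal.Tendsto.div_const (b := C) h2 (Or.inl ENNReal.top_ne_zero)
    rwa [ENNReal.top_div_of_ne_top hC] at h3
  refine tendsto_nhds_top_mono' h1 fun n => ENNReal.div_le_of_le_mul ?_
  have h4 := hle (f n)
  rw [mul_comm] at h4
  rw [pairingCLM_apply]
  simpa only [mul_comm] using h4

end Inflation

end

theorem theorem1p2 (d σ : ℕ) (hdσ : 2 ≤ d * σ) (μ : ℝ) (hμ : μ = 1 ∨ μ = -1)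
    (s : ℝ) (hs : s < -(1 / (2 * (σ : ℝ) + 1))) :
    ∃ (ψ : ℕ → ℝ → 𝓢(EuclideanSpace ℝ (Fin d), ℂ)) (t : ℕ → ℝ),
      (∀ n, 0 < t n) ∧ Tendsto t atTop (𝓝 0) ∧
      (∀ n, IsNLSSolution σ μ (t n) (ψ n)) ∧
      (∀ n, ∀ χ : ℝ → 𝓢(EuclideanSpace ℝ (Fin d), ℂ),
        IsNLSSolution σ μ (t n) χ → χ 0 = ψ n 0 → ∀ τ ∈ Set.Icc 0 (t n), χ τ = ψ n τ) ∧
      (∀ p : ℝ≥0∞, 1 ≤ p →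
        Tendsto (fun n => fourierLebesgueNorm p s (ψ n 0)) atTop (𝓝 0)) ∧
      (∀ (k : ℝ) (p : ℝ≥0∞), 1 ≤ p →
        Tendsto (fun n => fourierLebesgueNorm p k (ψ n (t n))) atTop (𝓝 ∞)) := by
  have hσ : 0 < σ := Nat.pos_of_ne_zero fun h => by simp [h] at hdσ
  have hs0 : s ≤ 0 := hs.le.trans (neg_nonpos.2 (by positivity))
  have hμ1 : |μ| = 1 := by rcases hμ with rfl | rfl <;> simp
  obtain ⟨κ, hκ, hres⟩ := exists_resonant_modes hdσ
  obtain ⟨a, ha⟩ := exists_schwartz_apply_ne_zero (EuclideanSpace ℝ (Fin d))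
  set b := powerNonlinearity σ a with hb
  have hb0 : b ≠ 0 := fun h => by
    have h1 : b 0 = 0 := by rw [h]; rfl
    rw [hb, powerNonlinearity_apply] at h1
    simp [ha] at h1
  set G := schwartzConj b with hG
  set M := packetBound (Fin 3) a with hM
  obtain ⟨A, N, t, hpos, hN, ht, hAN, htA, htA', htN, htN'⟩ :=
    exists_scales hσ hs (picardLipschitz σ M)
  set c : ℂ := -(Complex.I * μ) with hc
  have hc1 : ‖c‖ = 1 := by
    rw [hc, norm_neg, norm_mul, Complex.norm_I, one_mul, Complex.norm_real, Real.norm_eq_abs, hμ1]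
  set φ : ℕ → 𝓢(EuclideanSpace ℝ (Fin d), ℂ) := fun n => (A n : ℂ) • wavePacket κ a (N n) 0 with hφ
  have hex : ∀ n, ∃ w : C(ℝ, 𝓢(EuclideanSpace ℝ (Fin d), ℂ)),
      (∀ τ, wienerSeminorm 1 0 (w τ) ≤ 2 * (A n * M)) ∧ ∀ τ ∈ Set.Icc 0 (t n),
        w τ = φ n + c • schwartzIntegral (interactionForcing σ w) 0 τ := by
    intro n
    obtain ⟨h1, h2, h3, h4, h5⟩ := hpos n
    refine exists_interaction_solution hc1.le h3.le h4 ?_ ?_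
    · rwa [picardLipschitz_mul, ← mul_assoc]
    · rw [hφ, map_smul_eq_mul, Complex.norm_real, Real.norm_eq_abs, abs_of_pos h1]
      exact mul_lt_mul_of_pos_left (wienerSeminorm_wavePacket_lt κ a (N n) 0) h1
  choose w hwM hw using hex
  set ψ : ℕ → ℝ → 𝓢(EuclideanSpace ℝ (Fin d), ℂ) := fun n τ => schrodingerGroup τ (w n τ) with hψ
  have hψ0 : ∀ n, ψ n 0 = φ n := fun n => by
    rw [hψ]
    simp only [schrodingerGroup_zero]
    rw [hw n 0 (Set.left_mem_Icc.2 (hpos n).2.2.1.le), schwartzIntegral_self, smul_zero, add_zero]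
  have hsol : ∀ n, IsNLSSolution σ μ (t n) (ψ n) := fun n => isNLSSolution_of_interaction (hw n)
  have hdata : ∀ p : ℝ≥0∞, 1 ≤ p → Tendsto (fun n => fourierLebesgueNorm p s (φ n)) atTop (𝓝 0) := by
    intro p hp
    set B : ℝ≥0∞ := ∑ j, ENNReal.ofReal (2 ^ (-s / 2) * ‖(2 * Real.pi) • κ j‖ ^ s) *
      fourierLebesgueNorm p (-s) a with hB
    have hBtop : B ≠ ∞ := ENNReal.sum_ne_top.2 fun j _ =>
      ENNReal.mul_ne_top ENNReal.ofReal_ne_top (fourierLebesgueNorm_lt_top p (-s) a).ne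
    have h1 : ∀ n, fourierLebesgueNorm p s (φ n) ≤ ENNReal.ofReal (A n * N n ^ s) * B := by
      intro n
      obtain ⟨hA, hN1, -⟩ := hpos n
      simp only [hφ]
      rw [wavePacket_zero, fourierLebesgueNorm_smul, ENNReal.ofReal_mul hA.le, mul_assoc, hB,
        Finset.mul_sum]
      have h2 : ‖(A n : ℂ)‖ₑ = ENNReal.ofReal (A n) := by
        rw [← ofReal_norm, Complex.norm_real, Real.norm_eq_abs, abs_of_pos hA]
      rw [h2]
      gcongr
      exact (fourierLebesgueNorm_sum_le hp s _ _).trans (Finset.sum_le_sum fun j _ =>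
        fourierLebesgueNorm_modulation_le p hs0 (zero_lt_one.trans_le hN1) (hκ j) a)
    have h3 : Tendsto (fun n => ENNReal.ofReal (A n * N n ^ s) * B) atTop (𝓝 0) := by
      have h4 := ENNReal.Tendsto.mul_const (b := B) (ENNReal.tendsto_ofReal hAN) (Or.inr hBtop)
      rwa [ENNReal.ofReal_zero, zero_mul] at h4
    exact tendsto_of_tendsto_of_tendsto_of_le_of_le tendsto_const_nhds h3 (fun n => zero_le) h1
  -- the linear evolution of the data is invisible to the pairing
  have hlin : Tendsto (fun n => ‖pairingCLM G (schrodingerGroup (t n) (φ n))‖) atTop (𝓝 0) := by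
    obtain ⟨C, hC, hle⟩ := exists_enorm_integral_mul_le (le_refl (1 : ℝ≥0∞)) s G
    have h1 := ENNReal.Tendsto.const_mul (a := C) (hdata 1 le_rfl) (Or.inr hC)
    rw [mul_zero] at h1
    have h2 : Tendsto (fun n => ‖pairingCLM G (schrodingerGroup (t n) (φ n))‖ₑ) atTop (𝓝 0) := by
      refine tendsto_of_tendsto_of_tendsto_of_le_of_le tendsto_const_nhds h1
        (fun n => zero_le) fun n => ?_
      have h3 := hle (schrodingerGroup (t n) (φ n))
      rw [fourierLebesgueNorm_schrodingerGroup] at h3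
      rw [pairingCLM_apply]
      simpa only [mul_comm] using h3
    have h4 := (ENNReal.tendsto_toReal ENNReal.zero_ne_top).comp h2
    rw [ENNReal.toReal_zero] at h4
    exact h4.congr fun n => toReal_enorm _
  -- the first Duhamel iterate dominates
  have hblow : Tendsto (fun n => ‖pairingCLM G (ψ n (t n))‖) atTop atTop := by
    obtain ⟨C, hC⟩ := exists_norm_pairingCLM_solution_sub_le G σ κ a
    set Y : ℕ → ℂ := fun n => ((t n : ℝ) : ℂ)⁻¹ * ∫ τ in (0 : ℝ)..t n,
      pairingCLM G (powerNonlinearity σ (wavePacket κ a (N n) τ)) with hY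
    have hYlim : Tendsto (fun n => ‖Y n‖) atTop (𝓝 ‖resonanceCount κ σ * pairingCLM G b‖) :=
      (tendsto_average_pairingCLM_wavePacket G σ κ a hN (fun n => (hpos n).2.2.1) htN').norm
    have hYpos : 0 < ‖resonanceCount κ σ * pairingCLM G b‖ :=
      norm_pos_iff.2 (mul_ne_zero (by exact_mod_cast hres.ne')
        (pairingCLM_schwartzConj_self_ne_zero hb0))
    have herr : Tendsto (fun n => C * (t n + t n * A n ^ (2 * σ) + t n * N n)) atTop (𝓝 0) := by
      simpa using ((ht.add htA).add htN).const_mul C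
    have h1 := hYlim.sub herr
    rw [sub_zero] at h1
    have h2 := tendsto_atTop_add_const_right atTop (-1 : ℝ) (htA'.atTop_mul_pos hYpos h1)
    refine tendsto_atTop_mono' atTop ?_ h2
    filter_upwards [hlin.eventually (ge_mem_nhds one_pos)] with n hn
    obtain ⟨hA, hN1, ht0, -⟩ := hpos n
    have h3 := hC (A n) (N n) (t n) c (w n) hA hN1 ht0.le hc1 (hwM n) (hw n)
    have h4 : ∫ τ in (0 : ℝ)..t n, pairingCLM G (powerNonlinearity σ (wavePacket κ a (N n) τ)) =
        (t n : ℂ) * Y n := by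
      have : ((t n : ℝ) : ℂ) ≠ 0 := by exact_mod_cast ht0.ne'
      rw [hY]
      simp only
      rw [mul_inv_cancel_left₀ this]
    rw [h4] at h3
    have h5 : ‖c * (A n : ℂ) ^ (2 * σ + 1) * ((t n : ℂ) * Y n)‖ =
        t n * A n ^ (2 * σ + 1) * ‖Y n‖ := by
      rw [norm_mul, norm_mul, norm_mul, norm_pow, hc1, Complex.norm_real, Complex.norm_real,
        Real.norm_eq_abs, Real.norm_eq_abs, abs_of_pos hA, abs_of_pos ht0]
      ring
    set X := pairingCLM G (schrodingerGroup (t n) (w n (t n))) with hX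
    set X0 := pairingCLM G (schrodingerGroup (t n) ((A n : ℂ) • wavePacket κ a (N n) 0)) with hX0
    set Z := c * (A n : ℂ) ^ (2 * σ + 1) * ((t n : ℂ) * Y n) with hZ
    have h6 : ‖Z‖ ≤ ‖X‖ + ‖X0‖ + ‖X - X0 - Z‖ := by
      have h7 : Z = X - X0 - (X - X0 - Z) := by ring
      calc ‖Z‖ = ‖X - X0 - (X - X0 - Z)‖ := by rw [← h7]
        _ ≤ ‖X - X0‖ + ‖X - X0 - Z‖ := norm_sub_le _ _
        _ ≤ _ := by gcongr; exact norm_sub_le _ _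
    have h8 : ‖X0‖ ≤ 1 := hn
    rw [h5] at h6
    change t n * A n ^ (2 * σ + 1) * (‖Y n‖ - _) + -1 ≤ ‖X‖
    rw [mul_sub]
    linarith
  refine ⟨ψ, t, fun n => (hpos n).2.2.1, ht, hsol, fun n χ hχ h0 =>
    hχ.unique (hpos n).2.2.1.le hμ1 (hsol n) h0, fun p hp => ?_, fun k p hp =>
    tendsto_fourierLebesgueNorm_top hblow hp k⟩
  simpa only [hψ0] using hdata p hp
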